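/- Let $G$ be a connected (finite-dimensional, real) Lie group with Lie algebra $\mathfrak g$, $K$ a closed subgroup with Lie algebra $\mathfrak k$, $\pi : G \to N := G/K$ the projection onto the coset manifold, and suppose that $N$ is reductive: $\mathfrak g = \mathfrak k \oplus \mathfrak p$ with $\mathfrak p$ an $\operatorname{Ad}(K)$-invariant subspace, which is identified with $T_{eK}N$ by $d\pi_e$. Let $\nabla^N$ be the natural torsion-free connection of $N$, i.e. the $G$-invariant affine connection with $$\nabla^N_{X^\#_{eK}} Y^\# = \tfrac12 [X,Y]_{\mathfrak p} \qquad (X, Y \in \mathfrak p),$$ where $Y^\#$ is the vector field near $eK$ given by $Y^\#_{aK} = d\pi_a(dl_a Y)$ for $a \in \exp W$, $W$ a small neighbourhood of $0$ in $\mathfrak p$, and $Z_{\mathfrak p}$ is the $\mathfrak p$-component of $Z \in \mathfrak g$. Let $V_{\mathfrak g} := L^2([0,1], \mathfrak g)$ with its flat connection $D$. The parallel transport map $\Phi : V_{\mathfrak g} \to G$ is $\Phi(u) := g_u(1)$, where $g_u \in H^1([0,1],G)$ solves $dl_g^{-1}(g') = u$, $g(0) = e$; and $\Phi_N := \pi \circ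 \Phi$. For $g \in H^1([0,1],G)$ and $u \in V_{\mathfrak g}$ put $g * u := \operatorname{Ad}(g)u - dr_g^{-1}(g')$. Let $P(G, G\times K) := \{g \in H^1([0,1],G) \mid g(1) \in K\}$, let $\hat 0$ be the zero path and $\hat{\mathfrak p} \subset V_{\mathfrak g}$ the space of constant paths with values in $\mathfrak p$. Then: 1. $\mathcal H(g * \hat 0) := \operatorname{Ad}(g)\hat{\mathfrak p}$, $g \in P(G, G \times K)$, is a well-defined distribution $\mathcal H = \mathcal H^{\Phi_N}$ on $V_{\mathfrak g}$. 2. $\Phi_N : (V_{\mathfrak g}, D) \to (N, \nabla^N)$ is an affine submersion with horizontal distribution $\mathcal H$. That is, $\Phi_N$ is a smooth submersion, $\mathcal H$ is a smooth distribution with $T_u V_{\mathfrak g} = \mathcal H(u) \oplus \mathcal V(u)$, $\mathcal V(u) := \operatorname{Ker}(d\Phi_N)_u$, for every $u$, and for all smooth vector fields $X, Z$ on $N$ with horizontal lifts $\hat X, \hat Z$ the $\mathcal H$-component of $D_{\hat X}\hat Z$ is the horizontal lift of $\nabla^N_X Z$. 3. The fundamental tensor $\mathcal A(X,Y) := (D_{X^{\mathcal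 H}} Y^{\mathcal H})^{\mathcal V} + (D_{X^{\mathcal H}} Y^{\mathcal V})^{\mathcal H}$ of $\Phi_N$ is alternating on $\mathcal H \times \mathcal H$: $\mathcal A(X,Y) = -\mathcal A(Y,X)$ for all smooth horizontal vector fields $X, Y$ on $V_{\mathfrak g}$. -/

import Mathlib

open Set Filter MeasureTheory Bundle
open scoped Manifold ContDiff Topology ENNReal

noncomputable section

/-! ## Affine submersions with horizontal distribution -/

section AffineSubmersion

variable {E₁ : Type*} [NormedAddCommGroup E₁] [NormedSpace ℝ E₁]
  {M : Type*} [TopologicalSpace M] [ChartedSpace E₁ M] [IsManifold 𝓘(ℝ, E₁) 1 M]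
  {E₂ : Type*} [NormedAddCommGroup E₂] [NormedSpace ℝ E₂]
  {N : Type*} [TopologicalSpace N] [ChartedSpace E₂ N] [IsManifold 𝓘(ℝ, E₂) 1 N]

/-- Smooth vector fields. -/
def IsSmoothField (X : Π x : M, TangentSpace 𝓘(ℝ, E₁) x) : Prop :=
  ContMDiff 𝓘(ℝ, E₁) 𝓘(ℝ, E₁).tangent ∞ (fun x ↦ (⟨x, X x⟩ : TangentBundle 𝓘(ℝ, E₁) M))

/-- A smooth submersion of (possibly infinite-dimensional) manifolds: each differential is
surjective and its kernel splits. -/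
structure IsSmoothSubmersion (f : M → N) : Prop where
  contMDiff : ContMDiff 𝓘(ℝ, E₁) 𝓘(ℝ, E₂) ∞ f
  surjective : ∀ x, Function.Surjective (mfderiv 𝓘(ℝ, E₁) 𝓘(ℝ, E₂) f x)
  splits : ∀ x, (LinearMap.ker
    (mfderiv 𝓘(ℝ, E₁) 𝓘(ℝ, E₂) f x).toLinearMap).ClosedComplemented

/-- The vertical space of `f` at `x`: the kernel of the differential. -/
def verticalSpace (f : M → N) (x : M) : Submodule ℝ (TangentSpace 𝓘(ℝ, E₁) x) :=
  LinearMap.ker (mfderiv 𝓘(ℝ, E₁) 𝓘(ℝ, E₂) f x).toLinearMap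

/-- A smooth distribution of finite rank: near each point it has a smooth frame. -/
def IsSmoothDistribution (H : Π x : M, Submodule ℝ (TangentSpace 𝓘(ℝ, E₁) x)) : Prop :=
  ∀ x₀ : M, ∃ U ∈ 𝓝 x₀, ∃ (n : ℕ) (X : Fin n → Π x : M, TangentSpace 𝓘(ℝ, E₁) x),
    (∀ i, ContMDiffOn 𝓘(ℝ, E₁) 𝓘(ℝ, E₁).tangent ∞
      (fun x ↦ (⟨x, X i x⟩ : TangentBundle 𝓘(ℝ, E₁) M)) U) ∧
    ∀ x ∈ U, LinearIndependent ℝ (fun i ↦ X i x) ∧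
      Submodule.span ℝ (range fun i ↦ X i x) = H x

variable (E₁ E₂) in
open Classical in
/-- The projection of `T_x M = H x ⊕ ker (df_x)` onto `H x` (zero if there is no such
decomposition). -/
def horizontalPart (f : M → N) (H : Π x : M, Submodule ℝ (TangentSpace 𝓘(ℝ, E₁) x)) (x : M) :
    TangentSpace 𝓘(ℝ, E₁) x →ₗ[ℝ] TangentSpace 𝓘(ℝ, E₁) x :=
  if h : IsCompl (H x) (verticalSpace (E₂ := E₂) f x) then
    (H x).projection (verticalSpace (E₂ := E₂) f x) h else 0

variable (E₁ E₂) in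
/-- The complementary projection, onto the vertical space. -/
def verticalPart (f : M → N) (H : Π x : M, Submodule ℝ (TangentSpace 𝓘(ℝ, E₁) x)) (x : M) :
    TangentSpace 𝓘(ℝ, E₁) x →ₗ[ℝ] TangentSpace 𝓘(ℝ, E₁) x :=
  LinearMap.id - horizontalPart E₁ E₂ f H x

/-- `X'` is the horizontal lift of the vector field `X`. -/
def IsHorizontalLift (f : M → N) (H : Π x : M, Submodule ℝ (TangentSpace 𝓘(ℝ, E₁) x))
    (X : Π y : N, TangentSpace 𝓘(ℝ, E₂) y) (X' : Π x : M, TangentSpace 𝓘(ℝ, E₁) x) : Prop :=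
  ∀ x, X' x ∈ H x ∧ mfderiv 𝓘(ℝ, E₁) 𝓘(ℝ, E₂) f x (X' x) = X (f x)

/-- `f : (M, ∇) → (N, ∇')` is an affine submersion with horizontal distribution `H`
(Abe–Hasegawa): `f` is a submersion, `H` is a smooth distribution complementary to the vertical
distribution, and the horizontal part of `∇_{X̂} Ẑ` is the horizontal lift of `∇'_X Z`, where
`X̂`, `Ẑ` are the horizontal lifts of `X`, `Z`.
In Mathlib `∇ Z x v` stands for `(∇_v Z)(x)`. -/
structure IsAffineSubmersion
    (cov : CovariantDerivative 𝓘(ℝ, E₁) E₁ (TangentSpace 𝓘(ℝ, E₁) : M → Type _))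
    (cov' : CovariantDerivative 𝓘(ℝ, E₂) E₂ (TangentSpace 𝓘(ℝ, E₂) : N → Type _))
    (f : M → N) (H : Π x : M, Submodule ℝ (TangentSpace 𝓘(ℝ, E₁) x)) : Prop where
  submersion : IsSmoothSubmersion (E₁ := E₁) (E₂ := E₂) f
  smooth : IsSmoothDistribution H
  isCompl : ∀ x, IsCompl (H x) (verticalSpace (E₂ := E₂) f x)
  lift_cov : ∀ (X Z : Π y : N, TangentSpace 𝓘(ℝ, E₂) y)
    (X' Z' : Π x : M, TangentSpace 𝓘(ℝ, E₁) x), IsSmoothField X → IsSmoothField Z →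
    IsHorizontalLift f H X X' → IsHorizontalLift f H Z Z' →
    IsHorizontalLift f H (fun y ↦ cov' Z y (X y))
      (fun x ↦ horizontalPart E₁ E₂ f H x (cov Z' x (X' x)))

variable (E₂) in
/-- The fundamental tensor `𝒜(X, Y) = (∇_{X^H} Y^H)^V + (∇_{X^H} Y^V)^H`. -/
def fundamentalTensor
    (cov : CovariantDerivative 𝓘(ℝ, E₁) E₁ (TangentSpace 𝓘(ℝ, E₁) : M → Type _))
    (f : M → N) (H : Π x : M, Submodule ℝ (TangentSpace 𝓘(ℝ, E₁) x))
    (X Y : Π x : M, TangentSpace 𝓘(ℝ, E₁) x) (x : M) : TangentSpace 𝓘(ℝ, E₁) x :=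
  verticalPart E₁ E₂ f H x
      (cov (fun y ↦ horizontalPart E₁ E₂ f H y (Y y)) x (horizontalPart E₁ E₂ f H x (X x))) +
    horizontalPart E₁ E₂ f H x
      (cov (fun y ↦ verticalPart E₁ E₂ f H y (Y y)) x (horizontalPart E₁ E₂ f H x (X x)))

variable (E₂) in
/-- The fundamental tensor restricted to `H × H` is alternating. -/
def FundamentalTensorAlternating
    (cov : CovariantDerivative 𝓘(ℝ, E₁) E₁ (TangentSpace 𝓘(ℝ, E₁) : M → Type _))
    (f : M → N) (H : Π x : M, Submodule ℝ (TangentSpace 𝓘(ℝ, E₁) x)) : Prop :=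
  ∀ X Y : Π x : M, TangentSpace 𝓘(ℝ, E₁) x, IsSmoothField X → IsSmoothField Y →
    (∀ x, X x ∈ H x) → (∀ x, Y x ∈ H x) →
    ∀ x, fundamentalTensor E₂ cov f H X Y x = -fundamentalTensor E₂ cov f H Y X x

end AffineSubmersion

/-- A vector field on a vector space that is differentiable as a section of the tangent bundle is
differentiable as a map. -/
theorem differentiableAt_of_section {V : Type*} [NormedAddCommGroup V] [NormedSpace ℝ V]
    {σ : Π x : V, TangentSpace 𝓘(ℝ, V) x} {x : V}
    (h : MDifferentiableAt 𝓘(ℝ, V) 𝓘(ℝ, V).tangent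
      (fun y ↦ (⟨y, σ y⟩ : TangentBundle 𝓘(ℝ, V) V)) x) :
    DifferentiableAt ℝ (fun y : V ↦ (show V from σ y)) x :=
  (((contMDiff_snd_tangentBundle_modelSpace V 𝓘(ℝ, V) (n := 1)).mdifferentiable
    one_ne_zero).mdifferentiableAt.comp x h).differentiableAt

/-- The flat connection `D` of a normed space: `D_v Z` is the directional derivative. -/
def flatConnection (V : Type*) [NormedAddCommGroup V] [NormedSpace ℝ V] :
    CovariantDerivative 𝓘(ℝ, V) V (TangentSpace 𝓘(ℝ, V) : V → Type _) where
  toFun σ x := (fderiv ℝ (fun y : V ↦ (show V from σ y)) x : V →L[ℝ] V)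
  isCovariantDerivativeOnUniv :=
    { add := fun hσ hσ' _ ↦
        fderiv_add (differentiableAt_of_section hσ) (differentiableAt_of_section hσ')
      leibniz := fun {σ g x} hσ hg _ ↦ by
        have h := fderiv_smul hg.differentiableAt (differentiableAt_of_section hσ)
        have e : (mvfderiv 𝓘(ℝ, V) g x : V →L[ℝ] ℝ) = fderiv ℝ g x := by
          ext v
          simp [mvfderiv]
          rfl
        refine h.trans ?_
        rw [← e]
        rfl }

/-! ## Lie groups and reductive homogeneous spaces -/

section LieGroups

variable {E : Type*} [NormedAddCommGroup E] [NormedSpace ℝ E]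
  {G : Type*} [TopologicalSpace G] [ChartedSpace E G] [Group G]

/-- The adjoint representation: the differential at `1` of the conjugation by `a`. -/
def adjointRep (a : G) : GroupLieAlgebra 𝓘(ℝ, E) G →L[ℝ] GroupLieAlgebra 𝓘(ℝ, E) G :=
  mfderiv 𝓘(ℝ, E) 𝓘(ℝ, E) (fun x : G ↦ a * x * a⁻¹) 1

/-- `γ` is the smooth one-parameter subgroup of `G` with initial velocity `X`. -/
structure IsOneParameterSubgroup (γ : ℝ → G) (X : GroupLieAlgebra 𝓘(ℝ, E) G) : Prop where
  map_add : ∀ s t, γ (s + t) = γ s * γ t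
  contMDiff : ContMDiff 𝓘(ℝ, ℝ) 𝓘(ℝ, E) ∞ γ
  velocity : mfderiv 𝓘(ℝ, ℝ) 𝓘(ℝ, E) γ 0 (1 : ℝ) = X

open Classical in
/-- The exponential map of a Lie group. -/
def lieExp (X : GroupLieAlgebra 𝓘(ℝ, E) G) : G :=
  if h : ∃ γ : ℝ → G, IsOneParameterSubgroup γ X then h.choose 1 else 1

variable (E) in
/-- The Lie algebra of a (closed) subgroup `K`: the span of (in fact, the set of) the initial
velocities of the one-parameter subgroups of `G` that stay in `K`. -/
def subgroupLieAlgebra (K : Subgroup G) : Submodule ℝ (GroupLieAlgebra 𝓘(ℝ, E) G) :=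
  Submodule.span ℝ {X | ∃ γ : ℝ → G, IsOneParameterSubgroup γ X ∧ ∀ t, γ t ∈ K}

/-- `𝔤 = 𝔨 ⊕ 𝔭` with `𝔭` an `Ad(K)`-invariant subspace. -/
structure IsReductiveDecomposition (K : Subgroup G)
    (𝔭 : Submodule ℝ (GroupLieAlgebra 𝓘(ℝ, E) G)) : Prop where
  isCompl : IsCompl (subgroupLieAlgebra E K) 𝔭
  adjointRep_mem : ∀ k ∈ K, ∀ X ∈ 𝔭, adjointRep k X ∈ 𝔭

/-- The `𝔭`-component of `X ∈ 𝔤 = 𝔨 ⊕ 𝔭`. -/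
def pComponent {K : Subgroup G} {𝔭 : Submodule ℝ (GroupLieAlgebra 𝓘(ℝ, E) G)}
    (h : IsReductiveDecomposition K 𝔭) :
    GroupLieAlgebra 𝓘(ℝ, E) G →ₗ[ℝ] GroupLieAlgebra 𝓘(ℝ, E) G :=
  𝔭.projection (subgroupLieAlgebra E K) h.isCompl.symm

variable {F : Type*} [NormedAddCommGroup F] [NormedSpace ℝ F]

variable (E) in
/-- The differential at `a` of the projection `π : G → G/K`. -/
def dproj (K : Subgroup G) [ChartedSpace F (G ⧸ K)] (a : G) :
    TangentSpace 𝓘(ℝ, E) a →L[ℝ] TangentSpace 𝓘(ℝ, F) (a : G ⧸ K) :=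
  mfderiv 𝓘(ℝ, E) 𝓘(ℝ, F) (fun x : G ↦ (x : G ⧸ K)) a

/-- `Z` coincides near `eK` with the local vector field `Y^♯` of `Y ∈ 𝔭`, which is defined by
`Y^♯(aK) = dπ_a (dl_a Y)` for `a ∈ exp W`, with `W` a small neighbourhood of `0` in `𝔭`. -/
def EqSharpNearBase {K : Subgroup G} [ChartedSpace F (G ⧸ K)]
    (𝔭 : Submodule ℝ (GroupLieAlgebra 𝓘(ℝ, E) G)) (Y : GroupLieAlgebra 𝓘(ℝ, E) G)
    (Z : Π y : G ⧸ K, TangentSpace 𝓘(ℝ, F) y) : Prop :=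
  ∃ W ∈ 𝓝 (0 : 𝔭), ∀ P ∈ W,
    Z (lieExp (P : GroupLieAlgebra 𝓘(ℝ, E) G) : G) =
      dproj E K (lieExp (P : GroupLieAlgebra 𝓘(ℝ, E) G))
        (mulInvariantVectorField Y (lieExp (P : GroupLieAlgebra 𝓘(ℝ, E) G)))

/-- A connection on `G/K` is `G`-invariant if `∇_{dL_a v} (dL_a Z) = dL_a (∇_v Z)`. Here `Z'` is
the push-forward of `Z` by `L_a`. -/
def IsInvariantConnection {K : Subgroup G} [ChartedSpace F (G ⧸ K)] [IsManifold 𝓘(ℝ, F) 1 (G ⧸ K)]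
    (cov : CovariantDerivative 𝓘(ℝ, F) F (TangentSpace 𝓘(ℝ, F) : G ⧸ K → Type _)) : Prop :=
  ∀ (a : G) (Z Z' : Π y : G ⧸ K, TangentSpace 𝓘(ℝ, F) y), IsSmoothField Z → IsSmoothField Z' →
    (∀ y, Z' (a • y) = mfderiv 𝓘(ℝ, F) 𝓘(ℝ, F) (fun x : G ⧸ K ↦ a • x) y (Z y)) →
    ∀ (y : G ⧸ K) (v : TangentSpace 𝓘(ℝ, F) y),
      cov Z' (a • y) (mfderiv 𝓘(ℝ, F) 𝓘(ℝ, F) (fun x : G ⧸ K ↦ a • x) y v) =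
        mfderiv 𝓘(ℝ, F) 𝓘(ℝ, F) (fun x : G ⧸ K ↦ a • x) y (cov Z y v)

/-- The natural torsion-free connection of a reductive homogeneous space: the `G`-invariant
connection whose connection function is `α(X, Y) = ½ [X, Y]_𝔭`, that is
`∇_{X^♯_{eK}} Y^♯ = ½ [X, Y]_𝔭` for `X, Y ∈ 𝔭`, where `𝔭` is identified with `T_{eK}(G/K)`
by `dπ_e`. -/
structure IsNaturalTorsionFree {K : Subgroup G} [ChartedSpace F (G ⧸ K)]
    [IsManifold 𝓘(ℝ, F) 1 (G ⧸ K)]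
    {𝔭 : Submodule ℝ (GroupLieAlgebra 𝓘(ℝ, E) G)} (h : IsReductiveDecomposition K 𝔭)
    (cov : CovariantDerivative 𝓘(ℝ, F) F (TangentSpace 𝓘(ℝ, F) : G ⧸ K → Type _)) : Prop where
  invariant : IsInvariantConnection cov
  cov_sharp : ∀ X ∈ 𝔭, ∀ Y ∈ 𝔭, ∀ Z : Π y : G ⧸ K, TangentSpace 𝓘(ℝ, F) y, IsSmoothField Z →
    EqSharpNearBase 𝔭 Y Z →
    cov Z ((1 : G) : G ⧸ K) (dproj E K 1 X) = dproj E K 1 ((1 / 2 : ℝ) • pComponent h ⁅X, Y⁆)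

/-! ## Paths and the parallel transport map -/

/-- `g : [0,1] → G` is a Sobolev `H¹`-path: it is continuous and, locally in charts, absolutely
continuous with square integrable derivative. (Only the values of `g` on `[0,1]` matter.) -/
def IsH1Path (g : ℝ → G) : Prop :=
  ContinuousOn g (Icc 0 1) ∧
  ∀ t₀ ∈ Icc (0 : ℝ) 1, ∃ (x : G) (a b : ℝ), 0 ≤ a ∧ a < b ∧ b ≤ 1 ∧ Icc a b ∈ 𝓝[Icc 0 1] t₀ ∧
    MapsTo g (Icc a b) (chartAt E x).source ∧
    AbsolutelyContinuousOnInterval (fun t ↦ chartAt E x (g t)) a b ∧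
    MemLp (deriv fun t ↦ chartAt E x (g t)) 2 (volume.restrict (Icc a b))

/-- The velocity `g'(t)`. For an `H¹`-path it exists for almost every `t`. -/
def pathVelocity (g : ℝ → G) (t : ℝ) : TangentSpace 𝓘(ℝ, E) (g t) :=
  mfderiv 𝓘(ℝ, ℝ) 𝓘(ℝ, E) g t (1 : ℝ)

/-- `dl_g⁻¹ (g')`. -/
def leftLogDeriv (g : ℝ → G) (t : ℝ) : GroupLieAlgebra 𝓘(ℝ, E) G :=
  mfderiv 𝓘(ℝ, E) 𝓘(ℝ, E) (fun x : G ↦ (g t)⁻¹ * x) (g t) (pathVelocity g t)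

/-- `dr_g⁻¹ (g')`. -/
def rightLogDeriv (g : ℝ → G) (t : ℝ) : GroupLieAlgebra 𝓘(ℝ, E) G :=
  mfderiv 𝓘(ℝ, E) 𝓘(ℝ, E) (fun x : G ↦ x * (g t)⁻¹) (g t) (pathVelocity g t)

variable (E) in
/-- `P(G, U) = {g ∈ H¹([0,1], G) | (g(0), g(1)) ∈ U}`. -/
def pathSpace (U : Set (G × G)) : Set (ℝ → G) :=
  {g | IsH1Path (E := E) g ∧ (g 0, g 1) ∈ U}

variable (E) in
/-- The Hilbertable space `V_𝔤 = L²([0,1], 𝔤)`. The underlying vector space of the Lie algebra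
`𝔤 = T_e G` is the model space `E` of `G`, whose norm is used to define the topology of `L²`. -/
abbrev PathAlgebra : Type _ := Lp E 2 (volume.restrict (Icc (0 : ℝ) 1))

/-- `u ∈ V_𝔤` as a path in the Lie algebra of `G`. -/
def PathAlgebra.toPath (u : PathAlgebra E) (t : ℝ) : GroupLieAlgebra 𝓘(ℝ, E) G := u t

open Classical in
/-- The gauge action `g * u = Ad(g) u - dr_g⁻¹ (g')`; the right side is square integrable for every
`H¹`-path `g`. -/
def gaugeAction (g : ℝ → G) (u : PathAlgebra E) : PathAlgebra E :=
  if h : MemLp (fun t ↦ (show E from adjointRep (g t) (u.toPath t) - rightLogDeriv g t)) 2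
      (volume.restrict (Icc (0 : ℝ) 1)) then h.toLp else 0

/-- `g` is the solution of `dl_g⁻¹ (g') = u`, `g(0) = e` in `H¹([0,1], G)`. -/
structure IsTransport (u : PathAlgebra E) (g : ℝ → G) : Prop where
  isH1Path : IsH1Path (E := E) g
  initial : g 0 = 1
  equation : ∀ᵐ t ∂(volume.restrict (Icc (0 : ℝ) 1)), leftLogDeriv g t = u.toPath t

open Classical in
/-- The parallel transport map `Φ : V_𝔤 → G`, `Φ(u) = g_u(1)`. -/
def parallelTransport (u : PathAlgebra E) : G :=
  if h : ∃ g : ℝ → G, IsTransport u g then h.choose 1 else 1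

/-- The parallel transport map `Φ_N = π ∘ Φ : V_𝔤 → G/K`. -/
def parallelTransportQuotient (K : Subgroup G) (u : PathAlgebra E) : G ⧸ K :=
  (parallelTransport u : G)

/-- `Ad(g) 𝔭̂`, where `𝔭̂ ⊆ V_𝔤` is the space of constant paths with values in `𝔭`. -/
def adConstPaths (g : ℝ → G) (𝔭 : Submodule ℝ (GroupLieAlgebra 𝓘(ℝ, E) G)) :
    Submodule ℝ (PathAlgebra E) where
  carrier := {w | ∃ X ∈ 𝔭, ∀ᵐ t ∂(volume.restrict (Icc (0 : ℝ) 1)),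
    w.toPath t = adjointRep (g t) X}
  add_mem' := by
    rintro v w ⟨X, hX, hv⟩ ⟨Y, hY, hw⟩
    refine ⟨X + Y, 𝔭.add_mem hX hY, ?_⟩
    filter_upwards [hv, hw, Lp.coeFn_add v w] with t h₁ h₂ h₃
    rw [map_add, ← h₁, ← h₂]
    exact h₃
  zero_mem' := by
    refine ⟨0, 𝔭.zero_mem, ?_⟩
    filter_upwards [Lp.coeFn_zero E 2 (volume.restrict (Icc (0 : ℝ) 1))] with t h
    rw [map_zero]
    exact h
  smul_mem' := by
    rintro c w ⟨X, hX, hw⟩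
    refine ⟨c • X, 𝔭.smul_mem c hX, ?_⟩
    filter_upwards [hw, Lp.coeFn_smul c w] with t h₁ h₂
    rw [map_smul, ← h₁]
    exact h₂

/-- The horizontal distribution `H(g * 0̂) = Ad(g) 𝔭̂`, `g ∈ P(G, G × K)`, of `Φ_N`. (For a fixed
point the subspaces `Ad(g) 𝔭̂` agree, so that their sum is any one of them.) -/
def horizontalDistribution (K : Subgroup G) (𝔭 : Submodule ℝ (GroupLieAlgebra 𝓘(ℝ, E) G))
    (u : PathAlgebra E) : Submodule ℝ (TangentSpace 𝓘(ℝ, PathAlgebra E) u) :=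
  ⨆ (g : ℝ → G) (_ : g ∈ pathSpace E (univ ×ˢ (K : Set G)) ∧ gaugeAction g 0 = u),
    (adConstPaths g 𝔭 : Submodule ℝ (PathAlgebra E))

end LieGroups

end

/-! Write g_u for the transport of u and F_u(t) = Ad(g_u(t)⁻¹ Φ(u)) (`adFrame`). Everything rests on
the cocycle identity g_{u+v} = g_w g_u with w = Ad(g_u) v (`transport_add`). Since v ↦ w is bounded
and linear, smoothness and derivatives at any u reduce to the zero control. Near the zero control
the transport stays in the chart at 1, and the implicit function theorem in C([0,1], E), applied to
the integral equation in the chart, gives a solution depending smoothly on u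
(`exists_controlled_solution`, `exists_local_transport`). Products of such short transports give all
transports (`exists_transports`).

Well-definedness: if u = g * 0̂, then g_u = g(0) g⁻¹, so g(t) g(1)⁻¹ = g_u(t)⁻¹ Φ(u). As Ad(g(1))
preserves 𝔭, Ad(g) 𝔭̂ = F_u 𝔭̂, which depends on u alone (`adConstPaths_eq`). Every u occurs, with g
= g_u⁻¹ Φ(u) (`exists_gaugeAction_eq`).

Two derivatives carry the rest: dΦ_u (F_u c) = dl_{Φ(u)} ∫₀¹ c
(`modelDeriv_comp_parallelTransport`), and the derivative of F at u along F_u c is t ↦ F_u(t)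
ad(∫_t^1 c) (`contDiff_adFrame`). Hence a horizontal field v ↦ F_v η(v) has, along F_u ξ, the
derivative F_u((1 - t)[ξ, η(u)]) + F_u dη(F_u ξ) (`hasFDerivAt_horizontalMap`).

Affine submersion: dΦ_N sends this vector to dπ dl (½[ξ, η(u)] + dη(F_u ξ)), because 1 - t has mean
½. In terms of 𝔭-valued lifts to G, ∇^N is given by the same expression
(`IsNaturalTorsionFree.cov_lift`): near eK a field is expanded in the fields Y^♯, the Leibniz rule
is applied, and G-invariance moves the result to all points.

Alternation: the term F_u dη is horizontal, so 𝒜 is the vertical part of F_u((1 - t)[ξ, η(u)]),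
which is skew because the bracket is.

Three facts connect the definitions with this calculus: the bracket of left-invariant fields is the
derivative of Ad (`bracket_eq_adDeriv`), exp X = Φ(X̂) for the constant path X̂ (`lieExp_eq`), and
Ker dπ_e = 𝔨 (`projDeriv_eq_zero_iff`). -/

noncomputable section

set_option linter.unusedSectionVars false

/-! ## Absolutely continuous functions -/

section AbsolutelyContinuous

variable {X Y : Type*} [PseudoMetricSpace X] [PseudoMetricSpace Y]

/-- The sums of increments of `g` are at most `C` times those of `f`. Lipschitz images and
vector-valued indefinite integrals are reduced to this comparison. -/
theorem AbsolutelyContinuousOnInterval.of_dist_le {f : ℝ → X} {g : ℝ → Y} {a b C : ℝ}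
    (hf : AbsolutelyContinuousOnInterval f a b)
    (h : ∀ s ∈ uIcc a b, ∀ t ∈ uIcc a b, dist (g s) (g t) ≤ C * dist (f s) (f t)) :
    AbsolutelyContinuousOnInterval g a b := by
  have hC := Filter.Tendsto.const_mul C hf
  rw [mul_zero] at hC
  refine squeeze_zero' (Eventually.of_forall fun _ ↦ Finset.sum_nonneg fun _ _ ↦ dist_nonneg) ?_ hC
  have : ∀ᶠ (E : ℕ × (ℕ → ℝ × ℝ)) in AbsolutelyContinuousOnInterval.totalLengthFilter ⊓
      𝓟 (AbsolutelyContinuousOnInterval.disjWithin a b),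
      E ∈ AbsolutelyContinuousOnInterval.disjWithin a b :=
    eventually_inf_principal.mpr (by simp)
  filter_upwards [this] with E hE
  rw [Finset.mul_sum]
  exact Finset.sum_le_sum fun i hi ↦ h _ (hE.1 i hi).1 _ (hE.1 i hi).2

theorem AbsolutelyContinuousOnInterval.congr {f g : ℝ → X} {a b : ℝ}
    (hf : AbsolutelyContinuousOnInterval f a b) (h : EqOn f g (uIcc a b)) :
    AbsolutelyContinuousOnInterval g a b :=
  hf.of_dist_le (C := 1) fun s hs t ht ↦ by rw [h hs, h ht, one_mul]

theorem AbsolutelyContinuousOnInterval.prodMk {f : ℝ → X} {g : ℝ → Y} {a b : ℝ}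
    (hf : AbsolutelyContinuousOnInterval f a b) (hg : AbsolutelyContinuousOnInterval g a b) :
    AbsolutelyContinuousOnInterval (fun t ↦ (f t, g t)) a b := by
  have hC := Tendsto.add hf hg
  rw [add_zero] at hC
  refine squeeze_zero (fun _ ↦ Finset.sum_nonneg fun _ _ ↦ dist_nonneg) (fun E ↦ ?_) hC
  rw [← Finset.sum_add_distrib]
  exact Finset.sum_le_sum fun i _ ↦ max_le_add_of_nonneg dist_nonneg dist_nonneg

/-- Increments of the integral are bounded by those of the real-valued integral of ‖f‖. -/
theorem IntervalIntegrable.absolutelyContinuousOnInterval_integral {E : Type*}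
    [NormedAddCommGroup E] [NormedSpace ℝ E] {f : ℝ → E} {a b c : ℝ}
    (h : IntervalIntegrable f volume a b) (hc : c ∈ uIcc a b) :
    AbsolutelyContinuousOnInterval (fun x ↦ ∫ v in c..x, f v) a b := by
  refine (h.norm.absolutelyContinuousOnInterval_intervalIntegral hc).of_dist_le (C := 1) ?_
  intro s hs t ht
  have hi : ∀ x ∈ uIcc a b, IntervalIntegrable f volume c x := fun x hx ↦
    h.mono_set (uIcc_subset_uIcc hc hx)
  rw [dist_eq_norm, dist_eq_norm, one_mul,
    intervalIntegral.integral_interval_sub_left (hi s hs) (hi t ht),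
    intervalIntegral.integral_interval_sub_left (hi s hs).norm (hi t ht).norm,
    Real.norm_eq_abs]
  exact intervalIntegral.norm_integral_le_abs_integral_norm

/-- `f` is absolutely continuous on an interval that is a neighbourhood of `t₀` in `[0,1]`. -/
def ACNear (f : ℝ → X) (t₀ : ℝ) : Prop :=
  ∃ a b : ℝ, 0 ≤ a ∧ a < b ∧ b ≤ 1 ∧ Icc a b ∈ 𝓝[Icc 0 1] t₀ ∧
    AbsolutelyContinuousOnInterval f a b

theorem exists_Icc_subset_of_mem_nhdsWithin {t₀ : ℝ} (ht : t₀ ∈ Icc (0 : ℝ) 1) {U : Set ℝ}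
    (hU : U ∈ 𝓝[Icc 0 1] t₀) :
    ∃ a b : ℝ, 0 ≤ a ∧ a < b ∧ b ≤ 1 ∧ Icc a b ∈ 𝓝[Icc 0 1] t₀ ∧ Icc a b ⊆ U := by
  obtain ⟨ε, hε, h⟩ := Metric.mem_nhdsWithin_iff.1 hU
  refine ⟨max 0 (t₀ - ε / 2), min 1 (t₀ + ε / 2), le_max_left _ _, ?_, min_le_left _ _, ?_, ?_⟩
  · rw [max_lt_iff, lt_min_iff, lt_min_iff]
    refine ⟨⟨one_pos, ?_⟩, ?_, ?_⟩ <;> linarith [ht.1, ht.2]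
  · refine Metric.mem_nhdsWithin_iff.2 ⟨ε / 2, by positivity, ?_⟩
    rintro t ⟨h₁, h₂⟩
    rw [Metric.mem_ball, Real.dist_eq, abs_lt] at h₁
    exact ⟨max_le h₂.1 (by linarith), le_min h₂.2 (by linarith)⟩
  · rintro t ⟨h₁, h₂⟩
    rw [max_le_iff] at h₁
    rw [le_min_iff] at h₂
    refine h ⟨?_, h₁.1, h₂.1⟩
    rw [Metric.mem_ball, Real.dist_eq, abs_lt]
    constructor <;> linarith

theorem ACNear.exists_subset {f : ℝ → X} {t₀ : ℝ} (hf : ACNear f t₀) (ht : t₀ ∈ Icc (0 : ℝ) 1)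
    {U : Set ℝ} (hU : U ∈ 𝓝[Icc 0 1] t₀) :
    ∃ a b : ℝ, 0 ≤ a ∧ a < b ∧ b ≤ 1 ∧ Icc a b ∈ 𝓝[Icc 0 1] t₀ ∧ Icc a b ⊆ U ∧
      AbsolutelyContinuousOnInterval f a b := by
  obtain ⟨a, b, -, hab, -, hn, hac⟩ := hf
  obtain ⟨c, d, h₀, hcd, h₁, hn', hs⟩ := exists_Icc_subset_of_mem_nhdsWithin ht (inter_mem hn hU)
  refine ⟨c, d, h₀, hcd, h₁, hn', hs.trans inter_subset_right, hac.mono ?_⟩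
  rw [uIcc_of_le hab.le, uIcc_of_le hcd.le]
  exact hs.trans inter_subset_left

theorem ACNear.continuousWithinAt {E : Type*} [SeminormedAddCommGroup E] {f : ℝ → E} {t₀ : ℝ}
    (hf : ACNear f t₀) (ht : t₀ ∈ Icc (0 : ℝ) 1) : ContinuousWithinAt f (Icc 0 1) t₀ := by
  obtain ⟨a, b, -, hab, -, hn, hac⟩ := hf
  have hc : ContinuousOn f (Icc a b) := uIcc_of_le hab.le ▸ hac.continuousOn
  exact (hc t₀ (mem_of_mem_nhdsWithin ht hn)).mono_of_mem_nhdsWithin hn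

theorem ACNear.prodMk {f : ℝ → X} {g : ℝ → Y} {t₀ : ℝ} (hf : ACNear f t₀) (hg : ACNear g t₀)
    (ht : t₀ ∈ Icc (0 : ℝ) 1) : ACNear (fun t ↦ (f t, g t)) t₀ := by
  obtain ⟨a, b, -, hab, -, hn, hac⟩ := hg
  obtain ⟨c, d, h₀, hcd, h₁, hn', hs, hac'⟩ := hf.exists_subset ht hn
  refine ⟨c, d, h₀, hcd, h₁, hn', hac'.prodMk (hac.mono ?_)⟩
  rwa [uIcc_of_le hab.le, uIcc_of_le hcd.le]

theorem ACNear.congr {f g : ℝ → X} {t₀ : ℝ} (hf : ACNear f t₀) (ht : t₀ ∈ Icc (0 : ℝ) 1)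
    (h : f =ᶠ[𝓝[Icc 0 1] t₀] g) : ACNear g t₀ := by
  obtain ⟨a, b, h₀, hab, h₁, hn, hs, hac⟩ := hf.exists_subset ht h
  refine ⟨a, b, h₀, hab, h₁, hn, hac.congr ?_⟩
  rw [uIcc_of_le hab.le]
  exact hs

theorem ACNear.comp_contDiffAt {E E' : Type*} [NormedAddCommGroup E] [NormedSpace ℝ E]
    [NormedAddCommGroup E'] [NormedSpace ℝ E'] {f : ℝ → E} {t₀ : ℝ} (hf : ACNear f t₀)
    (ht : t₀ ∈ Icc (0 : ℝ) 1) {F : E → E'} (hF : ContDiffAt ℝ 1 F (f t₀)) :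
    ACNear (fun t ↦ F (f t)) t₀ := by
  obtain ⟨K, s, hs, hK⟩ := hF.exists_lipschitzOnWith
  obtain ⟨a, b, h₀, hab, h₁, hn, hsub, hac⟩ :=
    hf.exists_subset ht ((hf.continuousWithinAt ht).preimage_mem_nhdsWithin hs)
  refine ⟨a, b, h₀, hab, h₁, hn, hac.of_dist_le (C := K) ?_⟩
  rw [uIcc_of_le hab.le]
  exact fun u hu v hv ↦ hK.dist_le_mul _ (hsub hu) _ (hsub hv)

/-- A set that is null near each of its points is null. -/
theorem ae_restrict_of_forall_nhdsWithin {s : Set ℝ} (hs : MeasurableSet s) {p : ℝ → Prop}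
    (h : ∀ t₀ ∈ s, ∃ U ∈ 𝓝[s] t₀, ∀ᵐ t, t ∈ U → t ∈ s → p t) :
    ∀ᵐ t ∂(volume.restrict s), p t := by
  rw [ae_restrict_iff' hs, ae_iff]
  have e : {a | ¬(a ∈ s → p a)} = {a | a ∈ s ∧ ¬ p a} := by ext; simp
  rw [e]
  refine measure_null_of_locally_null _ fun t ht ↦ ?_
  obtain ⟨U, hU, hp⟩ := h t ht.1
  refine ⟨U ∩ {a | a ∈ s ∧ ¬ p a}, inter_mem (nhdsWithin_mono t (fun a ha ↦ ha.1) hU)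
    self_mem_nhdsWithin, ?_⟩
  rw [ae_iff] at hp
  refine measure_mono_null ?_ hp
  rintro a ⟨ha, hb, hc⟩
  simp [ha, hb, hc]

theorem ACNear.exists_ae_differentiableAt {E : Type*} [NormedAddCommGroup E] [NormedSpace ℝ E]
    [FiniteDimensional ℝ E] {f : ℝ → E} {t₀ : ℝ} (hf : ACNear f t₀) :
    ∃ U ∈ 𝓝[Icc 0 1] t₀, ∀ᵐ t, t ∈ U → DifferentiableAt ℝ f t := by
  obtain ⟨a, b, -, hab, -, hn, hac⟩ := hf
  refine ⟨_, hn, ?_⟩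
  have := hac.boundedVariationOn.ae_differentiableAt_of_mem_uIcc
  rwa [uIcc_of_le hab.le] at this

theorem eqOn_of_forall_eventually_eq {α : Type*} {f : ℝ → α} {c : ℝ}
    (h : ∀ t₀ ∈ Icc (0 : ℝ) c, ∀ᶠ t in 𝓝[Icc 0 c] t₀, f t = f t₀) :
    ∀ t ∈ Icc (0 : ℝ) c, f t = f 0 := by
  intro t ht
  have h0 : (0 : ℝ) ∈ Icc 0 c := ⟨le_rfl, ht.1.trans ht.2⟩
  have : Fact ((0 : ℝ) ≤ c) := ⟨h0.2⟩
  have hl : IsLocallyConstant (fun s : Icc (0 : ℝ) c ↦ f s) := by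
    refine (IsLocallyConstant.iff_eventually_eq _).2 fun s ↦ ?_
    have := h s s.2
    rw [nhdsWithin_eq_map_subtype_coe s.2] at this
    exact this
  have hp : PreconnectedSpace (Icc (0 : ℝ) c) := Subtype.preconnectedSpace isPreconnected_Icc
  exact hl.apply_eq_of_isPreconnected isPreconnected_univ (mem_univ ⟨t, ht⟩) (mem_univ ⟨0, h0⟩)

end AbsolutelyContinuous

/-- A function that is smooth near a point agrees near the point with a smooth function. -/
theorem exists_contDiff_eventuallyEq {E E' : Type*} [NormedAddCommGroup E] [NormedSpace ℝ E]
    [FiniteDimensional ℝ E] [NormedAddCommGroup E'] [NormedSpace ℝ E'] {f : E → E'} {z : E}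
    (hf : ∀ᶠ w in 𝓝 z, ContDiffAt ℝ ∞ f w) : ∃ F : E → E', ContDiff ℝ ∞ F ∧ F =ᶠ[𝓝 z] f := by
  obtain ⟨ε, hε, h⟩ := Metric.eventually_nhds_iff_ball.1 hf
  -- The outer radius ε / 2 keeps the support inside the ball on which `f` is smooth, so that the
  -- product extends smoothly by 0.
  let χ : ContDiffBump z := ⟨ε / 4, ε / 2, by positivity, by linarith⟩
  refine ⟨fun w ↦ χ w • f w, contDiff_iff_contDiffAt.2 fun w ↦ ?_, ?_⟩
  · by_cases hw : w ∈ Metric.ball z ε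
    · exact χ.contDiffAt.smul (h w hw)
    · have : (fun w ↦ χ w • f w) =ᶠ[𝓝 w] fun _ ↦ 0 := by
        have hc : (Metric.closedBall z (ε / 2))ᶜ ∈ 𝓝 w := by
          refine Metric.isClosed_closedBall.isOpen_compl.mem_nhds ?_
          simp only [Metric.mem_ball, not_lt] at hw
          simp only [mem_compl_iff, Metric.mem_closedBall, not_le]
          linarith
        filter_upwards [hc] with y hy
        have : y ∉ Function.support χ := by
          rw [χ.support_eq]
          exact fun hy' ↦ hy (Metric.ball_subset_closedBall hy')
        rw [Function.notMem_support.1 this, zero_smul]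
      exact contDiffAt_const.congr_of_eventuallyEq this
  · filter_upwards [χ.eventuallyEq_one] with w hw
    rw [hw, Pi.one_apply, one_smul]

/-! ## Composition with smooth functions on spaces of continuous functions -/

section Nemytskii

universe u

variable {K : Type*} [TopologicalSpace K] [CompactSpace K]
  {E : Type u} [NormedAddCommGroup E] [NormedSpace ℝ E]
  {E' : Type u} [NormedAddCommGroup E'] [NormedSpace ℝ E']

instance : SeminormedAddCommGroup C(K, E →L[ℝ] E') := ContinuousMap.instSeminormedAddCommGroup

instance : NormedAddCommGroup C(K, E →L[ℝ] E') := ContinuousMap.instNormedAddCommGroup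

instance : NormedSpace ℝ C(K, E →L[ℝ] E') := ContinuousMap.normedSpace

/-- Post-composition with a continuous function. -/
def nemytskii (K : Type*) [TopologicalSpace K] (f : C(E, E')) (x : C(K, E)) : C(K, E') := f.comp x

variable (K E E') in
/-- Pointwise application of a path of operators, as a bilinear map. -/
def pointwiseApplyₗ : C(K, E →L[ℝ] E') →ₗ[ℝ] C(K, E) →ₗ[ℝ] C(K, E') :=
  LinearMap.mk₂ ℝ (fun (A : C(K, E →L[ℝ] E')) (x : C(K, E)) ↦
    (⟨fun t ↦ A t (x t), A.continuous.clm_apply x.continuous⟩ : C(K, E')))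
    (fun _ _ _ ↦ by ext; simp) (fun _ _ _ ↦ by ext; simp) (fun _ _ _ ↦ by ext; simp)
    (fun _ _ _ ↦ by ext; simp)

variable (K E E') in
/-- Pointwise application of a path of operators, as a bounded bilinear map. -/
def pointwiseApply : C(K, E →L[ℝ] E') →L[ℝ] C(K, E) →L[ℝ] C(K, E') :=
  LinearMap.mkContinuous₂ (pointwiseApplyₗ K E E') 1
    (fun A x ↦ by
      rw [one_mul]
      refine (ContinuousMap.norm_le _ (by positivity)).2 fun t ↦ ?_
      exact (A t).le_of_opNorm_le_of_le (A.norm_coe_le_norm t) (x.norm_coe_le_norm t))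

/-- The mean value inequality is applied at each time t. Uniform continuity of `fderiv ℝ f` on a
bounded ball makes the estimate uniform in t. -/
theorem hasFDerivAt_nemytskii [FiniteDimensional ℝ E] {f : E → E'} (hf : ContDiff ℝ 1 f)
    (x : C(K, E)) :
    HasFDerivAt (nemytskii K ⟨f, hf.continuous⟩) (pointwiseApply K E E'
      (nemytskii K ⟨fderiv ℝ f, hf.continuous_fderiv one_ne_zero⟩ x)) x := by
  have := FiniteDimensional.proper_real E
  rw [hasFDerivAt_iff_isLittleO_nhds_zero, Asymptotics.isLittleO_iff]
  intro c hc
  -- The radius ‖x‖ + 1 covers all values of `x` and of its perturbations `x + y` with ‖y‖ < 1.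
  have huc : UniformContinuousOn (fderiv ℝ f) (Metric.closedBall 0 (‖x‖ + 1)) :=
    (isCompact_closedBall _ _).uniformContinuousOn_of_continuous
      (hf.continuous_fderiv one_ne_zero).continuousOn
  obtain ⟨δ, hδ, h⟩ := Metric.uniformContinuousOn_iff.1 huc c hc
  filter_upwards [Metric.ball_mem_nhds (0 : C(K, E)) (lt_min hδ one_pos)] with y hy
  rw [mem_ball_zero_iff, lt_min_iff] at hy
  refine (ContinuousMap.norm_le _ (by positivity)).2 fun t ↦ ?_
  have hb : ∀ z ∈ Metric.closedBall (x t) ‖y‖, ‖fderiv ℝ f z - fderiv ℝ f (x t)‖ ≤ c := by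
    intro z hz
    rw [Metric.mem_closedBall] at hz
    rw [← dist_eq_norm]
    refine (h z ?_ (x t) ?_ (hz.trans_lt hy.1)).le
    · rw [mem_closedBall_zero_iff]
      calc ‖z‖ ≤ ‖x t‖ + dist z (x t) := by
            rw [dist_eq_norm]; exact norm_le_norm_add_norm_sub' _ _
        _ ≤ _ := add_le_add (x.norm_coe_le_norm t) (hz.trans hy.2.le)
    · rw [mem_closedBall_zero_iff]
      linarith [x.norm_coe_le_norm t]
  have hm := (convex_closedBall (x t) ‖y‖).norm_image_sub_le_of_norm_hasFDerivWithin_le'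
    (f := f) (f' := fderiv ℝ f) (φ := fderiv ℝ f (x t)) (x := x t) (y := x t + y t)
    (fun z _ ↦ (hf.differentiable one_ne_zero z).hasFDerivAt.hasFDerivWithinAt) hb
    (Metric.mem_closedBall_self (norm_nonneg _))
    (by simpa [dist_eq_norm] using y.norm_coe_le_norm t)
  rw [add_sub_cancel_left] at hm
  exact hm.trans (mul_le_mul_of_nonneg_left (y.norm_coe_le_norm t) hc.le)

/-- The derivative is the operator of the same kind attached to `fderiv ℝ f`, followed by a bounded
linear map. The induction therefore runs over all target spaces `E'` at once. -/
theorem contDiff_nemytskii_nat [FiniteDimensional ℝ E] (n : ℕ) :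
    ∀ {E' : Type u} [NormedAddCommGroup E'] [NormedSpace ℝ E'] {f : E → E'} (hf : ContDiff ℝ ∞ f),
      ContDiff ℝ n (nemytskii K ⟨f, hf.continuous⟩) := by
  induction n with
  | zero =>
    intro E' _ _ f hf
    exact contDiff_zero.2 (ContinuousMap.continuous_postcomp _)
  | succ n ih =>
    intro E' _ _ f hf
    have h1 : ContDiff ℝ 1 f := hf.of_le (by exact_mod_cast le_top)
    have hd : ContDiff ℝ ∞ (fderiv ℝ f) := hf.fderiv_right (m := ∞) (by simp)
    push_cast
    refine (contDiff_succ_iff_hasFDerivAt).2 ⟨_, ?_, fun x ↦ hasFDerivAt_nemytskii h1 x⟩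
    exact (pointwiseApply K E E').contDiff.comp (ih hd)

theorem contDiff_nemytskii [FiniteDimensional ℝ E] {f : E → E'} (hf : ContDiff ℝ ∞ f) :
    ContDiff ℝ ∞ (nemytskii K ⟨f, hf.continuous⟩) :=
  contDiff_infty.2 fun n ↦ contDiff_nemytskii_nat n hf

end Nemytskii

/-! ## Operations on square integrable paths -/

section SquareIntegrable

universe u

variable {E : Type u} [NormedAddCommGroup E] [NormedSpace ℝ E]

instance : IsProbabilityMeasure (volume.restrict (Icc (0 : ℝ) 1)) := ⟨by simp⟩

/-- The value at time `t` of a path parametrized by `[0,1]`, extended to be constant outside. -/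
def pathExtend {X : Type*} [TopologicalSpace X] (x : C(Icc (0 : ℝ) 1, X)) (t : ℝ) : X :=
  IccExtend zero_le_one x t

theorem continuous_pathExtend {X : Type*} [TopologicalSpace X] (x : C(Icc (0 : ℝ) 1, X)) :
    Continuous (pathExtend x) :=
  x.continuous.Icc_extend'

theorem pathExtend_of_mem {X : Type*} [TopologicalSpace X] (x : C(Icc (0 : ℝ) 1, X)) {t : ℝ}
    (ht : t ∈ Icc (0 : ℝ) 1) : pathExtend x t = x ⟨t, ht⟩ :=
  IccExtend_of_mem _ _ ht

theorem memLp_pathExtend_apply (A : C(Icc (0 : ℝ) 1, E →L[ℝ] E)) (u : PathAlgebra E) :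
    MemLp (fun t ↦ pathExtend A t (u t)) 2 (volume.restrict (Icc (0 : ℝ) 1)) := by
  refine (Lp.memLp u).of_le_mul (c := ‖A‖) ?_ (Eventually.of_forall fun t ↦ ?_)
  · exact (ContinuousLinearMap.id ℝ (E →L[ℝ] E)).aestronglyMeasurable_comp₂
      (continuous_pathExtend A).aestronglyMeasurable (Lp.memLp u).1
  · exact (pathExtend A t).le_of_opNorm_le (A.norm_coe_le_norm _) _

/-- Pointwise multiplication of a square integrable path by a continuous path of operators. -/
def mulPathₗ : C(Icc (0 : ℝ) 1, E →L[ℝ] E) →ₗ[ℝ] PathAlgebra E →ₗ[ℝ] PathAlgebra E :=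
  LinearMap.mk₂ ℝ (fun A u ↦ (memLp_pathExtend_apply A u).toLp)
    (fun A B u ↦ by
      ext1
      filter_upwards [(memLp_pathExtend_apply (A + B) u).coeFn_toLp,
        Lp.coeFn_add (memLp_pathExtend_apply A u).toLp (memLp_pathExtend_apply B u).toLp,
        (memLp_pathExtend_apply A u).coeFn_toLp,
        (memLp_pathExtend_apply B u).coeFn_toLp] with t h₁ h₂ h₃ h₄
      rw [h₁, h₂, Pi.add_apply, h₃, h₄]
      rfl)
    (fun c A u ↦ by
      ext1
      filter_upwards [(memLp_pathExtend_apply (c • A) u).coeFn_toLp,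
        Lp.coeFn_smul c (memLp_pathExtend_apply A u).toLp,
        (memLp_pathExtend_apply A u).coeFn_toLp] with t h₁ h₂ h₃
      rw [h₁, h₂, Pi.smul_apply, h₃]
      rfl)
    (fun A u v ↦ by
      ext1
      filter_upwards [(memLp_pathExtend_apply A (u + v)).coeFn_toLp,
        Lp.coeFn_add (memLp_pathExtend_apply A u).toLp (memLp_pathExtend_apply A v).toLp,
        (memLp_pathExtend_apply A u).coeFn_toLp,
        (memLp_pathExtend_apply A v).coeFn_toLp, Lp.coeFn_add u v] with t h₁ h₂ h₃ h₄ h₅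
      rw [h₁, h₂, Pi.add_apply, h₃, h₄, h₅, Pi.add_apply, map_add])
    (fun c A u ↦ by
      ext1
      filter_upwards [(memLp_pathExtend_apply A (c • u)).coeFn_toLp,
        Lp.coeFn_smul c (memLp_pathExtend_apply A u).toLp,
        (memLp_pathExtend_apply A u).coeFn_toLp, Lp.coeFn_smul c u] with t h₁ h₂ h₃ h₄
      rw [h₁, h₂, Pi.smul_apply, h₃, h₄, Pi.smul_apply, map_smul])

theorem coeFn_mulPathₗ (A : C(Icc (0 : ℝ) 1, E →L[ℝ] E)) (u : PathAlgebra E) :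
    ∀ᵐ t ∂(volume.restrict (Icc (0 : ℝ) 1)), mulPathₗ A u t = pathExtend A t (u t) :=
  (memLp_pathExtend_apply A u).coeFn_toLp

variable (E) in
/-- Pointwise multiplication of a square integrable path by a continuous path of operators, as a
bounded bilinear map. -/
def mulPath : C(Icc (0 : ℝ) 1, E →L[ℝ] E) →L[ℝ] PathAlgebra E →L[ℝ] PathAlgebra E :=
  LinearMap.mkContinuous₂ mulPathₗ 1 fun A u ↦ by
    rw [one_mul]
    refine Lp.norm_le_mul_norm_of_ae_le_mul ?_
    filter_upwards [coeFn_mulPathₗ A u] with t ht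
    rw [ht]
    exact (pathExtend A t).le_of_opNorm_le (A.norm_coe_le_norm _) _

theorem coeFn_mulPath (A : C(Icc (0 : ℝ) 1, E →L[ℝ] E)) (u : PathAlgebra E) :
    ∀ᵐ t ∂(volume.restrict (Icc (0 : ℝ) 1)), mulPath E A u t = pathExtend A t (u t) :=
  coeFn_mulPathₗ A u

theorem mulPath_mul (A B : C(Icc (0 : ℝ) 1, E →L[ℝ] E)) (u : PathAlgebra E) :
    mulPath E (A * B) u = mulPath E A (mulPath E B u) := by
  ext1
  filter_upwards [coeFn_mulPath (A * B) u, coeFn_mulPath A (mulPath E B u), coeFn_mulPath B u]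
    with t h₁ h₂ h₃
  rw [h₁, h₂, h₃]
  rfl

theorem mulPath_one (u : PathAlgebra E) : mulPath E 1 u = u := by
  ext1
  filter_upwards [coeFn_mulPath 1 u] with t h₁
  rw [h₁]
  rfl

theorem PathAlgebra.integrableOn (u : PathAlgebra E) : IntegrableOn u (Icc (0 : ℝ) 1) :=
  (Lp.memLp u).integrable (by norm_num)

theorem PathAlgebra.intervalIntegrable (u : PathAlgebra E) {a b : ℝ} (ha : a ∈ Icc (0 : ℝ) 1)
    (hb : b ∈ Icc (0 : ℝ) 1) : IntervalIntegrable u volume a b := by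
  refine IntegrableOn.intervalIntegrable (u.integrableOn.mono_set ?_)
  exact uIcc_subset_Icc ha hb

theorem PathAlgebra.integral_norm_le (u : PathAlgebra E) : ∫ t in Icc (0 : ℝ) 1, ‖u t‖ ≤ ‖u‖ := by
  rw [integral_norm_eq_lintegral_enorm (Lp.memLp u).1, ← eLpNorm_one_eq_lintegral_enorm, Lp.norm_def]
  exact ENNReal.toReal_mono (Lp.eLpNorm_ne_top u)
    (eLpNorm_le_eLpNorm_of_exponent_le (by norm_num) (Lp.memLp u).1)

theorem PathAlgebra.continuous_primitive (u : PathAlgebra E) :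
    Continuous fun t : Icc (0 : ℝ) 1 ↦ ∫ s in (0 : ℝ)..t, u s := by
  have := intervalIntegral.continuousOn_primitive_interval (a := 0) (b := 1) (μ := volume)
    (f := u) (by rw [uIcc_of_le zero_le_one]; exact u.integrableOn)
  rw [uIcc_of_le zero_le_one] at this
  exact this.comp_continuous continuous_subtype_val Subtype.prop

/-- The indefinite integral of a square integrable path. -/
def primitiveₗ : PathAlgebra E →ₗ[ℝ] C(Icc (0 : ℝ) 1, E) where
  toFun u := ⟨fun t ↦ ∫ s in (0 : ℝ)..t, u s, u.continuous_primitive⟩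
  map_add' u v := by
    ext t
    have h0 : (0 : ℝ) ∈ Icc (0 : ℝ) 1 := by simp
    simp only [ContinuousMap.coe_mk, ContinuousMap.coe_add, Pi.add_apply]
    rw [← intervalIntegral.integral_add (u.intervalIntegrable h0 t.2)
      (v.intervalIntegrable h0 t.2)]
    refine intervalIntegral.integral_congr_ae ?_
    have h := (ae_restrict_iff' measurableSet_Icc).1 (Lp.coeFn_add u v)
    filter_upwards [h] with s hs hs'
    refine hs ?_
    rw [uIoc_of_le t.2.1] at hs'
    exact ⟨hs'.1.le, hs'.2.trans t.2.2⟩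
  map_smul' c u := by
    ext t
    simp only [ContinuousMap.coe_mk, ContinuousMap.coe_smul, Pi.smul_apply, RingHom.id_apply]
    rw [← intervalIntegral.integral_smul]
    refine intervalIntegral.integral_congr_ae ?_
    have h := (ae_restrict_iff' measurableSet_Icc).1 (Lp.coeFn_smul c u)
    filter_upwards [h] with s hs hs'
    refine hs ?_
    rw [uIoc_of_le t.2.1] at hs'
    exact ⟨hs'.1.le, hs'.2.trans t.2.2⟩

variable (E) in
/-- The indefinite integral of a square integrable path, as a bounded linear map. -/
def primitive : PathAlgebra E →L[ℝ] C(Icc (0 : ℝ) 1, E) :=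
  LinearMap.mkContinuous primitiveₗ 1 fun u ↦ by
    rw [one_mul]
    refine (ContinuousMap.norm_le _ (norm_nonneg u)).2 fun t ↦ ?_
    refine le_trans ?_ u.integral_norm_le
    change ‖∫ s in (0 : ℝ)..t, u s‖ ≤ _
    rw [intervalIntegral.integral_of_le t.2.1]
    refine (norm_integral_le_integral_norm _).trans ?_
    refine setIntegral_mono_set u.integrableOn.norm (Eventually.of_forall fun _ ↦ norm_nonneg _) ?_
    exact (Ioc_subset_Icc_self.trans (Icc_subset_Icc_right t.2.2)).eventuallyLE

theorem primitive_apply (u : PathAlgebra E) (t : Icc (0 : ℝ) 1) :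
    primitive E u t = ∫ s in (0 : ℝ)..t, u s := rfl

theorem pathExtend_primitive (u : PathAlgebra E) {t : ℝ} (ht : t ∈ Icc (0 : ℝ) 1) :
    pathExtend (primitive E u) t = ∫ s in (0 : ℝ)..t, u s :=
  pathExtend_of_mem _ ht

variable (E) in
/-- The constant square integrable path. -/
def constPath : E →L[ℝ] PathAlgebra E := Lp.constL 2 (volume.restrict (Icc (0 : ℝ) 1)) ℝ

theorem coeFn_constPath (ξ : E) :
    ∀ᵐ t ∂(volume.restrict (Icc (0 : ℝ) 1)), constPath E ξ t = ξ :=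
  Lp.coeFn_const ..

theorem primitive_constPath [CompleteSpace E] (ξ : E) (t : Icc (0 : ℝ) 1) :
    primitive E (constPath E ξ) t = (t : ℝ) • ξ := by
  rw [primitive_apply]
  have : ∫ s in (0 : ℝ)..t, constPath E ξ s = ∫ s in (0 : ℝ)..t, ξ := by
    refine intervalIntegral.integral_congr_ae ?_
    have h := (ae_restrict_iff' measurableSet_Icc).1 (coeFn_constPath ξ)
    filter_upwards [h] with s hs hs'
    refine hs ?_
    rw [uIoc_of_le t.2.1] at hs'
    exact ⟨hs'.1.le, hs'.2.trans t.2.2⟩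
  rw [this, intervalIntegral.integral_const, sub_zero]

theorem absolutelyContinuousOnInterval_pathExtend_primitive (u : PathAlgebra E) :
    AbsolutelyContinuousOnInterval (pathExtend (primitive E u)) 0 1 := by
  refine ((u.intervalIntegrable (a := 0) (b := 1) (by simp)
    (by simp)).absolutelyContinuousOnInterval_integral (c := 0) (by simp)).congr ?_
  intro t ht
  rw [uIcc_of_le zero_le_one] at ht
  exact (pathExtend_primitive u ht).symm

theorem ae_restrict_mem_Ioo : ∀ᵐ t ∂(volume.restrict (Icc (0 : ℝ) 1)), t ∈ Ioo (0 : ℝ) 1 := by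
  rw [← restrict_Ioo_eq_restrict_Icc]
  exact ae_restrict_mem measurableSet_Ioo

theorem ae_hasDerivAt_pathExtend_primitive [CompleteSpace E] (u : PathAlgebra E) :
    ∀ᵐ t ∂(volume.restrict (Icc (0 : ℝ) 1)), HasDerivAt (pathExtend (primitive E u)) (u t) t := by
  have h := (u.intervalIntegrable (a := 0) (b := 1) (by simp) (by simp)).ae_hasDerivAt_integral
  filter_upwards [ae_restrict_of_ae h, ae_restrict_mem_Ioo] with t ht hm
  rw [uIcc_of_le zero_le_one] at ht
  refine (ht (Ioo_subset_Icc_self hm) 0 (by simp)).congr_of_eventuallyEq ?_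
  filter_upwards [Ioo_mem_nhds hm.1 hm.2] with s hs
  exact pathExtend_primitive u (Ioo_subset_Icc_self hs)

/-! ## Local solutions of controlled differential equations -/

/-- For small controls `u`, the equation `x' = Λ(x) u`, `x(0) = z` has a solution that depends
smoothly on `u`. -/
theorem exists_controlled_solution [FiniteDimensional ℝ E] {Λ : E → E →L[ℝ] E}
    (hΛ : ContDiff ℝ ∞ Λ) (z : E) :
    ∃ σ : PathAlgebra E → C(Icc (0 : ℝ) 1, E), ContDiffAt ℝ ∞ σ 0 ∧
      σ 0 = ContinuousMap.const _ z ∧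
      HasFDerivAt σ (primitive E ∘L mulPath E (ContinuousMap.const _ (Λ z))) 0 ∧
      ∀ᶠ u in 𝓝 (0 : PathAlgebra E), σ u = ContinuousMap.const _ z +
        primitive E (mulPath E (nemytskii _ ⟨Λ, hΛ.continuous⟩ (σ u)) u) := by
  have := FiniteDimensional.complete ℝ E
  set c : C(Icc (0 : ℝ) 1, E) := ContinuousMap.const _ z
  let N : C(Icc (0 : ℝ) 1, E) → C(Icc (0 : ℝ) 1, E →L[ℝ] E) := nemytskii _ ⟨Λ, hΛ.continuous⟩
  have hN : ContDiff ℝ ∞ N := contDiff_nemytskii hΛ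
  -- The zeros of `f` are the solutions of the integral equation. At (0, c) the nonlinear term
  -- vanishes together with the control, so the partial derivative in x is the identity and the
  -- implicit function theorem applies.
  let f : PathAlgebra E × C(Icc (0 : ℝ) 1, E) → C(Icc (0 : ℝ) 1, E) := fun p ↦
    p.2 - c - primitive E (mulPath E (N p.2) p.1)
  have hf : ContDiff ℝ ∞ f := by
    refine (contDiff_snd.sub contDiff_const).sub ((primitive E).contDiff.comp ?_)
    exact ((mulPath E).contDiff.comp (hN.comp contDiff_snd)).clm_apply contDiff_fst
  have hf0 : f (0, c) = 0 := by simp [f]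
  have hd : HasFDerivAt f (fderiv ℝ f (0, c)) (0, c) :=
    (hf.differentiable (by simp) _).hasFDerivAt
  have h₂ : fderiv ℝ f (0, c) ∘L .inr ℝ _ _ = ContinuousLinearMap.id ℝ _ := by
    have h1 : HasFDerivAt (fun x ↦ f (0, x)) (fderiv ℝ f (0, c) ∘L .inr ℝ _ _) c :=
      HasFDerivAt.comp (f := fun x ↦ ((0 : PathAlgebra E), x)) c hd (hasFDerivAt_prodMk_right 0 c)
    have h2 : HasFDerivAt (fun x ↦ f (0, x)) (ContinuousLinearMap.id ℝ _) c := by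
      simpa [f] using (hasFDerivAt_id c).sub_const c
    exact h1.unique h2
  -- `f` is linear in u; this partial derivative yields the derivative of the solution at the zero
  -- control.
  have h₁ : fderiv ℝ f (0, c) ∘L .inl ℝ _ _ = -(primitive E ∘L mulPath E (N c)) := by
    have h1 : HasFDerivAt (fun u ↦ f (u, c)) (fderiv ℝ f (0, c) ∘L .inl ℝ _ _) 0 :=
      HasFDerivAt.comp (f := fun u ↦ (u, c)) 0 hd (hasFDerivAt_prodMk_left 0 c)
    have h2 : HasFDerivAt (fun u ↦ f (u, c)) (-(primitive E ∘L mulPath E (N c))) 0 := by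
      have : (fun u ↦ f (u, c)) = fun u ↦ -(primitive E ∘L mulPath E (N c)) u := by
        ext1 u
        simp [f]
      rw [this]
      exact (primitive E ∘L mulPath E (N c)).hasFDerivAt.neg
    exact h1.unique h2
  have hinv : (fderiv ℝ f (0, c) ∘L .inr ℝ _ _).IsInvertible := by
    rw [h₂]
    exact ⟨ContinuousLinearEquiv.refl ℝ _, rfl⟩
  have cdf : ContDiffAt ℝ ∞ f (0, c) := hf.contDiffAt
  refine ⟨cdf.implicitFunction (by simp) hinv, cdf.contDiffAt_implicitFunction (by simp) hinv,
    cdf.implicitFunction_apply_self (by simp) hinv, ?_, ?_⟩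
  · have := (cdf.hasStrictFDerivAt_implicitFunction (by simp) hinv).hasFDerivAt
    rw [h₁, h₂, ContinuousLinearMap.inverse_id] at this
    convert! this using 1
    ext u : 1
    simp [N, c]
    rfl
  · filter_upwards [cdf.eventually_apply_implicitFunction (by simp) hinv] with u hu
    rw [hf0] at hu
    have := sub_eq_zero.1 hu
    rw [sub_eq_iff_eq_add] at this
    rw [add_comm]
    exact this

end SquareIntegrable

/-! ## Derivatives with values in the model spaces -/

section ModelDerivative

variable {E₁ : Type*} [NormedAddCommGroup E₁] [NormedSpace ℝ E₁]
  {M₁ : Type*} [TopologicalSpace M₁] [ChartedSpace E₁ M₁]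
  {E₂ : Type*} [NormedAddCommGroup E₂] [NormedSpace ℝ E₂]
  {M₂ : Type*} [TopologicalSpace M₂] [ChartedSpace E₂ M₂]
  {E₃ : Type*} [NormedAddCommGroup E₃] [NormedSpace ℝ E₃]
  {M₃ : Type*} [TopologicalSpace M₃] [ChartedSpace E₃ M₃]

variable (E₁ E₂) in
/-- The derivative of `f` at `x`, as a map between the model spaces. -/
def modelDeriv (f : M₁ → M₂) (x : M₁) : E₁ →L[ℝ] E₂ := mfderiv 𝓘(ℝ, E₁) 𝓘(ℝ, E₂) f x

/-- `f` has the derivative `f'` at `x`, where `f'` is a map between the model spaces. -/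
def HasModelDerivAt (f : M₁ → M₂) (f' : E₁ →L[ℝ] E₂) (x : M₁) : Prop :=
  HasMFDerivAt 𝓘(ℝ, E₁) 𝓘(ℝ, E₂) f x f'

theorem HasModelDerivAt.modelDeriv_eq {f : M₁ → M₂} {f' : E₁ →L[ℝ] E₂} {x : M₁}
    (h : HasModelDerivAt f f' x) : modelDeriv E₁ E₂ f x = f' :=
  HasMFDerivAt.mfderiv h

theorem HasModelDerivAt.unique {f : M₁ → M₂} {f' f'' : E₁ →L[ℝ] E₂} {x : M₁}
    (h : HasModelDerivAt f f' x) (h' : HasModelDerivAt f f'' x) : f' = f'' :=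
  h.modelDeriv_eq.symm.trans h'.modelDeriv_eq

theorem MDifferentiableAt.hasModelDerivAt {f : M₁ → M₂} {x : M₁}
    (h : MDifferentiableAt 𝓘(ℝ, E₁) 𝓘(ℝ, E₂) f x) : HasModelDerivAt f (modelDeriv E₁ E₂ f x) x :=
  h.hasMFDerivAt

theorem HasModelDerivAt.mdifferentiableAt {f : M₁ → M₂} {f' : E₁ →L[ℝ] E₂} {x : M₁}
    (h : HasModelDerivAt f f' x) : MDifferentiableAt 𝓘(ℝ, E₁) 𝓘(ℝ, E₂) f x :=
  HasMFDerivAt.mdifferentiableAt h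

theorem ContMDiffAt.hasModelDerivAt {f : M₁ → M₂} {x : M₁}
    (h : ContMDiffAt 𝓘(ℝ, E₁) 𝓘(ℝ, E₂) ∞ f x) : HasModelDerivAt f (modelDeriv E₁ E₂ f x) x :=
  (h.mdifferentiableAt (by simp)).hasModelDerivAt

/-- The base point `y` is tied to `f x` only by the equation `h`, so derivatives at propositionally
equal points compose without transport between tangent spaces. -/
theorem HasModelDerivAt.comp {g : M₂ → M₃} {g' : E₂ →L[ℝ] E₃} {f : M₁ → M₂} {f' : E₁ →L[ℝ] E₂}
    {x : M₁} {y : M₂} (hg : HasModelDerivAt g g' y) (hf : HasModelDerivAt f f' x)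
    (h : f x = y) : HasModelDerivAt (fun z ↦ g (f z)) (g' ∘L f') x := by
  subst h
  exact HasMFDerivAt.comp x hg hf

theorem HasModelDerivAt.congr_of_eventuallyEq {f g : M₁ → M₂} {f' : E₁ →L[ℝ] E₂} {x : M₁}
    (h : HasModelDerivAt f f' x) (hg : g =ᶠ[𝓝 x] f) : HasModelDerivAt g f' x :=
  HasMFDerivAt.congr_of_eventuallyEq h hg

theorem hasModelDerivAt_const (c : M₂) (x : M₁) :
    HasModelDerivAt (fun _ : M₁ ↦ c) (0 : E₁ →L[ℝ] E₂) x :=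
  hasMFDerivAt_const ..

theorem hasModelDerivAt_id (x : M₁) :
    HasModelDerivAt (fun y : M₁ ↦ y) (ContinuousLinearMap.id ℝ E₁) x :=
  hasMFDerivAt_id _

theorem hasModelDerivAt_iff_hasFDerivAt {f : E₁ → E₂} {f' : E₁ →L[ℝ] E₂} {x : E₁} :
    HasModelDerivAt f f' x ↔ HasFDerivAt f f' x :=
  hasMFDerivAt_iff_hasFDerivAt

/-- The tangent space at `x` is identified with the model space through this very chart. -/
theorem hasModelDerivAt_extChartAt_self [IsManifold 𝓘(ℝ, E₁) ∞ M₁] (x : M₁) :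
    HasModelDerivAt (extChartAt 𝓘(ℝ, E₁) x) (ContinuousLinearMap.id ℝ E₁) x := by
  have : IsManifold 𝓘(ℝ, E₁) 1 M₁ := .of_le (n := ∞) (by simp)
  have h := (contMDiffAt_extChartAt (I := 𝓘(ℝ, E₁)) (n := 1) (x := x)).mdifferentiableAt one_ne_zero
  have e : modelDeriv E₁ E₁ (extChartAt 𝓘(ℝ, E₁) x) x = ContinuousLinearMap.id ℝ E₁ := by
    refine (mfderiv_chartAt_eq_tangentCoordChange (I := 𝓘(ℝ, E₁)) (x := x) (y := x)
      (mem_chart_source E₁ x)).trans ?_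
    ext v
    exact tangentCoordChange_self (mem_extChartAt_source x)
  have := MDifferentiableAt.hasModelDerivAt h
  rwa [e] at this

/-- The partial derivative of a smooth family of maps into a vector space depends smoothly on the
parameter. -/
theorem ContMDiffAt.modelDeriv_right [IsManifold 𝓘(ℝ, E₂) ∞ M₂] [IsManifold 𝓘(ℝ, E₁) ∞ M₁]
    {f : M₁ → M₂ → E₃} {x₀ : M₁} {y₀ : M₂}
    (hf : ContMDiffAt (𝓘(ℝ, E₁).prod 𝓘(ℝ, E₂)) 𝓘(ℝ, E₃) ∞ (Function.uncurry f) (x₀, y₀)) :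
    ContMDiffAt 𝓘(ℝ, E₁) 𝓘(ℝ, E₂ →L[ℝ] E₃) ∞ (fun x ↦ modelDeriv E₂ E₃ (f x) y₀) x₀ := by
  have : IsManifold 𝓘(ℝ, E₂) 1 M₂ := .of_le (n := ∞) (by simp)
  have h := ContMDiffAt.mfderiv (m := ∞) f (fun _ ↦ y₀) hf contMDiffAt_const (by simp)
  refine h.congr_of_eventuallyEq (Eventually.of_forall fun x ↦ ?_)
  -- `ContMDiffAt.mfderiv` speaks of the derivative in tangent coordinates. Here both coordinate
  -- changes are trivial: the source point is the fixed `y₀` and the target is a vector space.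
  refine Eq.symm ((inTangentCoordinates_eq (I := 𝓘(ℝ, E₂)) (I' := 𝓘(ℝ, E₃)) (fun _ : M₁ ↦ y₀)
    (fun x ↦ f x y₀) (fun x ↦ modelDeriv E₂ E₃ (f x) y₀) (mem_chart_source _ _)
    (mem_univ (f x y₀))).trans ?_)
  ext v
  have h₁ := (tangentBundleCore 𝓘(ℝ, E₂) M₂).coordChange_self (achart E₂ y₀) y₀
    (mem_chart_source _ _) v
  have h₂ := tangentBundleCore_coordChange_model_space (I := 𝓘(ℝ, E₃)) (f x y₀) (f x₀ y₀) (f x y₀)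
  exact (DFunLike.congr_fun h₂ _).trans (congrArg (modelDeriv E₂ E₃ (f x) y₀) h₁)

end ModelDerivative

/-! ## Calculus on Lie groups -/

section LieCalculus

variable {E : Type*} [NormedAddCommGroup E] [NormedSpace ℝ E]
  {G : Type*} [TopologicalSpace G] [ChartedSpace E G] [Group G] [LieGroup 𝓘(ℝ, E) ∞ G]

theorem HasModelDerivAt.mul {E₁ : Type*} [NormedAddCommGroup E₁] [NormedSpace ℝ E₁]
    {M₁ : Type*} [TopologicalSpace M₁] [ChartedSpace E₁ M₁] {f g : M₁ → G} {f' g' : E₁ →L[ℝ] E}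
    {x : M₁} (hf : HasModelDerivAt f f' x) (hg : HasModelDerivAt g g' x) :
    HasModelDerivAt (fun y ↦ f y * g y)
      (modelDeriv E E (fun a ↦ a * g x) (f x) ∘L f' + modelDeriv E E (fun b ↦ f x * b) (g x) ∘L g') x := by
  have h := HasMFDerivAt.prodMk hf hg
  have hm : MDifferentiableAt (𝓘(ℝ, E).prod 𝓘(ℝ, E)) 𝓘(ℝ, E) (fun p : G × G ↦ p.1 * p.2)
      (f x, g x) := (contMDiff_mul 𝓘(ℝ, E) ∞).mdifferentiable (by simp) _
  have hc := HasMFDerivAt.comp x hm.hasMFDerivAt h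
  refine (congrArg (HasModelDerivAt (fun y ↦ f y * g y) · x) ?_).mpr hc
  ext v
  exact (mfderiv_prod_eq_add_apply hm (v := ((f' v, g' v) : E × E))).symm

end LieCalculus

section LieTranslations

variable {E : Type*} [NormedAddCommGroup E] [NormedSpace ℝ E]
  {G : Type*} [TopologicalSpace G] [ChartedSpace E G] [Group G]
  {E₂ : Type*} [NormedAddCommGroup E₂] [NormedSpace ℝ E₂]
  {M₂ : Type*} [TopologicalSpace M₂] [ChartedSpace E₂ M₂]

variable (E E₂) in
/-- The derivative of `f` at `a` in the left trivialization of the tangent bundle of `G`. -/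
def leftDeriv (f : G → M₂) (a : G) : E →L[ℝ] E₂ := modelDeriv E E₂ (fun b ↦ f (a * b)) 1

variable (E) in
/-- The derivative at `1` of the left translation by `a`. -/
def dleft (a : G) : E →L[ℝ] E := modelDeriv E E (fun b : G ↦ a * b) 1

variable (E) in
/-- The derivative at `1` of the right translation by `a`. -/
def dright (a : G) : E →L[ℝ] E := modelDeriv E E (fun b : G ↦ b * a) 1

variable (E) in
/-- The adjoint representation on the model space. -/
def Ad (a : G) : E →L[ℝ] E := modelDeriv E E (fun b : G ↦ a * b * a⁻¹) 1

/-- The path `g` has at time `t` the velocity `dl_{g(t)} w`. -/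
def HasLeftVelocity (g : ℝ → G) (t : ℝ) (w : E) : Prop :=
  HasModelDerivAt g (ContinuousLinearMap.toSpanSingleton ℝ (dleft E (g t) w)) t

variable [LieGroup 𝓘(ℝ, E) ∞ G]

theorem contMDiff_conj (a : G) : ContMDiff 𝓘(ℝ, E) 𝓘(ℝ, E) ∞ (fun b : G ↦ a * b * a⁻¹) :=
  (contMDiff_const.mul contMDiff_id).mul contMDiff_const

theorem hasModelDerivAt_mul_left (a b : G) :
    HasModelDerivAt (fun x : G ↦ a * x) (modelDeriv E E (fun x : G ↦ a * x) b) b :=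
  contMDiff_mul_left.contMDiffAt.hasModelDerivAt

theorem hasModelDerivAt_mul_right (a b : G) :
    HasModelDerivAt (fun x : G ↦ x * a) (modelDeriv E E (fun x : G ↦ x * a) b) b :=
  contMDiff_mul_right.contMDiffAt.hasModelDerivAt

theorem hasModelDerivAt_dleft (a : G) : HasModelDerivAt (fun x : G ↦ a * x) (dleft E a) 1 :=
  hasModelDerivAt_mul_left a 1

theorem hasModelDerivAt_dright (a : G) : HasModelDerivAt (fun x : G ↦ x * a) (dright E a) 1 :=
  hasModelDerivAt_mul_right a 1

theorem hasModelDerivAt_Ad (a : G) : HasModelDerivAt (fun x : G ↦ a * x * a⁻¹) (Ad E a) 1 :=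
  (contMDiff_conj a).contMDiffAt.hasModelDerivAt

theorem HasModelDerivAt.comp_dleft {f : G → M₂} {f' : E →L[ℝ] E₂} {a : G}
    (hf : HasModelDerivAt f f' a) : HasModelDerivAt (fun b ↦ f (a * b)) (f' ∘L dleft E a) 1 :=
  hf.comp (hasModelDerivAt_dleft a) (mul_one a)

theorem HasModelDerivAt.leftDeriv_eq {f : G → M₂} {f' : E →L[ℝ] E₂} {a : G}
    (hf : HasModelDerivAt f f' a) : leftDeriv E E₂ f a = f' ∘L dleft E a :=
  hf.comp_dleft.modelDeriv_eq

theorem modelDeriv_mul_left_comp_dleft (a b : G) :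
    modelDeriv E E (fun x : G ↦ a * x) b ∘L dleft E b = dleft E (a * b) := by
  refine ((hasModelDerivAt_mul_left a b).comp_dleft.unique ?_)
  simpa only [mul_assoc] using hasModelDerivAt_dleft (E := E) (a * b)

theorem modelDeriv_mul_right_comp_dleft (a b : G) :
    modelDeriv E E (fun x : G ↦ x * b) a ∘L dleft E a = dleft E (a * b) ∘L Ad E b⁻¹ := by
  refine ((hasModelDerivAt_mul_right b a).comp_dleft.unique ?_)
  have := (hasModelDerivAt_dleft (E := E) (a * b)).comp (hasModelDerivAt_Ad (E := E) b⁻¹) (by simp)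
  convert! this using 2 with x
  group

theorem Ad_one : Ad E (1 : G) = ContinuousLinearMap.id ℝ E := by
  refine (hasModelDerivAt_Ad (1 : G)).unique ?_
  simpa using hasModelDerivAt_id (1 : G)

theorem Ad_mul (a b : G) : Ad E (a * b) = Ad E a ∘L Ad E b := by
  refine (hasModelDerivAt_Ad (a * b)).unique ?_
  convert! (hasModelDerivAt_Ad (E := E) a).comp (hasModelDerivAt_Ad (E := E) b) (by simp) using 2 with x
  group

theorem Ad_mul_apply (a b : G) (X : E) : Ad E (a * b) X = Ad E a (Ad E b X) := by
  rw [Ad_mul]; rfl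

@[simp]
theorem Ad_inv_apply_Ad (a : G) (X : E) : Ad E a⁻¹ (Ad E a X) = X := by
  rw [← Ad_mul_apply, inv_mul_cancel, Ad_one]; rfl

@[simp]
theorem Ad_apply_Ad_inv (a : G) (X : E) : Ad E a (Ad E a⁻¹ X) = X := by
  rw [← Ad_mul_apply, mul_inv_cancel, Ad_one]; rfl

theorem dright_comp_Ad (a : G) : dright E a ∘L Ad E a = dleft E a := by
  refine HasModelDerivAt.unique ?_ (hasModelDerivAt_dleft a)
  convert! (hasModelDerivAt_dright (E := E) a).comp (hasModelDerivAt_Ad (E := E) a) (by simp) using 2 with x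
  group

theorem modelDeriv_inv_mul_apply_dleft (a : G) (X : E) :
    modelDeriv E E (fun x : G ↦ a⁻¹ * x) a (dleft E a X) = X := by
  have h := modelDeriv_mul_left_comp_dleft (E := E) a⁻¹ a
  have h1 : dleft E (1 : G) = ContinuousLinearMap.id ℝ E := by
    refine (hasModelDerivAt_dleft (1 : G)).unique ?_
    simpa using hasModelDerivAt_id (1 : G)
  rw [inv_mul_cancel, h1] at h
  exact DFunLike.congr_fun h X

theorem dleft_apply_modelDeriv_inv_mul (a : G) (v : E) :
    dleft E a (modelDeriv E E (fun x : G ↦ a⁻¹ * x) a v) = v := by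
  have h := (hasModelDerivAt_dleft a).comp (hasModelDerivAt_mul_left (E := E) a⁻¹ a)
    (inv_mul_cancel a)
  have h2 : HasModelDerivAt (fun z ↦ a * (a⁻¹ * z)) (ContinuousLinearMap.id ℝ E) a := by
    simpa using hasModelDerivAt_id a
  exact DFunLike.congr_fun (h.unique h2) v

theorem isInvertible_dleft (a : G) : (dleft E a).IsInvertible :=
  ⟨ContinuousLinearEquiv.equivOfInverse (dleft E a) (modelDeriv E E (fun x : G ↦ a⁻¹ * x) a)
    (modelDeriv_inv_mul_apply_dleft a) (dleft_apply_modelDeriv_inv_mul a), rfl⟩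

/-- Differentiation of a (b z b⁻¹) b = a b z at z = 1. It turns derivatives along right translates
into left-trivialized ones. -/
theorem leftDeriv_apply_Ad {f : G → M₂} (a b : G)
    (hf : MDifferentiableAt 𝓘(ℝ, E) 𝓘(ℝ, E₂) f (a * b)) (X : E) :
    modelDeriv E E₂ (fun x ↦ f (a * x * b)) 1 (Ad E b X) = leftDeriv E E₂ f (a * b) X := by
  have h1 : HasModelDerivAt (fun x : G ↦ a * x * b) (modelDeriv E E (fun x : G ↦ a * x * b) 1) 1 :=
    (contMDiff_mul_right.comp contMDiff_mul_left).contMDiffAt.hasModelDerivAt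
  have h2 := (hf.hasModelDerivAt.comp h1 (by simp)).comp (hasModelDerivAt_Ad b) (by simp)
  have h3 := hf.hasModelDerivAt.comp_dleft
  have e : (fun z ↦ f (a * (b * z * b⁻¹) * b)) = fun z ↦ f (a * b * z) := by
    ext z; congr 1; group
  rw [e] at h2
  have h4 := (hf.hasModelDerivAt.comp h1 (by simp)).modelDeriv_eq
  rw [hf.hasModelDerivAt.leftDeriv_eq, ← h2.unique h3, h4]
  rfl

/-! ### Velocities in the left trivialization -/

namespace HasLeftVelocity

variable {g h : ℝ → G} {t : ℝ} {w v : E}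

theorem comp (hg : HasLeftVelocity g t w) {f : G → M₂}
    (hf : MDifferentiableAt 𝓘(ℝ, E) 𝓘(ℝ, E₂) f (g t)) :
    HasModelDerivAt (fun s ↦ f (g s))
      (ContinuousLinearMap.toSpanSingleton ℝ (leftDeriv E E₂ f (g t) w)) t := by
  have := hf.hasModelDerivAt.comp hg rfl
  rw [hf.hasModelDerivAt.leftDeriv_eq]
  convert! this using 1
  ext
  simp

theorem hasDerivAt_comp (hg : HasLeftVelocity g t w) {f : G → E₂}
    (hf : MDifferentiableAt 𝓘(ℝ, E) 𝓘(ℝ, E₂) f (g t)) :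
    HasDerivAt (fun s ↦ f (g s)) (leftDeriv E E₂ f (g t) w) t :=
  hasModelDerivAt_iff_hasFDerivAt.1 (hg.comp hf)

theorem leftLogDeriv_eq (hg : HasLeftVelocity g t w) : leftLogDeriv (E := E) g t = w := by
  have h : pathVelocity (E := E) g t = dleft E (g t) w := by
    refine (DFunLike.congr_fun (HasModelDerivAt.modelDeriv_eq hg) (1 : ℝ)).trans ?_
    simp
  exact (congrArg (modelDeriv E E (fun x : G ↦ (g t)⁻¹ * x) (g t)) h).trans
    (modelDeriv_inv_mul_apply_dleft _ _)

theorem rightLogDeriv_eq (hg : HasLeftVelocity g t w) :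
    rightLogDeriv (E := E) g t = Ad E (g t) w := by
  have h : pathVelocity (E := E) g t = dleft E (g t) w := by
    refine (DFunLike.congr_fun (HasModelDerivAt.modelDeriv_eq hg) (1 : ℝ)).trans ?_
    simp
  refine (congrArg (modelDeriv E E (fun x : G ↦ x * (g t)⁻¹) (g t)) h).trans ?_
  exact DFunLike.congr_fun
    ((hasModelDerivAt_mul_right (E := E) (g t)⁻¹ (g t)).comp_dleft.modelDeriv_eq).symm w

theorem unique (hg : HasLeftVelocity g t w) (hg' : HasLeftVelocity g t v) : w = v :=
  hg.leftLogDeriv_eq.symm.trans hg'.leftLogDeriv_eq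

theorem const (a : G) (t : ℝ) : HasLeftVelocity (fun _ ↦ a) t (0 : E) := by
  unfold HasLeftVelocity
  rw [map_zero, ContinuousLinearMap.toSpanSingleton_zero]
  exact hasModelDerivAt_const a t

theorem mul (hg : HasLeftVelocity g t w) (hh : HasLeftVelocity h t v) :
    HasLeftVelocity (fun s ↦ g s * h s) t (Ad E (h t)⁻¹ w + v) := by
  have := HasModelDerivAt.mul hg hh
  unfold HasLeftVelocity
  convert! this using 1
  ext
  have h1 := DFunLike.congr_fun (modelDeriv_mul_left_comp_dleft (E := E) (g t) (h t)) v
  have h2 := DFunLike.congr_fun (modelDeriv_mul_right_comp_dleft (E := E) (g t) (h t)) w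
  simp only [ContinuousLinearMap.comp_apply] at h1 h2
  simp [h1, h2]

theorem const_mul (a : G) (hg : HasLeftVelocity g t w) :
    HasLeftVelocity (fun s ↦ a * g s) t w := by
  simpa using (const (E := E) a t).mul hg

theorem mul_const (hg : HasLeftVelocity g t w) (a : G) :
    HasLeftVelocity (fun s ↦ g s * a) t (Ad E a⁻¹ w) := by
  simpa using hg.mul (const (E := E) a t)

end HasLeftVelocity

theorem MDifferentiableAt.hasLeftVelocity {g : ℝ → G} {t : ℝ}
    (hg : MDifferentiableAt 𝓘(ℝ, ℝ) 𝓘(ℝ, E) g t) :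
    HasLeftVelocity g t (show E from leftLogDeriv g t) := by
  unfold HasLeftVelocity
  have h : dleft E (g t) (show E from leftLogDeriv g t) = modelDeriv ℝ E g t 1 :=
    dleft_apply_modelDeriv_inv_mul _ _
  rw [h]
  convert! hg.hasModelDerivAt using 1
  ext
  simp

/-- Smoothness of the inversion gives differentiability; the value is forced by the product rule for
g g⁻¹ = 1. -/
theorem HasLeftVelocity.inv {g : ℝ → G} {t : ℝ} {w : E} (hg : HasLeftVelocity g t w) :
    HasLeftVelocity (fun s ↦ (g s)⁻¹) t (-Ad E (g t) w) := by
  have hd : MDifferentiableAt 𝓘(ℝ, ℝ) 𝓘(ℝ, E) (fun s ↦ (g s)⁻¹) t :=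
    (((contMDiff_inv 𝓘(ℝ, E) ∞ (G := G)).mdifferentiable (by simp) (g t)).hasModelDerivAt.comp hg
      rfl).mdifferentiableAt
  have h1 := hg.mul hd.hasLeftVelocity
  simp only [mul_inv_cancel, inv_inv] at h1
  have h2 := h1.unique (HasLeftVelocity.const (E := E) (1 : G) t)
  have h3 := hd.hasLeftVelocity
  rwa [← neg_eq_of_add_eq_zero_right h2] at h3

/-! ### Smoothness -/

/-- Composition with the chart at 1 makes the family of conjugations vector-valued, so that
`ContMDiffAt.modelDeriv_right` applies. The derivative of this chart at 1 is the identity, so the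
composition does not change the derivative. -/
theorem contMDiff_Ad : ContMDiff 𝓘(ℝ, E) 𝓘(ℝ, E →L[ℝ] E) ∞ (fun a : G ↦ Ad E a) := by
  intro a₀
  have hs : ContMDiffAt (𝓘(ℝ, E).prod 𝓘(ℝ, E)) 𝓘(ℝ, E) ∞
      (Function.uncurry fun a b : G ↦ extChartAt 𝓘(ℝ, E) (1 : G) (a * b * a⁻¹)) (a₀, 1) := by
    refine ContMDiffAt.comp (I' := 𝓘(ℝ, E)) (a₀, (1 : G))
      (g := extChartAt 𝓘(ℝ, E) (1 : G)) (f := fun p : G × G ↦ p.1 * p.2 * p.1⁻¹) ?_ ?_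
    · simpa using contMDiffAt_extChartAt (I := 𝓘(ℝ, E)) (n := ∞) (x := (1 : G))
    · exact ((contMDiff_fst.mul contMDiff_snd).mul contMDiff_fst.inv).contMDiffAt
  refine (ContMDiffAt.modelDeriv_right hs).congr_of_eventuallyEq
    (Eventually.of_forall fun a ↦ ?_)
  have := (hasModelDerivAt_extChartAt_self (1 : G)).comp (hasModelDerivAt_Ad (E := E) a) (by simp)
  exact this.modelDeriv_eq.symm

theorem contMDiffAt_leftDeriv {f : G → E₂} {a : G}
    (hf : ContMDiffAt 𝓘(ℝ, E) 𝓘(ℝ, E₂) ∞ f a) :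
    ContMDiffAt 𝓘(ℝ, E) 𝓘(ℝ, E →L[ℝ] E₂) ∞ (leftDeriv E E₂ f) a := by
  refine ContMDiffAt.modelDeriv_right (f := fun a b : G ↦ f (a * b)) ?_
  refine ContMDiffAt.comp (I' := 𝓘(ℝ, E)) (a, (1 : G)) (g := f) (f := fun p : G × G ↦ p.1 * p.2)
    ?_ (contMDiff_mul 𝓘(ℝ, E) ∞).contMDiffAt
  simpa using hf

variable (E) in
/-- The derivative of the chart at `x` in the left trivialization. -/
def chartFrame (x a : G) : E →L[ℝ] E := leftDeriv E E (extChartAt 𝓘(ℝ, E) x) a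

theorem contMDiffAt_extChartAt_of_mem {x a : G} (ha : a ∈ (chartAt E x).source) :
    ContMDiffAt 𝓘(ℝ, E) 𝓘(ℝ, E) ∞ (extChartAt 𝓘(ℝ, E) x) a := by
  exact contMDiffAt_extChartAt' ha

theorem contMDiffAt_chartFrame {x a : G} (ha : a ∈ (chartAt E x).source) :
    ContMDiffAt 𝓘(ℝ, E) 𝓘(ℝ, E →L[ℝ] E) ∞ (chartFrame E x) a :=
  contMDiffAt_leftDeriv (contMDiffAt_extChartAt_of_mem ha)

theorem isInvertible_chartFrame {x a : G} (ha : a ∈ (chartAt E x).source) :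
    (chartFrame E x a).IsInvertible := by
  have : IsManifold 𝓘(ℝ, E) 1 G := .of_le (n := ∞) (by simp)
  have h := (contMDiffAt_extChartAt_of_mem ha).hasModelDerivAt
  have hi : (modelDeriv E E (extChartAt 𝓘(ℝ, E) x) a).IsInvertible :=
    isInvertible_mfderiv_extChartAt (I := 𝓘(ℝ, E)) (by simpa using ha)
  unfold chartFrame
  rw [h.leftDeriv_eq]
  exact hi.comp (isInvertible_dleft a)

theorem chartFrame_one : chartFrame E (1 : G) 1 = ContinuousLinearMap.id ℝ E := by
  refine HasModelDerivAt.modelDeriv_eq ?_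
  simpa using hasModelDerivAt_extChartAt_self (1 : G)

theorem HasLeftVelocity.hasDerivAt_extChartAt {g : ℝ → G} {t : ℝ} {w : E} {x : G}
    (hg : HasLeftVelocity g t w) (hx : g t ∈ (chartAt E x).source) :
    HasDerivAt (fun s ↦ extChartAt 𝓘(ℝ, E) x (g s)) (chartFrame E x (g t) w) t :=
  hg.hasDerivAt_comp ((contMDiffAt_extChartAt_of_mem hx).mdifferentiableAt (by simp))

theorem mdifferentiableAt_of_differentiableAt_extChartAt {g : ℝ → G} {t : ℝ} {x : G}
    (hc : ContinuousAt g t) (hx : g t ∈ (chartAt E x).source)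
    (hd : DifferentiableAt ℝ (fun s ↦ extChartAt 𝓘(ℝ, E) x (g s)) t) :
    MDifferentiableAt 𝓘(ℝ, ℝ) 𝓘(ℝ, E) g t := by
  have hs : ContMDiffAt 𝓘(ℝ, E) 𝓘(ℝ, E) ∞ (extChartAt 𝓘(ℝ, E) x).symm
      (extChartAt 𝓘(ℝ, E) x (g t)) :=
    (contMDiffOn_extChartAt_symm x).contMDiffAt
      (extChartAt_target_mem_nhds' ((extChartAt 𝓘(ℝ, E) x).map_source (by simpa using hx)))
  have h := (hs.mdifferentiableAt (by simp)).hasModelDerivAt.comp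
    (hasModelDerivAt_iff_hasFDerivAt.2 hd.hasFDerivAt) rfl
  refine (h.congr_of_eventuallyEq ?_).mdifferentiableAt
  filter_upwards [hc.preimage_mem_nhds ((chartAt E x).open_source.mem_nhds hx)] with s hs
  exact ((extChartAt 𝓘(ℝ, E) x).left_inv (by simpa using hs)).symm

end LieTranslations

/-! ### Absolutely continuous paths in a Lie group. -/

theorem memLp_two_of_forall_nhdsWithin {E : Type*} [NormedAddCommGroup E] {f : ℝ → E} {s : Set ℝ}
    (hs : IsCompact s) (h : ∀ t ∈ s, ∃ u ∈ 𝓝[s] t, MemLp f 2 (volume.restrict u)) :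
    MemLp f 2 (volume.restrict s) := by
  refine hs.induction_on (p := fun u ↦ MemLp f 2 (volume.restrict u)) (by simp)
    (fun u v huv hv ↦ hv.mono_measure (Measure.restrict_mono_set _ huv)) (fun u v hu hv ↦ ?_) h
  have hm := aestronglyMeasurable_union_iff.2 ⟨hu.1, hv.1⟩
  rw [memLp_two_iff_integrable_sq_norm hm]
  exact IntegrableOn.union ((memLp_two_iff_integrable_sq_norm hu.1).1 hu)
    ((memLp_two_iff_integrable_sq_norm hv.1).1 hv)

theorem memLp_clm_apply_of_continuousOn {E F : Type*} [NormedAddCommGroup E] [NormedSpace ℝ E]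
    [NormedAddCommGroup F] [NormedSpace ℝ F] {A : ℝ → E →L[ℝ] F} {f : ℝ → E} {a b : ℝ}
    (hA : ContinuousOn A (Icc a b)) (hf : MemLp f 2 (volume.restrict (Icc a b))) :
    MemLp (fun t ↦ A t (f t)) 2 (volume.restrict (Icc a b)) := by
  obtain ⟨C, hC⟩ := isCompact_Icc.exists_bound_of_continuousOn hA
  have hm : AEStronglyMeasurable A (volume.restrict (Icc a b)) :=
    hA.aestronglyMeasurable_of_isCompact isCompact_Icc measurableSet_Icc
  refine hf.of_le_mul (c := C) ?_ ?_
  · exact (ContinuousLinearMap.id ℝ (E →L[ℝ] F)).aestronglyMeasurable_comp₂ hm hf.1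
  · filter_upwards [ae_restrict_mem measurableSet_Icc] with t ht
    exact (A t).le_of_opNorm_le (hC t ht) _

section ACPath

variable {E : Type*} [NormedAddCommGroup E] [NormedSpace ℝ E]
  {G : Type*} [TopologicalSpace G] [ChartedSpace E G] [Group G]
  {E₂ : Type*} [NormedAddCommGroup E₂] [NormedSpace ℝ E₂]

variable (E) in
/-- A path in `G` that is absolutely continuous in charts. -/
structure ACPath (g : ℝ → G) : Prop where
  continuousOn : ContinuousOn g (Icc 0 1)
  acNear : ∀ t₀ ∈ Icc (0 : ℝ) 1, ACNear (fun t ↦ extChartAt 𝓘(ℝ, E) (g t₀) (g t)) t₀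

variable [LieGroup 𝓘(ℝ, E) ∞ G] {g h : ℝ → G}

theorem contMDiffAt_extChartAt_symm_of_mem {x a : G} (ha : a ∈ (chartAt E x).source) :
    ContMDiffAt 𝓘(ℝ, E) 𝓘(ℝ, E) ∞ (extChartAt 𝓘(ℝ, E) x).symm (extChartAt 𝓘(ℝ, E) x a) :=
  (contMDiffOn_extChartAt_symm x).contMDiffAt
    (extChartAt_target_mem_nhds' ((extChartAt 𝓘(ℝ, E) x).map_source (by simpa using ha)))

theorem extChartAt_symm_apply_of_mem {x a : G} (ha : a ∈ (chartAt E x).source) :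
    (extChartAt 𝓘(ℝ, E) x).symm (extChartAt 𝓘(ℝ, E) x a) = a :=
  (extChartAt 𝓘(ℝ, E) x).left_inv (by simpa using ha)

/-- Smooth maps are locally Lipschitz in the chart. In particular absolute continuity does not
depend on the chart. -/
theorem ACNear.comp_contMDiffAt {t₀ : ℝ} (ht : t₀ ∈ Icc (0 : ℝ) 1) {x : G}
    (hc : ContinuousWithinAt g (Icc 0 1) t₀) (hx : g t₀ ∈ (chartAt E x).source)
    (hg : ACNear (fun t ↦ extChartAt 𝓘(ℝ, E) x (g t)) t₀) {F : G → E₂}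
    (hF : ContMDiffAt 𝓘(ℝ, E) 𝓘(ℝ, E₂) ∞ F (g t₀)) : ACNear (fun t ↦ F (g t)) t₀ := by
  have h1 : ContDiffAt ℝ ∞ (fun z ↦ F ((extChartAt 𝓘(ℝ, E) x).symm z))
      (extChartAt 𝓘(ℝ, E) x (g t₀)) := by
    refine contMDiffAt_iff_contDiffAt.1 (ContMDiffAt.comp (I' := 𝓘(ℝ, E)) _ (g := F) ?_
      (contMDiffAt_extChartAt_symm_of_mem hx))
    rwa [extChartAt_symm_apply_of_mem hx]
  refine (hg.comp_contDiffAt ht (h1.of_le (by exact_mod_cast le_top))).congr ht ?_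
  filter_upwards [hc ((chartAt E x).open_source.mem_nhds hx)] with t ht
  rw [extChartAt_symm_apply_of_mem ht]

theorem ACPath.of_chart (hc : ContinuousOn g (Icc 0 1)) (h : ∀ t₀ ∈ Icc (0 : ℝ) 1, ∃ x : G,
    g t₀ ∈ (chartAt E x).source ∧ ACNear (fun t ↦ extChartAt 𝓘(ℝ, E) x (g t)) t₀) :
    ACPath E g := by
  refine ⟨hc, fun t₀ ht ↦ ?_⟩
  obtain ⟨x, hx, hac⟩ := h t₀ ht
  exact hac.comp_contMDiffAt ht (hc t₀ ht) hx
    (contMDiffAt_extChartAt_of_mem (mem_chart_source _ _))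

theorem ACPath.mul (hg : ACPath E g) (hh : ACPath E h) : ACPath E (fun t ↦ g t * h t) := by
  have := topologicalGroup_of_lieGroup 𝓘(ℝ, E) ∞ (G := G)
  refine ⟨hg.continuousOn.mul hh.continuousOn, fun t₀ ht ↦ ?_⟩
  have h1 := (hg.acNear t₀ ht).prodMk (hh.acNear t₀ ht) ht
  set x := g t₀
  set y := h t₀
  let F : E × E → E := fun p ↦ extChartAt 𝓘(ℝ, E) (x * y)
    ((extChartAt 𝓘(ℝ, E) x).symm p.1 * (extChartAt 𝓘(ℝ, E) y).symm p.2)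
  have hF : ContDiffAt ℝ ∞ F (extChartAt 𝓘(ℝ, E) x x, extChartAt 𝓘(ℝ, E) y y) := by
    refine contMDiffAt_iff_contDiffAt.1 (ContMDiffAt.comp (I' := 𝓘(ℝ, E)) _
      (g := extChartAt 𝓘(ℝ, E) (x * y)) ?_ (ContMDiffAt.mul ?_ ?_))
    · simp only [extChartAt_to_inv]
      exact contMDiffAt_extChartAt_of_mem (mem_chart_source _ _)
    · exact ContMDiffAt.comp (I' := 𝓘(ℝ, E)) (g := (extChartAt 𝓘(ℝ, E) x).symm) _
        (contMDiffAt_extChartAt_symm_of_mem (mem_chart_source _ _))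
        contDiff_fst.contMDiff.contMDiffAt
    · exact ContMDiffAt.comp (I' := 𝓘(ℝ, E)) (g := (extChartAt 𝓘(ℝ, E) y).symm) _
        (contMDiffAt_extChartAt_symm_of_mem (mem_chart_source _ _))
        contDiff_snd.contMDiff.contMDiffAt
  refine (h1.comp_contDiffAt ht (F := F) (hF.of_le (by exact_mod_cast le_top))).congr ht ?_
  filter_upwards [hg.continuousOn t₀ ht ((chartAt E x).open_source.mem_nhds (mem_chart_source _ _)),
    hh.continuousOn t₀ ht ((chartAt E y).open_source.mem_nhds (mem_chart_source _ _))] with t h₁ h₂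
  simp only [F]
  rw [extChartAt_symm_apply_of_mem h₁, extChartAt_symm_apply_of_mem h₂]

theorem ACPath.inv (hg : ACPath E g) : ACPath E (fun t ↦ (g t)⁻¹) := by
  have := topologicalGroup_of_lieGroup 𝓘(ℝ, E) ∞ (G := G)
  refine ⟨hg.continuousOn.inv, fun t₀ ht ↦ ?_⟩
  refine (hg.acNear t₀ ht).comp_contMDiffAt ht (hg.continuousOn t₀ ht) (mem_chart_source _ _)
    (F := fun a ↦ extChartAt 𝓘(ℝ, E) (g t₀)⁻¹ a⁻¹) ?_
  exact ContMDiffAt.comp (I' := 𝓘(ℝ, E)) _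
    (contMDiffAt_extChartAt_of_mem (mem_chart_source _ _)) (contMDiff_inv 𝓘(ℝ, E) ∞).contMDiffAt

theorem ACPath.const (a : G) : ACPath E (fun _ ↦ a) := by
  refine ⟨continuousOn_const, fun t₀ ht ↦ ⟨0, 1, le_rfl, one_pos, le_rfl, self_mem_nhdsWithin, ?_⟩⟩
  exact (LipschitzWith.const _).lipschitzOnWith.absolutelyContinuousOnInterval

variable [FiniteDimensional ℝ E]

theorem ACPath.ae_hasLeftVelocity (hg : ACPath E g) :
    ∀ᵐ t ∂(volume.restrict (Icc (0 : ℝ) 1)), HasLeftVelocity g t (show E from leftLogDeriv g t) := by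
  -- `g` is controlled only on [0,1], while the velocity is a two-sided derivative; the endpoints
  -- form a null set.
  have h1 : ∀ᵐ t ∂(volume.restrict (Icc (0 : ℝ) 1)), t ∈ Ioo (0 : ℝ) 1 →
      MDifferentiableAt 𝓘(ℝ, ℝ) 𝓘(ℝ, E) g t := by
    refine ae_restrict_of_forall_nhdsWithin measurableSet_Icc fun t₀ ht ↦ ?_
    obtain ⟨U, hU, hd⟩ := (hg.acNear t₀ ht).exists_ae_differentiableAt
    refine ⟨_, inter_mem hU (hg.continuousOn t₀ ht
      ((chartAt E (g t₀)).open_source.mem_nhds (mem_chart_source _ _))), ?_⟩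
    filter_upwards [hd] with t hd htU _ hI
    exact mdifferentiableAt_of_differentiableAt_extChartAt
      (hg.continuousOn.continuousAt (Icc_mem_nhds hI.1 hI.2)) htU.2 (hd htU.1)
  filter_upwards [h1, ae_restrict_mem_Ioo] with t h h'
  exact (h h').hasLeftVelocity

/-- In a chart the path is absolutely continuous with zero derivative almost everywhere, hence
locally constant, and [0, c] is connected. The bound `c` serves the concatenation of controls, where
the velocity vanishes only on an initial interval. -/
theorem ACPath.eqOn_of_ae_hasLeftVelocity_zero (hg : ACPath E g) {c : ℝ} (hc : c ≤ 1)
    (h : ∀ᵐ t ∂(volume.restrict (Icc (0 : ℝ) 1)), t ≤ c → HasLeftVelocity g t (0 : E)) :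
    ∀ t ∈ Icc (0 : ℝ) c, g t = g 0 := by
  refine eqOn_of_forall_eventually_eq fun t₀ ht₀ ↦ ?_
  have ht : t₀ ∈ Icc (0 : ℝ) 1 := ⟨ht₀.1, ht₀.2.trans hc⟩
  obtain ⟨a, b, h₀, hab, h₁, hn, hs, hac⟩ := (hg.acNear t₀ ht).exists_subset ht
    (hg.continuousOn t₀ ht ((chartAt E (g t₀)).open_source.mem_nhds (mem_chart_source _ _)))
  have hm : t₀ ∈ Icc a b := mem_of_mem_nhdsWithin ht hn
  have hle : a ≤ min b c := le_min hab.le (hm.1.trans ht₀.2)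
  have hd : ∀ᵐ t, t ∈ uIcc a (min b c) →
      HasDerivAt (fun t ↦ extChartAt 𝓘(ℝ, E) (g t₀) (g t)) 0 t := by
    rw [uIcc_of_le hle]
    filter_upwards [(ae_restrict_iff' measurableSet_Icc).1 h] with t h ht
    rw [mem_Icc, le_min_iff] at ht
    have := (h ⟨h₀.trans ht.1, ht.2.1.trans h₁⟩ ht.2.2).hasDerivAt_extChartAt (hs ⟨ht.1, ht.2.1⟩)
    rwa [map_zero] at this
  obtain ⟨C, hC⟩ := (hac.mono (by
    rw [uIcc_of_le hle, uIcc_of_le hab.le]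
    exact Icc_subset_Icc_right (min_le_left _ _))).const_of_ae_hasDerivAt_zero hd
  rw [uIcc_of_le hle] at hC
  filter_upwards [nhdsWithin_mono t₀ (Icc_subset_Icc_right hc) hn, self_mem_nhdsWithin] with t h₁ h₂
  have e := (hC t ⟨h₁.1, le_min h₁.2 h₂.2⟩).trans (hC t₀ ⟨hm.1, le_min hm.2 ht₀.2⟩).symm
  rw [← extChartAt_symm_apply_of_mem (E := E) (hs h₁), e,
    extChartAt_symm_apply_of_mem (E := E) (hs hm)]

/-- Two absolutely continuous paths with the same velocity differ by a left translation. -/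
theorem ACPath.eq_of_ae_hasLeftVelocity (hg : ACPath E g) (hh : ACPath E h) {w : ℝ → E}
    (hw : ∀ᵐ t ∂(volume.restrict (Icc (0 : ℝ) 1)), HasLeftVelocity g t (w t))
    (hw' : ∀ᵐ t ∂(volume.restrict (Icc (0 : ℝ) 1)), HasLeftVelocity h t (w t)) :
    ∀ t ∈ Icc (0 : ℝ) 1, g t = g 0 * (h 0)⁻¹ * h t := by
  have := (hg.mul hh.inv).eqOn_of_ae_hasLeftVelocity_zero le_rfl (by
    filter_upwards [hw, hw'] with t h₁ h₂ _
    have := h₁.mul h₂.inv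
    simpa using this)
  intro t ht
  rw [← this t ht, inv_mul_cancel_right]

/-! ### `H¹`-paths -/

/-- The chart derivative is the left velocity multiplied by the chart frame, which is bounded along
the path by compactness. -/
theorem ACPath.isH1Path (hg : ACPath E g) {u : PathAlgebra E}
    (hu : ∀ᵐ t ∂(volume.restrict (Icc (0 : ℝ) 1)), HasLeftVelocity g t (u t)) :
    IsH1Path (E := E) g := by
  refine ⟨hg.continuousOn, fun t₀ ht ↦ ?_⟩
  obtain ⟨a, b, h₀, hab, h₁, hn, hs, hac⟩ := (hg.acNear t₀ ht).exists_subset ht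
    (hg.continuousOn t₀ ht ((chartAt E (g t₀)).open_source.mem_nhds (mem_chart_source _ _)))
  refine ⟨g t₀, a, b, h₀, hab, h₁, hn, hs, hac, ?_⟩
  have hsub : Icc a b ⊆ Icc 0 1 := Icc_subset_Icc h₀ h₁
  have hcf : ContinuousOn (fun t ↦ chartFrame E (g t₀) (g t)) (Icc a b) := fun t htI ↦
    (contMDiffAt_chartFrame (hs htI)).continuousAt.comp_continuousWithinAt
      ((hg.continuousOn t (hsub htI)).mono hsub)
  have hm := memLp_clm_apply_of_continuousOn hcf
    ((Lp.memLp u).mono_measure (Measure.restrict_mono_set _ hsub))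
  refine (memLp_congr_ae ?_).1 hm
  filter_upwards [ae_mono (Measure.restrict_mono_set volume hsub) hu,
    ae_restrict_mem measurableSet_Icc] with t h h'
  exact (h.hasDerivAt_extChartAt (hs h')).deriv.symm

theorem IsH1Path.acPath (hg : IsH1Path (E := E) g) : ACPath E g := by
  refine .of_chart hg.1 fun t₀ ht ↦ ?_
  obtain ⟨x, a, b, h₀, hab, h₁, hn, hs, hac, -⟩ := hg.2 t₀ ht
  exact ⟨x, hs (mem_of_mem_nhdsWithin ht hn), a, b, h₀, hab, h₁, hn, hac⟩

/-- The converse passage from chart derivatives to left velocities, with the inverse of the chart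
frame. -/
theorem IsH1Path.memLp_leftLogDeriv (hg : IsH1Path (E := E) g) :
    MemLp (fun t ↦ (show E from leftLogDeriv g t)) 2 (volume.restrict (Icc (0 : ℝ) 1)) := by
  refine memLp_two_of_forall_nhdsWithin isCompact_Icc fun t₀ ht ↦ ?_
  obtain ⟨x, a, b, h₀, hab, h₁, hn, hs, hac, hm⟩ := hg.2 t₀ ht
  refine ⟨_, hn, ?_⟩
  have hsub : Icc a b ⊆ Icc 0 1 := Icc_subset_Icc h₀ h₁
  have hcf : ContinuousOn (fun t ↦ (chartFrame E x (g t)).inverse) (Icc a b) := by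
    intro t htI
    obtain ⟨e, he⟩ := isInvertible_chartFrame (E := E) (hs htI)
    have hc : ContinuousAt ContinuousLinearMap.inverse (chartFrame E x (g t)) := by
      rw [← he]
      exact (contDiffAt_map_inverse (n := 0) e).continuousAt
    exact ContinuousAt.comp_continuousWithinAt (f := fun t ↦ chartFrame E x (g t)) hc
      ((contMDiffAt_chartFrame (hs htI)).continuousAt.comp_continuousWithinAt
        ((hg.1 t (hsub htI)).mono hsub))
  refine (memLp_congr_ae ?_).1 (memLp_clm_apply_of_continuousOn hcf hm)
  filter_upwards [ae_mono (Measure.restrict_mono_set volume hsub) hg.acPath.ae_hasLeftVelocity,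
    ae_restrict_mem measurableSet_Icc] with t h h'
  have e := (h.hasDerivAt_extChartAt (hs h')).deriv
  refine (congrArg _ e).trans ?_
  obtain ⟨e, he⟩ := isInvertible_chartFrame (E := E) (hs h')
  rw [← he, ContinuousLinearMap.inverse_equiv]
  exact e.symm_apply_apply _

end ACPath

/-! ### Existence, uniqueness and smooth dependence of transports. -/

section Transport

universe u v

variable {E : Type u} [NormedAddCommGroup E] [NormedSpace ℝ E]
  {G : Type v} [TopologicalSpace G] [ChartedSpace E G] [Group G]

/-- `g` is the absolutely continuous path with `g(0) = 1` and `dl_g⁻¹ (g') = u`. -/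
structure Transports (u : PathAlgebra E) (g : ℝ → G) : Prop where
  acPath : ACPath E g
  initial : g 0 = 1
  velocity : ∀ᵐ t ∂(volume.restrict (Icc (0 : ℝ) 1)), HasLeftVelocity g t (u t)

variable [LieGroup 𝓘(ℝ, E) ∞ G] {g h : ℝ → G} {u v : PathAlgebra E}

/-- The path `Ad(g)` of operators. -/
def adPath (hg : ContinuousOn g (Icc 0 1)) : C(Icc (0 : ℝ) 1, E →L[ℝ] E) :=
  ⟨fun t ↦ Ad E (g t), contMDiff_Ad.continuous.comp
    (hg.comp_continuous continuous_subtype_val Subtype.prop)⟩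

theorem pathExtend_adPath (hg : ContinuousOn g (Icc 0 1)) {t : ℝ} (ht : t ∈ Icc (0 : ℝ) 1) :
    pathExtend (adPath (E := E) hg) t = Ad E (g t) :=
  pathExtend_of_mem _ ht

theorem coeFn_mulPath_adPath (hg : ContinuousOn g (Icc 0 1)) (u : PathAlgebra E) :
    ∀ᵐ t ∂(volume.restrict (Icc (0 : ℝ) 1)), mulPath E (adPath hg) u t = Ad E (g t) (u t) := by
  filter_upwards [coeFn_mulPath (adPath hg) u, ae_restrict_mem measurableSet_Icc] with t h ht
  rw [h, pathExtend_adPath hg ht]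

/-- The source of the cocycle identity: in the left velocity of h g, the factor Ad(g⁻¹) of the
product rule cancels the twist Ad(g) of the control of h. -/
theorem Transports.mul (hg : Transports u g)
    (hh : Transports (mulPath E (adPath hg.acPath.continuousOn) v) h) :
    Transports (u + v) (fun t ↦ h t * g t) := by
  refine ⟨hh.acPath.mul hg.acPath, by simp [hg.initial, hh.initial], ?_⟩
  filter_upwards [hg.velocity, hh.velocity, coeFn_mulPath_adPath hg.acPath.continuousOn v,
    Lp.coeFn_add u v] with t h₁ h₂ h₃ h₄
  have := h₂.mul h₁
  rw [h₃, Ad_inv_apply_Ad, add_comm] at this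
  rwa [h₄]

variable [FiniteDimensional ℝ E]

theorem IsTransport.transports (hg : IsTransport u g) : Transports u g := by
  refine ⟨hg.isH1Path.acPath, hg.initial, ?_⟩
  filter_upwards [hg.isH1Path.acPath.ae_hasLeftVelocity, hg.equation] with t h₁ h₂
  have e : (show E from leftLogDeriv g t) = u t := h₂
  rwa [e] at h₁

/-- The `H¹` condition is automatic for an absolutely continuous solution, because the control is
square integrable. -/
theorem Transports.isTransport (hg : Transports u g) : IsTransport u g :=
  ⟨hg.acPath.isH1Path hg.velocity, hg.initial, by
    filter_upwards [hg.velocity] with t h using h.leftLogDeriv_eq⟩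

theorem Transports.eqOn (hg : Transports u g) (hh : Transports u h) :
    ∀ t ∈ Icc (0 : ℝ) 1, g t = h t := by
  intro t ht
  simpa [hg.initial, hh.initial] using
    hg.acPath.eq_of_ae_hasLeftVelocity hh.acPath hg.velocity hh.velocity t ht

variable (G) in
/-- For small controls the transport stays in the chart at `1`, in which it depends smoothly on the
control. -/
theorem exists_local_transport :
    ∃ σ : PathAlgebra E → C(Icc (0 : ℝ) 1, E), ContDiffAt ℝ ∞ σ 0 ∧
      σ 0 = ContinuousMap.const _ (extChartAt 𝓘(ℝ, E) (1 : G) 1) ∧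
      HasFDerivAt σ (primitive E) 0 ∧
      ∀ᶠ u in 𝓝 (0 : PathAlgebra E),
        Transports u (fun t ↦ (extChartAt 𝓘(ℝ, E) (1 : G)).symm (pathExtend (σ u) t)) := by
  set φ := extChartAt 𝓘(ℝ, E) (1 : G)
  set z := φ 1
  have ht : φ.target ∈ 𝓝 z := extChartAt_target_mem_nhds 1
  have hsrc : ∀ w ∈ φ.target, φ.symm w ∈ (chartAt E (1 : G)).source := fun w hw ↦ by
    simpa [φ] using φ.map_target hw
  have hΛ₀ : ∀ᶠ w in 𝓝 z, ContDiffAt ℝ ∞ (fun w ↦ chartFrame E (1 : G) (φ.symm w)) w := by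
    filter_upwards [eventually_eventually_nhds.2 ht] with w hw
    refine contMDiffAt_iff_contDiffAt.1 (ContMDiffAt.comp (I' := 𝓘(ℝ, E)) w
      (g := chartFrame E (1 : G)) (contMDiffAt_chartFrame (hsrc w hw.self_of_nhds)) ?_)
    exact (contMDiffOn_extChartAt_symm (1 : G)).contMDiffAt hw
  -- The chart frame is smooth only on the chart target, whereas the solution lemma asks for a
  -- globally smooth coefficient.
  obtain ⟨Λ, hΛ, hΛe⟩ := exists_contDiff_eventuallyEq hΛ₀
  obtain ⟨σ, h₁, h₂, h₃, h₄⟩ := exists_controlled_solution hΛ z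
  have hφ : φ.symm z = 1 := extChartAt_to_inv (I := 𝓘(ℝ, E)) (1 : G)
  -- This is why the derivative of σ at the zero control is plain integration.
  have hz : Λ z = ContinuousLinearMap.id ℝ E := by
    have : Λ z = chartFrame E (1 : G) (φ.symm z) := hΛe.self_of_nhds
    rw [this, hφ, chartFrame_one]
  refine ⟨σ, h₁, h₂, ?_, ?_⟩
  · rw [hz] at h₃
    convert! h₃ using 1
    ext1 u
    exact congrArg _ (mulPath_one u).symm
  -- Within distance ε of z the solution stays in the chart and in the region where Λ is the true
  -- chart frame.
  obtain ⟨ε, hε, hball⟩ := Metric.eventually_nhds_iff_ball.1 (hΛe.and ht)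
  have hσ : ∀ᶠ u in 𝓝 (0 : PathAlgebra E), dist (σ u) (σ 0) < ε :=
    h₁.continuousAt.eventually (Metric.ball_mem_nhds _ hε)
  filter_upwards [h₄, hσ] with u hu hd
  have hmem : ∀ t, pathExtend (σ u) t ∈ Metric.ball z ε := fun t ↦ by
    refine lt_of_le_of_lt ?_ hd
    rw [h₂]
    exact ContinuousMap.dist_apply_le_dist (f := σ u) (g := ContinuousMap.const _ z) _
  have htar : ∀ t, pathExtend (σ u) t ∈ φ.target := fun t ↦ (hball _ (hmem t)).2
  have hs : ∀ t, φ.symm (pathExtend (σ u) t) ∈ (chartAt E (1 : G)).source := fun t ↦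
    hsrc _ (htar t)
  have hright : ∀ t, φ (φ.symm (pathExtend (σ u) t)) = pathExtend (σ u) t := fun t ↦
    φ.right_inv (htar t)
  set w := mulPath E (nemytskii _ ⟨Λ, hΛ.continuous⟩ (σ u)) u
  have hx : ∀ t, pathExtend (σ u) t = z + pathExtend (primitive E w) t := fun t ↦ by
    have := congrArg (fun x : C(Icc (0 : ℝ) 1, E) ↦ pathExtend x t) hu
    exact this
  have hcont : ContinuousOn (fun t ↦ φ.symm (pathExtend (σ u) t)) (Icc 0 1) :=
    ((continuousOn_extChartAt_symm (1 : G)).comp_continuous (continuous_pathExtend _)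
      htar).continuousOn
  have hac : AbsolutelyContinuousOnInterval (pathExtend (σ u)) 0 1 :=
    (absolutelyContinuousOnInterval_pathExtend_primitive w).of_dist_le (C := 1)
      fun s _ t _ ↦ by rw [hx, hx, dist_add_left, one_mul]
  refine ⟨.of_chart hcont fun t₀ _ ↦ ⟨1, hs t₀, 0, 1, le_rfl, one_pos, le_rfl,
    self_mem_nhdsWithin, ?_⟩, ?_, ?_⟩
  · exact hac.congr fun t _ ↦ (hright t).symm
  · rw [hx, pathExtend_primitive _ (by simp), intervalIntegral.integral_same, add_zero, hφ]
  · have := FiniteDimensional.complete ℝ E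
    filter_upwards [ae_hasDerivAt_pathExtend_primitive w,
      coeFn_mulPath (nemytskii _ ⟨Λ, hΛ.continuous⟩ (σ u)) u, ae_restrict_mem_Ioo] with t h₁ h₂ hI
    have hdx : HasDerivAt (pathExtend (σ u)) (w t) t := by
      have : pathExtend (σ u) = fun t ↦ z + pathExtend (primitive E w) t := funext hx
      rw [this]
      exact h₁.const_add z
    have hdx' : HasDerivAt (fun s ↦ φ (φ.symm (pathExtend (σ u) s))) (w t) t := by
      simpa only [hright] using hdx
    have hw : w t = chartFrame E (1 : G) (φ.symm (pathExtend (σ u) t)) (u t) := by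
      rw [h₂]
      exact DFunLike.congr_fun (hball _ (hmem t)).1 (u t)
    have hv := (mdifferentiableAt_of_differentiableAt_extChartAt
      (hcont.continuousAt (Icc_mem_nhds hI.1 hI.2)) (hs t) hdx'.differentiableAt).hasLeftVelocity
    -- The chart derivative computed from the left velocity equals the one given by the equation;
    -- since the chart frame is invertible, the left velocity is u(t).
    have hinj := (hv.hasDerivAt_extChartAt (hs t)).unique hdx'
    rw [hw] at hinj
    obtain ⟨e, he⟩ := isInvertible_chartFrame (E := E) (hs t)
    rw [← he] at hinj
    rwa [e.injective hinj] at hv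

/-- The path that agrees with `u` on `s` and vanishes outside. -/
def cutPath {s : Set ℝ} (hs : MeasurableSet s) (u : PathAlgebra E) : PathAlgebra E :=
  ((Lp.memLp u).indicator hs).toLp

theorem coeFn_cutPath {s : Set ℝ} (hs : MeasurableSet s) (u : PathAlgebra E) :
    ∀ᵐ t ∂(volume.restrict (Icc (0 : ℝ) 1)), cutPath hs u t = s.indicator u t :=
  ((Lp.memLp u).indicator hs).coeFn_toLp

/-- Up to time s the path h rests at 1, so Ad(h⁻¹) is trivial; after s the velocity of g is zero. In
both cases the product rule gives u + v. -/
theorem Transports.concat {s : ℝ} (hs : s ≤ 1)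
    (hg : Transports u g) (hh : Transports v h)
    (hu : ∀ᵐ t ∂(volume.restrict (Icc (0 : ℝ) 1)), s < t → u t = 0)
    (hv : ∀ᵐ t ∂(volume.restrict (Icc (0 : ℝ) 1)), t ≤ s → v t = 0) :
    Transports (u + v) (fun t ↦ g t * h t) := by
  refine ⟨hg.acPath.mul hh.acPath, by simp [hg.initial, hh.initial], ?_⟩
  have h1 : ∀ t ∈ Icc 0 s, h t = 1 := by
    rw [← hh.initial]
    refine hh.acPath.eqOn_of_ae_hasLeftVelocity_zero hs ?_
    filter_upwards [hh.velocity, hv] with t h₁ h₂ h₃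
    rwa [h₂ h₃] at h₁
  filter_upwards [hg.velocity, hh.velocity, Lp.coeFn_add u v, hu,
    ae_restrict_mem measurableSet_Icc] with t h₁ h₂ h₃ h₄ h₅
  have := h₁.mul h₂
  rw [h₃, Pi.add_apply]
  rcases le_or_gt t s with hts | hts
  · rwa [h1 t ⟨h₅.1, hts⟩, inv_one, Ad_one] at this
  · rw [h₄ hts, map_zero] at this
    rw [h₄ hts]
    exact this

/-- [0,1] is divided into N + 1 intervals on each of which u is small in L². The transport on each
piece is the local one of a control vanishing elsewhere, and the pieces are multiplied together. -/
theorem exists_transports (u : PathAlgebra E) : ∃ g : ℝ → G, Transports u g := by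
  obtain ⟨σ, -, -, -, hσ⟩ := exists_local_transport (E := E) G
  obtain ⟨ε, hε, hsmall⟩ := Metric.eventually_nhds_iff_ball.1 hσ
  -- Absolute continuity of the integral of ‖u‖²: restrictions of u to sets of measure at most δ
  -- have norm at most ε / 2.
  obtain ⟨δ, hδ, hind⟩ := (Lp.memLp u).eLpNorm_indicator_le (by norm_num) (by norm_num)
    (half_pos hε)
  obtain ⟨N, hN⟩ := exists_nat_one_div_lt hδ
  set c : ℝ := 1 / ((N : ℝ) + 1) with hc
  have hc0 : 0 < c := by positivity
  have key : ∀ n : ℕ, n ≤ N + 1 →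
      ∃ g : ℝ → G, Transports (cutPath (measurableSet_Iic (a := n * c)) u) g := by
    intro n
    induction n with
    | zero =>
      intro _
      refine ⟨fun _ ↦ 1, ACPath.const 1, rfl, ?_⟩
      filter_upwards [coeFn_cutPath (measurableSet_Iic (a := ((0 : ℕ) : ℝ) * c)) u,
        ae_restrict_mem_Ioo] with t h₁ h₂
      rw [h₁, indicator_of_notMem]
      · exact HasLeftVelocity.const 1 t
      · simpa using h₂.1
    | succ n ih =>
      intro hn
      obtain ⟨g, hg⟩ := ih (by omega)
      have hn1 : n * c ≤ 1 := by
        rw [hc, mul_one_div, div_le_one (by positivity)]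
        exact_mod_cast (by omega : n ≤ N + 1)
      set p := cutPath (measurableSet_Ioc (a := n * c) (b := (n + 1) * c)) u
      have hp : p ∈ Metric.ball 0 ε := by
        rw [mem_ball_zero_iff]
        simp only [p, cutPath]
        rw [Lp.norm_toLp]
        have h1 := hind (Ioc (n * c) ((n + 1) * c)) measurableSet_Ioc (by
          refine (Measure.restrict_apply_le _ _).trans ?_
          rw [Real.volume_Ioc]
          refine ENNReal.ofReal_le_ofReal ?_
          linarith)
        refine (ENNReal.toReal_mono ENNReal.ofReal_ne_top h1).trans_lt ?_
        rw [ENNReal.toReal_ofReal (by positivity)]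
        linarith
      have hh := hsmall p hp
      have := Transports.concat hn1 hg hh (by
        filter_upwards [coeFn_cutPath (measurableSet_Iic (a := n * c)) u] with t h₁ h₂
        rw [h₁, indicator_of_notMem]
        simpa using h₂) (by
        filter_upwards [coeFn_cutPath (measurableSet_Ioc (a := n * c) (b := (n + 1) * c)) u]
          with t h₁ h₂
        rw [h₁, indicator_of_notMem]
        simpa using fun h ↦ absurd h (not_lt.2 h₂))
      refine ⟨_, Eq.mpr (congrArg (Transports · _) ?_) this⟩
      refine Lp.ext ?_
      simp only [Nat.cast_add, Nat.cast_one]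
      filter_upwards [coeFn_cutPath (measurableSet_Iic (a := (n + 1) * c)) u,
        Lp.coeFn_add (cutPath (measurableSet_Iic (a := n * c)) u) p,
        coeFn_cutPath (measurableSet_Iic (a := n * c)) u,
        coeFn_cutPath (measurableSet_Ioc (a := n * c) (b := (n + 1) * c)) u] with t h₁ h₂ h₃ h₄
      rw [h₁, h₂, Pi.add_apply, h₃, h₄, ← Iic_union_Ioc_eq_Iic (a := n * c) (by nlinarith),
        indicator_union_of_disjoint (Iic_disjoint_Ioc le_rfl)]
  obtain ⟨g, hg⟩ := key (N + 1) le_rfl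
  refine ⟨g, ?_⟩
  convert! hg using 1
  ext1
  filter_upwards [coeFn_cutPath (measurableSet_Iic (a := ((N + 1 : ℕ) : ℝ) * c)) u,
    ae_restrict_mem measurableSet_Icc] with t h₁ h₂
  rw [h₁, indicator_of_mem]
  have : ((N + 1 : ℕ) : ℝ) * c = 1 := by
    rw [hc]; push_cast; field_simp
  rw [this]
  exact h₂.2

variable (G) in
/-- The transport of a square integrable path in the Lie algebra. -/
def transport (u : PathAlgebra E) : ℝ → G := (exists_transports u).choose

theorem transports_transport (u : PathAlgebra E) : Transports u (transport G u) :=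
  (exists_transports u).choose_spec

theorem Transports.eq_transport (hg : Transports u g) :
    ∀ t ∈ Icc (0 : ℝ) 1, g t = transport G u t :=
  hg.eqOn (transports_transport u)

theorem parallelTransport_eq (u : PathAlgebra E) :
    (parallelTransport u : G) = transport G u 1 := by
  have h : ∃ g : ℝ → G, IsTransport u g := ⟨_, (transports_transport u).isTransport⟩
  unfold parallelTransport
  rw [dif_pos h]
  exact h.choose_spec.transports.eq_transport 1 (by simp)

end Transport

/-! ### Transport and parallel transport at the zero control. -/

section ParallelTransport

universe u v

variable {E : Type u} [NormedAddCommGroup E] [NormedSpace ℝ E]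
  {G : Type v} [TopologicalSpace G] [ChartedSpace E G] [Group G]

variable (E G) in
/-- The derivative of the adjoint representation at `1`. -/
def adDeriv : E →L[ℝ] E →L[ℝ] E := modelDeriv E (E →L[ℝ] E) (fun a : G ↦ Ad E a) 1

variable [LieGroup 𝓘(ℝ, E) ∞ G]

theorem hasModelDerivAt_Ad_one :
    HasModelDerivAt (fun a : G ↦ Ad E a) (adDeriv E G) 1 :=
  contMDiff_Ad.contMDiffAt.hasModelDerivAt

theorem hasModelDerivAt_inv_one :
    HasModelDerivAt (fun a : G ↦ a⁻¹) (-ContinuousLinearMap.id ℝ E) 1 := by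
  have h1 : HasModelDerivAt (fun a : G ↦ a⁻¹) (modelDeriv E E (fun a : G ↦ a⁻¹) 1) 1 :=
    (contMDiff_inv 𝓘(ℝ, E) ∞).contMDiffAt.hasModelDerivAt
  have h2 := h1.mul (hasModelDerivAt_id (E₁ := E) (1 : G))
  simp only [inv_mul_cancel, inv_one, one_mul, mul_one] at h2
  have h3 := h2.unique (hasModelDerivAt_const (1 : G) 1)
  rw [(hasModelDerivAt_id (E₁ := E) (1 : G)).modelDeriv_eq] at h3
  have h4 : modelDeriv E E (fun a : G ↦ a⁻¹) 1 = -ContinuousLinearMap.id ℝ E := by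
    refine eq_neg_of_add_eq_zero_left ?_
    exact h3
  rwa [h4] at h1

theorem hasModelDerivAt_extChartAt_symm_self :
    HasModelDerivAt (extChartAt 𝓘(ℝ, E) (1 : G)).symm (ContinuousLinearMap.id ℝ E)
      (extChartAt 𝓘(ℝ, E) (1 : G) 1) := by
  have h := (contMDiffAt_extChartAt_symm_of_mem (E := E)
    (mem_chart_source E (1 : G))).hasModelDerivAt
  have h' := (hasModelDerivAt_extChartAt_self (E₁ := E) (1 : G)).comp h
    (extChartAt_to_inv (I := 𝓘(ℝ, E)) (1 : G))
  have h'' := h'.unique ((hasModelDerivAt_id _).congr_of_eventuallyEq (by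
    filter_upwards [extChartAt_target_mem_nhds (I := 𝓘(ℝ, E)) (1 : G)] with w hw
    exact (extChartAt 𝓘(ℝ, E) (1 : G)).right_inv hw))
  rw [ContinuousLinearMap.id_comp] at h''
  rwa [h''] at h

/-- Differentiation of Ad(a x a⁻¹) Ad(a) = Ad(a) Ad(x) at x = 1. -/
theorem adDeriv_Ad_comp (a : G) (X : E) :
    adDeriv E G (Ad E a X) ∘L Ad E a = Ad E a ∘L adDeriv E G X := by
  have h1 := (hasModelDerivAt_Ad_one (E := E) (G := G)).comp (hasModelDerivAt_Ad (E := E) a)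
    (by simp)
  have hl : ∀ (B : E →L[ℝ] E), HasModelDerivAt (fun C : E →L[ℝ] E ↦ C ∘L B)
      ((ContinuousLinearMap.compL ℝ E E E).flip B) (Ad E (a * 1 * a⁻¹)) := fun B ↦
    hasModelDerivAt_iff_hasFDerivAt.2 ((ContinuousLinearMap.compL ℝ E E E).flip B).hasFDerivAt
  have h2 := (hl (Ad E a)).comp h1 rfl
  have h3 := (hasModelDerivAt_iff_hasFDerivAt.2
    ((ContinuousLinearMap.compL ℝ E E E (Ad E a)).hasFDerivAt (x := Ad E (1 : G)))).comp
    (hasModelDerivAt_Ad_one (E := E) (G := G)) rfl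
  have h4 : (fun x : G ↦ Ad E (a * x * a⁻¹) ∘L Ad E a) =
      fun x ↦ ContinuousLinearMap.compL ℝ E E E (Ad E a) (Ad E x) := by
    ext1 x
    rw [← Ad_mul, inv_mul_cancel_right, Ad_mul]
    rfl
  rw [h4] at h2
  exact congrArg (· X) (h2.unique h3)

variable [FiniteDimensional ℝ E] {E' : Type u} [NormedAddCommGroup E'] [NormedSpace ℝ E']

/-- A function of the transport, as a continuous path. -/
def transportComp (f : C(G, E')) (u : PathAlgebra E) : C(Icc (0 : ℝ) 1, E') :=
  ⟨fun t ↦ f (transport G u t), f.continuous.comp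
    ((transports_transport u).acPath.continuousOn.comp_continuous continuous_subtype_val
      Subtype.prop)⟩

/-- Near the zero control, f ∘ g_u is the chart path σ(u) followed pointwise by a smooth map between
vector spaces, so the smoothness of `nemytskii` applies. -/
theorem contDiffAt_transportComp_zero {f : C(G, E')} (hf : ContMDiff 𝓘(ℝ, E) 𝓘(ℝ, E') ∞ f) :
    ContDiffAt ℝ ∞ (transportComp (E := E) f) 0 ∧
    HasFDerivAt (transportComp (E := E) f)
      (pointwiseApply _ E E' (ContinuousMap.const _ (modelDeriv E E' f 1)) ∘L primitive E) 0 := by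
  obtain ⟨σ, h₁, h₂, h₃, h₄⟩ := exists_local_transport (E := E) G
  set φ := extChartAt 𝓘(ℝ, E) (1 : G)
  set z := φ 1
  have hz : φ.symm z = 1 := extChartAt_to_inv (I := 𝓘(ℝ, E)) (1 : G)
  have hQ : ∀ᶠ w in 𝓝 z, ContDiffAt ℝ ∞ (fun w ↦ f (φ.symm w)) w := by
    filter_upwards [eventually_eventually_nhds.2 (extChartAt_target_mem_nhds (1 : G))] with w hw
    exact contMDiffAt_iff_contDiffAt.1 (hf.contMDiffAt.comp w
      ((contMDiffOn_extChartAt_symm (1 : G)).contMDiffAt hw))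
  obtain ⟨Q, hQ, hQe⟩ := exists_contDiff_eventuallyEq hQ
  obtain ⟨ε, hε, hball⟩ := Metric.eventually_nhds_iff_ball.1 hQe
  have hσ : ∀ᶠ u in 𝓝 (0 : PathAlgebra E), dist (σ u) (σ 0) < ε :=
    h₁.continuousAt.eventually (Metric.ball_mem_nhds _ hε)
  have heq : transportComp f =ᶠ[𝓝 0] fun u ↦ nemytskii _ ⟨Q, hQ.continuous⟩ (σ u) := by
    filter_upwards [h₄, hσ] with u hu hd
    ext t
    have h5 : σ u t ∈ Metric.ball z ε := by
      refine lt_of_le_of_lt ?_ hd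
      rw [h₂]
      exact ContinuousMap.dist_apply_le_dist (f := σ u) (g := ContinuousMap.const _ z) _
    change f (transport G u t) = Q (σ u t)
    rw [hball _ h5, ← hu.eq_transport t t.2, pathExtend_of_mem _ t.2]
  have hd : HasFDerivAt (fun w ↦ Q w) (modelDeriv E E' f 1) z := by
    refine HasFDerivAt.congr_of_eventuallyEq ?_ hQe
    refine hasModelDerivAt_iff_hasFDerivAt.1 ?_
    exact (hf.contMDiffAt.hasModelDerivAt (x := (1 : G))).comp
      hasModelDerivAt_extChartAt_symm_self hz
  refine ⟨((contDiff_nemytskii hQ).contDiffAt.comp _ h₁).congr_of_eventuallyEq heq, ?_⟩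
  refine HasFDerivAt.congr_of_eventuallyEq ?_ heq
  convert! (hasFDerivAt_nemytskii (K := Icc (0 : ℝ) 1) (hQ.of_le (by simp)) (σ 0)).comp _ h₃ using 3
  ext1 t
  rw [h₂]
  exact hd.fderiv.symm

/-- In the chart at 1, Φ is the endpoint of σ(u). The chart has the identity as derivative at 1,
which leaves u ↦ ∫₀¹ u. -/
theorem contMDiffAt_parallelTransport_zero :
    ContMDiffAt 𝓘(ℝ, PathAlgebra E) 𝓘(ℝ, E) ∞ (parallelTransport : PathAlgebra E → G) 0 ∧
    HasModelDerivAt (parallelTransport : PathAlgebra E → G)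
      (ContinuousMap.evalCLM ℝ (⟨1, by simp⟩ : Icc (0 : ℝ) 1) ∘L primitive E) 0 := by
  obtain ⟨σ, h₁, h₂, h₃, h₄⟩ := exists_local_transport (E := E) G
  set φ := extChartAt 𝓘(ℝ, E) (1 : G)
  set z := φ 1
  set e : C(Icc (0 : ℝ) 1, E) →L[ℝ] E := ContinuousMap.evalCLM ℝ (⟨1, by simp⟩ : Icc (0 : ℝ) 1)
  have heq : (parallelTransport : PathAlgebra E → G) =ᶠ[𝓝 0] fun u ↦ φ.symm (e (σ u)) := by
    filter_upwards [h₄] with u hu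
    rw [parallelTransport_eq, ← hu.eq_transport 1 (by simp), pathExtend_of_mem _ (by simp)]
    rfl
  have he : e (σ 0) = z := by rw [h₂]; rfl
  have hsm : ContMDiffAt 𝓘(ℝ, E) 𝓘(ℝ, E) ∞ φ.symm z :=
    contMDiffAt_extChartAt_symm_of_mem (E := E) (mem_chart_source E (1 : G))
  have h5 : ContDiffAt ℝ ∞ (fun u ↦ e (σ u)) 0 := e.contDiff.contDiffAt.comp _ h₁
  refine ⟨ContMDiffAt.congr_of_eventuallyEq ?_ heq, HasModelDerivAt.congr_of_eventuallyEq ?_ heq⟩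
  · exact ContMDiffAt.comp _ (by rw [he]; exact hsm) h5.contMDiffAt
  · have := hasModelDerivAt_extChartAt_symm_self.comp (hasModelDerivAt_iff_hasFDerivAt.2
      (e.hasFDerivAt.comp _ h₃)) he
    rwa [ContinuousLinearMap.id_comp] at this

end ParallelTransport

/-! ### The cocycle identity and the operators Ad(g_u⁻¹ Φ(u)). -/

section AdFrame

universe u v

variable {E : Type u} [NormedAddCommGroup E] [NormedSpace ℝ E] [FiniteDimensional ℝ E]
  {G : Type v} [TopologicalSpace G] [ChartedSpace E G] [Group G] [LieGroup 𝓘(ℝ, E) ∞ G]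

theorem continuousOn_transport (u : PathAlgebra E) : ContinuousOn (transport G u) (Icc 0 1) :=
  (transports_transport u).acPath.continuousOn

instance : Mul C(Icc (0 : ℝ) 1, E →L[ℝ] E) := ContinuousMap.instMul

variable (E) in
/-- The constant continuous path. -/
def constC : E →L[ℝ] C(Icc (0 : ℝ) 1, E) :=
  LinearMap.mkContinuous
    { toFun := fun x ↦ ContinuousMap.const _ x
      map_add' := fun _ _ ↦ rfl
      map_smul' := fun _ _ ↦ rfl } 1 fun x ↦ by
    rw [one_mul]
    exact (ContinuousMap.norm_le _ (norm_nonneg x)).2 fun _ ↦ le_rfl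

variable (E) in
/-- Composition of paths of operators, as a bilinear map. -/
def pathCompₗ : C(Icc (0 : ℝ) 1, E →L[ℝ] E) →ₗ[ℝ] C(Icc (0 : ℝ) 1, E →L[ℝ] E) →ₗ[ℝ]
    C(Icc (0 : ℝ) 1, E →L[ℝ] E) :=
  LinearMap.mk₂ ℝ (fun A B ↦ A * B)
    (fun _ _ _ ↦ by ext; rfl) (fun _ _ _ ↦ by ext; rfl)
    (fun A _ _ ↦ by ext t x; exact map_add (A t) _ _)
    (fun _ A _ ↦ by ext t x; exact map_smul (A t) _ _)

variable (E) in
/-- Composition of paths of operators, as a bounded bilinear map. -/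
def pathComp : C(Icc (0 : ℝ) 1, E →L[ℝ] E) →L[ℝ] C(Icc (0 : ℝ) 1, E →L[ℝ] E) →L[ℝ]
    C(Icc (0 : ℝ) 1, E →L[ℝ] E) :=
  LinearMap.mkContinuous₂ (pathCompₗ E) 1 (fun A B ↦ by
    rw [one_mul]
    refine (ContinuousMap.norm_le _ (by positivity)).2 fun t ↦ ?_
    exact ((A t).opNorm_comp_le (B t)).trans
      (mul_le_mul (A.norm_coe_le_norm t) (B.norm_coe_le_norm t) (norm_nonneg _) (norm_nonneg _)))

theorem transports_zero : Transports (0 : PathAlgebra E) (fun _ ↦ (1 : G)) := by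
  refine ⟨ACPath.const 1, rfl, ?_⟩
  filter_upwards [Lp.coeFn_zero E 2 (volume.restrict (Icc (0 : ℝ) 1))] with t ht
  rw [ht]
  exact HasLeftVelocity.const 1 t

theorem transport_zero {t : ℝ} (ht : t ∈ Icc (0 : ℝ) 1) :
    transport G (0 : PathAlgebra E) t = 1 :=
  (transports_zero.eq_transport t ht).symm

theorem parallelTransport_zero : (parallelTransport (0 : PathAlgebra E) : G) = 1 := by
  rw [parallelTransport_eq, transport_zero (by simp)]

variable (G) in
/-- The path `Ad(g_u)` of operators. -/
def adTransport (u : PathAlgebra E) : C(Icc (0 : ℝ) 1, E →L[ℝ] E) :=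
  adPath (continuousOn_transport (G := G) u)

theorem adTransport_apply (u : PathAlgebra E) (t : Icc (0 : ℝ) 1) :
    adTransport G u t = Ad E (transport G u t) := rfl

/-- This moves the base point u to 0: with u fixed, v ↦ Ad(g_u) v is bounded and linear, and g_u is
a fixed right factor. -/
theorem transport_add (u v : PathAlgebra E) {t : ℝ} (ht : t ∈ Icc (0 : ℝ) 1) :
    transport G (u + v) t =
      transport G (mulPath E (adTransport G u) v) t * transport G u t :=
  (((transports_transport u).mul (transports_transport _)).eq_transport t ht).symm

theorem parallelTransport_add (u v : PathAlgebra E) :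
    (parallelTransport (u + v) : G) =
      parallelTransport (mulPath E (adTransport G u) v) * parallelTransport u := by
  simp only [parallelTransport_eq, transport_add u v (t := 1) (by simp)]

variable (G) in
/-- The path `Ad(g_u⁻¹)` of operators. -/
def adTransportInv (u : PathAlgebra E) : C(Icc (0 : ℝ) 1, E →L[ℝ] E) :=
  transportComp ⟨fun a : G ↦ Ad E a⁻¹, by
    have := topologicalGroup_of_lieGroup 𝓘(ℝ, E) ∞ (G := G)
    exact (contMDiff_Ad (E := E)).continuous.comp continuous_inv⟩ u

variable (G) in
/-- The path `Ad(g_u⁻¹ Φ(u))` of operators, which maps constant paths to horizontal vectors. -/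
def adFrame (u : PathAlgebra E) : C(Icc (0 : ℝ) 1, E →L[ℝ] E) :=
  adTransportInv G u * constC _ (Ad E (parallelTransport u : G))

theorem adFrame_apply (u : PathAlgebra E) (t : Icc (0 : ℝ) 1) :
    adFrame G u t = Ad E ((transport G u t)⁻¹ * parallelTransport u) := by
  rw [Ad_mul]; rfl

variable (G) in
/-- The inverse of `adFrame`. -/
def adFrameInv (u : PathAlgebra E) : C(Icc (0 : ℝ) 1, E →L[ℝ] E) :=
  constC _ (Ad E (parallelTransport u : G)⁻¹) * adTransport G u

theorem adFrameInv_mul (u : PathAlgebra E) : adFrameInv G u * adFrame G u = 1 := by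
  ext t x
  change Ad E _ (Ad E _ (Ad E _ (Ad E _ x))) = x
  rw [Ad_apply_Ad_inv, Ad_inv_apply_Ad]

theorem mulPath_adFrameInv_adFrame (u c : PathAlgebra E) :
    mulPath E (adFrameInv G u) (mulPath E (adFrame G u) c) = c := by
  rw [← mulPath_mul, adFrameInv_mul, mulPath_one]

theorem adTransport_mul_adFrame (u : PathAlgebra E) :
    adTransport G u * adFrame G u = constC _ (Ad E (parallelTransport u : G)) := by
  ext t x
  exact Ad_apply_Ad_inv _ _

theorem primitive_mulPath_const (A : E →L[ℝ] E) (c : PathAlgebra E) (t : Icc (0 : ℝ) 1) :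
    primitive E (mulPath E (constC _ A) c) t = A (primitive E c t) := by
  have := FiniteDimensional.complete ℝ E
  rw [primitive_apply, primitive_apply, ← A.intervalIntegral_comp_comm
    (c.intervalIntegrable (by simp) t.2)]
  refine intervalIntegral.integral_congr_ae_restrict ?_
  rw [uIoc_of_le t.2.1]
  refine ae_restrict_of_ae_restrict_of_subset
    (Ioc_subset_Icc_self.trans (Icc_subset_Icc_right t.2.2)) ?_
  filter_upwards [coeFn_mulPath (constC _ A) c] with s hs
  exact hs

/-- With w = Ad(g_u) v one has (g_w g_u)⁻¹ Φ(w) Φ(u) = g_u⁻¹ (g_w⁻¹ Φ(w)) Φ(u). -/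
theorem adFrame_add (u v : PathAlgebra E) :
    adFrame G (u + v) = adTransportInv G u *
      (adFrame G (mulPath E (adTransport G u) v) *
        constC _ (Ad E (parallelTransport u : G))) := by
  ext1 t
  change _ = Ad E _ ∘L (adFrame G _ t ∘L Ad E _)
  rw [adFrame_apply, adFrame_apply, transport_add u v t.2, parallelTransport_add, ← Ad_mul,
    ← Ad_mul]
  congr 1
  group

theorem contMDiff_parallelTransport :
    ContMDiff 𝓘(ℝ, PathAlgebra E) 𝓘(ℝ, E) ∞ (parallelTransport : PathAlgebra E → G) := by
  intro u
  have h : (parallelTransport : PathAlgebra E → G) = fun v ↦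
      parallelTransport (mulPath E (adTransport G u) (v - u)) * parallelTransport u := by
    ext1 v
    rw [← parallelTransport_add, add_sub_cancel]
  rw [h]
  refine ContMDiffAt.mul (ContMDiffAt.comp (I' := 𝓘(ℝ, PathAlgebra E)) u
    (g := (parallelTransport : PathAlgebra E → G)) ?_ ?_) contMDiffAt_const
  · rw [sub_self, map_zero]
    exact contMDiffAt_parallelTransport_zero.1
  · exact ((mulPath E (adTransport G u)).contDiff.comp
      (contDiff_id.sub contDiff_const)).contDiffAt.contMDiffAt

section

variable {E₂ : Type*} [NormedAddCommGroup E₂] [NormedSpace ℝ E₂]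
  {M₂ : Type*} [TopologicalSpace M₂] [ChartedSpace E₂ M₂]

/-- The derivative of `f ∘ Φ`, for a function `f` on `G`. -/
theorem modelDeriv_comp_parallelTransport {f : G → M₂} {u : PathAlgebra E}
    (hf : MDifferentiableAt 𝓘(ℝ, E) 𝓘(ℝ, E₂) f (parallelTransport u)) (c : PathAlgebra E) :
    modelDeriv (PathAlgebra E) E₂ (fun v ↦ f (parallelTransport v)) u (mulPath E (adFrame G u) c) =
      leftDeriv E E₂ f (parallelTransport u) (primitive E c ⟨1, by simp⟩) := by
  set a : G := parallelTransport u
  have h : (fun v ↦ f (parallelTransport v)) = fun v ↦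
      (fun x ↦ f (x * a)) (parallelTransport (mulPath E (adTransport G u) (v - u))) := by
    ext1 v
    exact congrArg f ((congrArg _ (add_sub_cancel u v).symm).trans (parallelTransport_add u _))
  have h0 : (parallelTransport (mulPath E (adTransport G u) (u - u)) : G) = 1 := by
    rw [sub_self, map_zero, parallelTransport_zero]
  have h1 : HasModelDerivAt (fun v ↦ mulPath E (adTransport G u) (v - u))
      (mulPath E (adTransport G u)) u := by
    refine hasModelDerivAt_iff_hasFDerivAt.2 ?_
    exact (mulPath E (adTransport G u)).hasFDerivAt.comp u ((hasFDerivAt_id u).sub_const u)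
  have h2 := contMDiffAt_parallelTransport_zero (E := E) (G := G).2.comp h1 (by simp)
  have h3 : HasModelDerivAt (fun x : G ↦ f (x * a)) (modelDeriv E E₂ (fun x : G ↦ f (x * a)) 1)
      1 := by
    refine MDifferentiableAt.hasModelDerivAt ?_
    refine MDifferentiableAt.comp (I' := 𝓘(ℝ, E)) (1 : G) (g := f) ?_
      (hasModelDerivAt_dright a).mdifferentiableAt
    rwa [one_mul]
  have h4 := (h3.comp h2 h0).modelDeriv_eq
  rw [h, h4]
  have h5 := leftDeriv_apply_Ad (E := E) (f := f) 1 a (by rwa [one_mul])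
    (primitive E c ⟨1, by simp⟩)
  simp only [one_mul] at h5
  rw [← h5]
  refine congrArg (modelDeriv E E₂ (fun x : G ↦ f (x * a)) 1) ?_
  change primitive E (mulPath E (adTransport G u) (mulPath E (adFrame G u) c)) _ = _
  -- Ad(g_u) cancels the path in the frame and leaves the constant Ad(Φ(u)), which commutes with
  -- integration and converts the right translation by Φ(u) into the left one.
  rw [← mulPath_mul, adTransport_mul_adFrame, primitive_mulPath_const]

end

/-- Product rule for Ad(g_u(t)⁻¹) Ad(Φ(u)) at u = 0: the factors contribute -ad(∫₀ᵗ c) and ad(∫₀¹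
c). -/
theorem contDiffAt_adFrame_zero : ContDiffAt ℝ ∞ (adFrame (E := E) G) 0 ∧
    ∀ c t, fderiv ℝ (adFrame (E := E) G) 0 c t =
      adDeriv E G (primitive E c ⟨1, by simp⟩ - primitive E c t) := by
  have hf : ContMDiff 𝓘(ℝ, E) 𝓘(ℝ, E →L[ℝ] E) ∞ (fun a : G ↦ Ad E a⁻¹) :=
    contMDiff_Ad.comp (contMDiff_inv 𝓘(ℝ, E) ∞)
  obtain ⟨h1, h2⟩ := contDiffAt_transportComp_zero (f := ⟨_, hf.continuous⟩) hf
  have h3 : ContDiffAt ℝ ∞ (fun u : PathAlgebra E ↦ Ad E (parallelTransport u : G)) 0 :=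
    (contMDiff_Ad.comp contMDiff_parallelTransport).contMDiffAt.contDiffAt
  have h4 : HasFDerivAt (fun u : PathAlgebra E ↦ Ad E (parallelTransport u : G))
      (adDeriv E G ∘L (ContinuousMap.evalCLM ℝ (⟨1, by simp⟩ : Icc (0 : ℝ) 1) ∘L primitive E)) 0 :=
    hasModelDerivAt_iff_hasFDerivAt.1 (hasModelDerivAt_Ad_one.comp
      contMDiffAt_parallelTransport_zero.2 parallelTransport_zero)
  have h5 := (constC (E →L[ℝ] E)).hasFDerivAt.comp 0 h4
  have hd : HasFDerivAt (adFrame (E := E) G) _ 0 :=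
    (pathComp E).hasFDerivAt_of_bilinear h2 h5
  refine ⟨(pathComp E).isBoundedBilinearMap.contDiff.contDiffAt.comp 0
    (h1.prodMk ((constC (E →L[ℝ] E)).contDiff.contDiffAt.comp 0 h3)), fun c t ↦ ?_⟩
  have h6 : modelDeriv E (E →L[ℝ] E) (fun a : G ↦ Ad E a⁻¹) 1 = -adDeriv E G := by
    rw [((hasModelDerivAt_Ad_one (E := E) (G := G)).comp hasModelDerivAt_inv_one
      inv_one).modelDeriv_eq]
    ext; simp
  rw [hd.fderiv]
  ext x
  change Ad E (transport G 0 t)⁻¹ (adDeriv E G (primitive E c _) x) +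
    modelDeriv E (E →L[ℝ] E) (fun a : G ↦ Ad E a⁻¹) 1 (primitive E c t)
      (Ad E (parallelTransport (0 : PathAlgebra E) : G) x) = _
  rw [h6, transport_zero t.2, parallelTransport_zero, inv_one, Ad_one, map_sub]
  exact (sub_eq_add_neg _ _).symm

/-- The case u = 0 is carried to u by `adFrame_add`. Directions are written as F_u c because Ad(g_u)
F_u is the constant Ad(Φ(u)). -/
theorem contDiff_adFrame : ContDiff ℝ ∞ (adFrame (E := E) G) ∧
    ∀ u c t, fderiv ℝ (adFrame (E := E) G) u (mulPath E (adFrame G u) c) t =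
      adFrame G u t ∘L adDeriv E G (primitive E c ⟨1, by simp⟩ - primitive E c t) := by
  -- `T u` is the operation C ↦ Ad(g_u⁻¹) C Ad(Φ(u)).
  set T : PathAlgebra E → C(Icc (0 : ℝ) 1, E →L[ℝ] E) →L[ℝ] C(Icc (0 : ℝ) 1, E →L[ℝ] E) :=
    fun u ↦ pathComp E (adTransportInv G u) ∘L
      (pathComp E).flip (constC _ (Ad E (parallelTransport u : G))) with hT
  have h : ∀ u : PathAlgebra E, adFrame G = fun v ↦
      T u (adFrame G (mulPath E (adTransport G u) (v - u))) := fun u ↦ by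
    ext1 v
    exact (congrArg _ (add_sub_cancel u v).symm).trans (adFrame_add u _)
  have hl : ∀ u, HasFDerivAt (fun v ↦ mulPath E (adTransport G u) (v - u))
      (mulPath E (adTransport G u)) u := fun u ↦
    (mulPath E (adTransport G u)).hasFDerivAt.comp u ((hasFDerivAt_id u).sub_const u)
  have h0 : ∀ u, mulPath E (adTransport G u) (u - u) = 0 := fun u ↦ by rw [sub_self, map_zero]
  obtain ⟨hc, hd⟩ := contDiffAt_adFrame_zero (E := E) (G := G)
  refine ⟨contDiff_iff_contDiffAt.2 fun u ↦ ?_, fun u c t ↦ ?_⟩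
  · rw [h u]
    refine (T u).contDiff.contDiffAt.comp u (ContDiffAt.comp u (g := adFrame G) (by rwa [h0]) ?_)
    exact ((mulPath E (adTransport G u)).contDiff.comp
      (contDiff_id.sub contDiff_const)).contDiffAt
  · have h1 : HasFDerivAt (adFrame (E := E) G) (fderiv ℝ (adFrame (E := E) G) 0)
        (mulPath E (adTransport G u) (u - u)) := by
      rw [h0]
      exact (hc.differentiableAt (by simp)).hasFDerivAt
    have h2 : HasFDerivAt (adFrame (E := E) G) (T u ∘L (fderiv ℝ (adFrame (E := E) G) 0 ∘L
        mulPath E (adTransport G u))) u := by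
      have := (T u).hasFDerivAt.comp u (h1.comp u (hl u))
      exact this.congr_of_eventuallyEq (Eventually.of_forall fun v ↦ congrFun (h u) v)
    rw [h2.fderiv]
    have h3 := hd (mulPath E (adTransport G u) (mulPath E (adFrame G u) c)) t
    rw [← mulPath_mul, adTransport_mul_adFrame, primitive_mulPath_const, primitive_mulPath_const,
      ← map_sub] at h3
    change Ad E (transport G u t)⁻¹ ∘L (fderiv ℝ (adFrame (E := E) G) 0
      (mulPath E (adTransport G u) (mulPath E (adFrame G u) c)) t ∘L
        Ad E (parallelTransport u)) = _
    -- With b = Φ(u), the relation ad(Ad(b) X) Ad(b) = Ad(b) ad(X) collects all group factors on the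
    -- left, where they form F_u.
    rw [← mulPath_mul, adTransport_mul_adFrame, h3, adDeriv_Ad_comp, adFrame_apply, Ad_mul]
    rfl

end AdFrame

/-! ### Well-definedness of the horizontal distribution. -/

section HorizontalDistribution

universe u v

variable {E : Type u} [NormedAddCommGroup E] [NormedSpace ℝ E] [FiniteDimensional ℝ E]
  {G : Type v} [TopologicalSpace G] [ChartedSpace E G] [Group G] [LieGroup 𝓘(ℝ, E) ∞ G]

variable (G) in
/-- The map `ξ ↦ Ad(g_u⁻¹ Φ(u)) ξ`, which identifies `𝔭` with the horizontal space at `u`. -/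
def horizontalMap (u : PathAlgebra E) : E →L[ℝ] PathAlgebra E :=
  mulPath E (adFrame G u) ∘L constPath E

theorem coeFn_horizontalMap (u : PathAlgebra E) (ξ : E) :
    ∀ᵐ t ∂(volume.restrict (Icc (0 : ℝ) 1)), horizontalMap G u ξ t =
      Ad E ((transport G u t)⁻¹ * parallelTransport u) ξ := by
  filter_upwards [coeFn_mulPath (adFrame G u) (constPath E ξ), coeFn_constPath ξ,
    ae_restrict_mem measurableSet_Icc] with t h₁ h₂ h₃
  refine h₁.trans ?_
  rw [h₂, pathExtend_of_mem _ h₃, adFrame_apply]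

theorem horizontalMap_injective (u : PathAlgebra E) : Function.Injective (horizontalMap G u) := by
  intro ξ ζ h
  have h' : constPath E ξ = constPath E ζ := by
    have := congrArg (mulPath E (adFrameInv G u)) h
    change mulPath E (adFrameInv G u) (mulPath E (adFrame G u) _) =
      mulPath E (adFrameInv G u) (mulPath E (adFrame G u) _) at this
    rwa [mulPath_adFrameInv_adFrame, mulPath_adFrameInv_adFrame] at this
  have := FiniteDimensional.complete ℝ E
  have h1 := congrArg (fun c ↦ primitive E c ⟨1, by simp⟩) h'
  simpa [primitive_constPath] using h1

/-- g * 0̂ is minus the right logarithmic derivative of g, which is the left logarithmic derivative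
of g⁻¹. -/
theorem IsH1Path.coeFn_gaugeAction_zero {g : ℝ → G} (hg : IsH1Path (E := E) g) :
    ∀ᵐ t ∂(volume.restrict (Icc (0 : ℝ) 1)), HasLeftVelocity (fun t ↦ (g t)⁻¹) t
      (gaugeAction g (0 : PathAlgebra E) t) := by
  let f : ℝ → E := fun t ↦
    (adjointRep (g t) ((0 : PathAlgebra E).toPath t) - rightLogDeriv g t :
      GroupLieAlgebra 𝓘(ℝ, E) G)
  have h1 : ∀ᵐ t ∂(volume.restrict (Icc (0 : ℝ) 1)), f t = -Ad E (g t) (show E from leftLogDeriv g t) := by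
    filter_upwards [hg.acPath.ae_hasLeftVelocity,
      Lp.coeFn_zero E 2 (volume.restrict (Icc (0 : ℝ) 1))] with t h₁ h₂
    have h3 : (0 : PathAlgebra E).toPath t = (0 : GroupLieAlgebra 𝓘(ℝ, E) G) := h₂
    simp only [f]
    rw [h3, map_zero, zero_sub, h₁.rightLogDeriv_eq]
    rfl
  -- This excludes the default value 0 in `gaugeAction`.
  have h2 : MemLp f 2 (volume.restrict (Icc (0 : ℝ) 1)) := by
    refine (memLp_congr_ae h1).2 ?_
    exact (memLp_clm_apply_of_continuousOn (contMDiff_Ad.continuous.comp_continuousOn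
      hg.acPath.continuousOn) hg.memLp_leftLogDeriv).neg
  have h3 : gaugeAction g (0 : PathAlgebra E) = h2.toLp := dif_pos h2
  rw [h3]
  filter_upwards [h1, h2.coeFn_toLp, hg.acPath.ae_hasLeftVelocity] with t h₁ h₂ h₃
  rw [h₂, h₁]
  exact h₃.inv

/-- The path g(0) g⁻¹ starts at 1 and has left velocity g * 0̂; transports are unique. -/
theorem IsH1Path.transport_gaugeAction_zero {g : ℝ → G} (hg : IsH1Path (E := E) g) {t : ℝ}
    (ht : t ∈ Icc (0 : ℝ) 1) :
    transport G (gaugeAction g (0 : PathAlgebra E)) t = g 0 * (g t)⁻¹ := by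
  refine (Transports.eq_transport (g := fun t ↦ g 0 * (g t)⁻¹) ⟨(ACPath.const _).mul hg.acPath.inv,
    mul_inv_cancel _, ?_⟩ t ht).symm
  filter_upwards [hg.coeFn_gaugeAction_zero] with t h using h.const_mul _

/-- The witness is g = g_u⁻¹ Φ(u), which ends at 1 ∈ K. It shows that the distribution is given at
every point. -/
theorem exists_gaugeAction_eq (K : Subgroup G) (u : PathAlgebra E) :
    ∃ g ∈ pathSpace E (univ ×ˢ (K : Set G)), gaugeAction g 0 = u := by
  have hu := transports_transport (G := G) u
  set a : G := transport G u 1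
  have hac : ACPath E (fun t ↦ (transport G u t)⁻¹ * a) := hu.acPath.inv.mul (ACPath.const a)
  -- The left velocity of g_u⁻¹ a, written as an element of L² in order to verify that the path is
  -- `H¹`.
  set w : PathAlgebra E := mulPath E (constC _ (Ad E a⁻¹)) (-mulPath E (adTransport G u) u)
  have hw : ∀ᵐ t ∂(volume.restrict (Icc (0 : ℝ) 1)), w t = Ad E a⁻¹ (-Ad E (transport G u t) (u t)) := by
    filter_upwards [coeFn_mulPath (constC _ (Ad E a⁻¹)) (-mulPath E (adTransport G u) u),
      Lp.coeFn_neg (mulPath E (adTransport G u) u), coeFn_mulPath_adPath hu.acPath.continuousOn u]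
      with t h₁ h₂ h₃
    rw [h₁, h₂, Pi.neg_apply]
    exact congrArg (fun x ↦ Ad E a⁻¹ (-x)) h₃
  have hg : IsH1Path (E := E) (fun t ↦ (transport G u t)⁻¹ * a) := by
    refine hac.isH1Path (u := w) ?_
    filter_upwards [hu.velocity, hw] with t h₁ h₂
    rw [h₂]
    exact h₁.inv.mul_const a
  refine ⟨_, ⟨hg, mem_univ _, ?_⟩, ?_⟩
  · simp only [a, inv_mul_cancel]
    exact K.one_mem
  · refine Lp.ext ?_
    filter_upwards [hg.coeFn_gaugeAction_zero, hu.velocity] with t h₁ h₂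
    refine h₁.unique ?_
    simpa using h₂.const_mul a⁻¹

/-- For u = g * 0̂ one has g_u(t)⁻¹ Φ(u) = g(t) g(1)⁻¹. The elements X and ξ describing the same
path are related by ξ = Ad(g(1)) X, and Ad(g(1)) preserves 𝔭. -/
theorem adConstPaths_eq {K : Subgroup G} {𝔭 : Submodule ℝ (GroupLieAlgebra 𝓘(ℝ, E) G)}
    (h𝔭 : ∀ k ∈ K, ∀ X ∈ 𝔭, adjointRep k X ∈ 𝔭) {g : ℝ → G}
    (hg : g ∈ pathSpace E (univ ×ˢ (K : Set G))) (w : PathAlgebra E) :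
    w ∈ adConstPaths g 𝔭 ↔
      ∃ ξ : E, ξ ∈ 𝔭 ∧ horizontalMap G (gaugeAction g (0 : PathAlgebra E)) ξ = w := by
  have hK : g 1 ∈ K := hg.2.2
  have h1 : ∀ ξ : E, ∀ᵐ t ∂(volume.restrict (Icc (0 : ℝ) 1)),
      horizontalMap G (gaugeAction g (0 : PathAlgebra E)) ξ t = Ad E (g t) (Ad E (g 1)⁻¹ ξ) := by
    intro ξ
    filter_upwards [coeFn_horizontalMap (G := G) (gaugeAction g (0 : PathAlgebra E)) ξ,
      ae_restrict_mem measurableSet_Icc] with t h₁ h₂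
    rw [h₁, parallelTransport_eq, hg.1.transport_gaugeAction_zero h₂,
      hg.1.transport_gaugeAction_zero (by simp), ← Ad_mul_apply]
    congr 2
    group
  constructor
  · rintro ⟨X', hX, hw⟩
    obtain ⟨X, rfl⟩ : ∃ X : E, X = X' := ⟨X', rfl⟩
    refine ⟨Ad E (g 1) X, h𝔭 _ hK X hX, Lp.ext ?_⟩
    filter_upwards [h1 (Ad E (g 1) X), hw] with t h₁ h₂
    exact (h₁.trans (congrArg _ (Ad_inv_apply_Ad _ _))).trans h₂.symm
  · rintro ⟨ξ, hξ, rfl⟩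
    refine ⟨Ad E (g 1)⁻¹ ξ, h𝔭 _ (K.inv_mem hK) ξ hξ, ?_⟩
    filter_upwards [h1 ξ] with t h₁
    exact h₁

/-- By `adConstPaths_eq` each space in the supremum depends only on the point g * 0̂, so all of them
coincide. -/
theorem horizontalDistribution_gaugeAction {K : Subgroup G}
    {𝔭 : Submodule ℝ (GroupLieAlgebra 𝓘(ℝ, E) G)}
    (h𝔭 : ∀ k ∈ K, ∀ X ∈ 𝔭, adjointRep k X ∈ 𝔭) {g : ℝ → G}
    (hg : g ∈ pathSpace E (univ ×ˢ (K : Set G))) :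
    horizontalDistribution K 𝔭 (gaugeAction g (0 : PathAlgebra E)) = adConstPaths g 𝔭 := by
  refine le_antisymm (iSup₂_le fun g' hg' ↦ ?_)
    (le_iSup₂_of_le g ⟨hg, rfl⟩ le_rfl)
  intro w hw
  obtain ⟨ξ, hξ, h⟩ := (adConstPaths_eq h𝔭 hg'.1 w).1 hw
  rw [hg'.2] at h
  exact (adConstPaths_eq h𝔭 hg w).2 ⟨ξ, hξ, h⟩

theorem mem_horizontalDistribution {K : Subgroup G}
    {𝔭 : Submodule ℝ (GroupLieAlgebra 𝓘(ℝ, E) G)}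
    (h𝔭 : ∀ k ∈ K, ∀ X ∈ 𝔭, adjointRep k X ∈ 𝔭) (u w : PathAlgebra E) :
    w ∈ horizontalDistribution K 𝔭 u ↔ ∃ ξ : E, ξ ∈ 𝔭 ∧ horizontalMap G u ξ = w := by
  obtain ⟨g, hg, rfl⟩ := exists_gaugeAction_eq (G := G) K u
  rw [horizontalDistribution_gaugeAction h𝔭 hg]
  exact adConstPaths_eq h𝔭 hg w

end HorizontalDistribution

/-! ### The Lie bracket as the derivative of the adjoint representation. -/

section Bracket

variable {E : Type*} [NormedAddCommGroup E] [NormedSpace ℝ E]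
  {G : Type*} [TopologicalSpace G] [ChartedSpace E G] [Group G] [LieGroup 𝓘(ℝ, E) ∞ G]

theorem mpullbackWithin_mulInvariantVectorField (X : E) {w : E}
    (hw : w ∈ (extChartAt 𝓘(ℝ, E) (1 : G)).target) :
    VectorField.mpullbackWithin 𝓘(ℝ, E) 𝓘(ℝ, E) (extChartAt 𝓘(ℝ, E) (1 : G)).symm
      (mulInvariantVectorField (X : GroupLieAlgebra 𝓘(ℝ, E) G)) (range 𝓘(ℝ, E)) w =
      chartFrame E (1 : G) ((extChartAt 𝓘(ℝ, E) (1 : G)).symm w) X := by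
  set φ := extChartAt 𝓘(ℝ, E) (1 : G)
  have hs : φ.symm w ∈ (chartAt E (1 : G)).source := by simpa [φ] using φ.map_target hw
  have hφ := (contMDiffAt_extChartAt_of_mem (E := E) hs).hasModelDerivAt
  have hψ : HasModelDerivAt φ.symm (modelDeriv E E φ.symm w) w :=
    ((contMDiffOn_extChartAt_symm (1 : G)).contMDiffAt
      ((isOpen_extChartAt_target (1 : G)).mem_nhds hw)).hasModelDerivAt (E₁ := E)
  have h1 : modelDeriv E E φ (φ.symm w) ∘L modelDeriv E E φ.symm w = ContinuousLinearMap.id ℝ E :=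
    (hφ.comp hψ rfl).unique ((hasModelDerivAt_id w).congr_of_eventuallyEq (by
      filter_upwards [(isOpen_extChartAt_target (I := 𝓘(ℝ, E)) (1 : G)).mem_nhds hw] with y hy using φ.right_inv hy))
  have h2 : modelDeriv E E φ.symm w ∘L modelDeriv E E φ (φ.symm w) = ContinuousLinearMap.id ℝ E :=
    (hψ.comp hφ (φ.right_inv hw)).unique ((hasModelDerivAt_id _).congr_of_eventuallyEq (by
      filter_upwards [(chartAt E (1 : G)).open_source.mem_nhds hs] with y hy
      exact φ.left_inv (by simpa [φ] using hy)))
  have h3 : (modelDeriv E E φ.symm w).inverse = modelDeriv E E φ (φ.symm w) :=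
    ContinuousLinearMap.inverse_eq h2 h1
  have h4 : mfderivWithin 𝓘(ℝ, E) 𝓘(ℝ, E) φ.symm (range 𝓘(ℝ, E)) w = modelDeriv E E φ.symm w := by
    simp [modelDeriv]
  have h5 : chartFrame E (1 : G) (φ.symm w) = modelDeriv E E φ (φ.symm w) ∘L dleft E (φ.symm w) :=
    hφ.leftDeriv_eq
  rw [h5]
  change (mfderivWithin 𝓘(ℝ, E) 𝓘(ℝ, E) φ.symm (range 𝓘(ℝ, E)) w).inverse
    (dleft E (φ.symm w) X) = _
  exact congrArg (fun A : E →L[ℝ] E ↦ A (dleft E (φ.symm w) X))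
    ((congrArg ContinuousLinearMap.inverse h4).trans h3)

/-- In the chart the left-invariant field of X is w ↦ Λ(w) X with Λ(z) = id, and the bracket of
vector fields on a vector space is DV_Y(V_X) - DV_X(V_Y). -/
theorem bracket_eq_fderiv_chartFrame {Λ' : E →L[ℝ] E →L[ℝ] E}
    (hΛ : HasFDerivAt (fun w ↦ chartFrame E (1 : G) ((extChartAt 𝓘(ℝ, E) (1 : G)).symm w)) Λ'
      (extChartAt 𝓘(ℝ, E) (1 : G) 1)) (X Y : E) :
    Bracket.bracket (L := GroupLieAlgebra 𝓘(ℝ, E) G) (M := GroupLieAlgebra 𝓘(ℝ, E) G) X Y = (Λ' X Y - Λ' Y X : E) := by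
  set φ := extChartAt 𝓘(ℝ, E) (1 : G)
  let V : E → E → E := fun X w ↦ VectorField.mpullbackWithin 𝓘(ℝ, E) 𝓘(ℝ, E) φ.symm
      (mulInvariantVectorField (X : GroupLieAlgebra 𝓘(ℝ, E) G)) (range 𝓘(ℝ, E)) w
  have hV : ∀ X, V X =ᶠ[𝓝 (φ 1)] fun w ↦ chartFrame E (1 : G) (φ.symm w) X := fun X ↦ by
    filter_upwards [extChartAt_target_mem_nhds (I := 𝓘(ℝ, E)) (1 : G)] with w hw
    exact mpullbackWithin_mulInvariantVectorField X hw
  have hd : ∀ X, HasFDerivAt (V X) (Λ'.flip X) (φ 1) := fun X ↦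
    HasFDerivAt.congr_of_eventuallyEq (by
      have := hΛ.clm_apply (hasFDerivAt_const X (φ 1))
      convert! this using 1
      ext; simp) (hV X)
  have h1 : ∀ X, V X (φ 1) = X := fun X ↦ by
    have h : V X (φ 1) = chartFrame E (1 : G) (φ.symm (φ 1)) X := (hV X).self_of_nhds
    rw [h, extChartAt_to_inv, chartFrame_one]
    rfl
  have h2 : VectorField.lieBracketWithin ℝ (V X) (V Y) (φ.symm ⁻¹' univ ∩ range 𝓘(ℝ, E)) (φ 1) =
      Λ' X Y - Λ' Y X := by
    have : φ.symm ⁻¹' univ ∩ range 𝓘(ℝ, E) = univ := by simp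
    rw [this, VectorField.lieBracketWithin_univ, VectorField.lieBracket, (hd X).fderiv,
      (hd Y).fderiv, h1, h1]
    rfl
  have h3 : modelDeriv E E φ (1 : G) = ContinuousLinearMap.id ℝ E :=
    (hasModelDerivAt_extChartAt_self (E₁ := E) (1 : G)).modelDeriv_eq
  change (modelDeriv E E φ (1 : G)).inverse (VectorField.lieBracketWithin ℝ (V X) (V Y)
    (φ.symm ⁻¹' univ ∩ range 𝓘(ℝ, E)) (φ 1)) = _
  rw [h2, h3, ContinuousLinearMap.inverse_id]
  rfl

/-- The Lie bracket is the derivative of the adjoint representation. -/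
theorem bracket_eq_adDeriv (X Y : E) :
    Bracket.bracket (L := GroupLieAlgebra 𝓘(ℝ, E) G) (M := GroupLieAlgebra 𝓘(ℝ, E) G) X Y = adDeriv E G X Y := by
  set φ := extChartAt 𝓘(ℝ, E) (1 : G)
  set z := φ 1 with hz
  have hz1 : φ.symm z = 1 := extChartAt_to_inv (I := 𝓘(ℝ, E)) (1 : G)
  have hs0 : HasModelDerivAt φ.symm (ContinuousLinearMap.id ℝ E) z :=
    hasModelDerivAt_extChartAt_symm_self
  -- The multiplication in the chart. Its two partial derivatives describe left and right
  -- translations, and the symmetry of its second derivative links them.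
  let m : E × E → E := fun p ↦ φ (φ.symm p.1 * φ.symm p.2)
  have hsm : ContMDiffAt 𝓘(ℝ, E) 𝓘(ℝ, E) ∞ φ.symm z :=
    contMDiffAt_extChartAt_symm_of_mem (E := E) (mem_chart_source E (1 : G))
  have hm : ContDiffAt ℝ ∞ m (z, z) := by
    have h1 : ContMDiffAt 𝓘(ℝ, E × E) 𝓘(ℝ, E) ∞ (fun p : E × E ↦ φ.symm p.1 * φ.symm p.2) (z, z) :=
      ContMDiffAt.mul (ContMDiffAt.comp (z, z) (g := φ.symm) hsm contDiff_fst.contMDiff.contMDiffAt)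
        (ContMDiffAt.comp (z, z) (g := φ.symm) hsm contDiff_snd.contMDiff.contMDiffAt)
    refine contMDiffAt_iff_contDiffAt.1 (ContMDiffAt.comp (I' := 𝓘(ℝ, E)) (z, z) (g := φ) ?_ h1)
    exact contMDiffAt_extChartAt_of_mem (by rw [hz1, mul_one]; exact mem_chart_source E (1 : G))
  have hm1 : ∀ᶠ p in 𝓝 (z, z), DifferentiableAt ℝ m p := by
    filter_upwards [(hm.of_le (n := ∞) (m := 1) (by simp)).eventually (by simp)] with p hp
    exact hp.differentiableAt (by simp)
  have h2 : (2 : WithTop ℕ∞) ≤ ((⊤ : ℕ∞) : WithTop ℕ∞) := WithTop.coe_le_coe.2 le_top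
  have hm2 : HasFDerivAt (fderiv ℝ m) (fderiv ℝ (fderiv ℝ m) (z, z)) (z, z) :=
    ((hm.fderiv_right (m := 1) (by rw [one_add_one_eq_two]; exact h2)).differentiableAt (by simp)).hasFDerivAt
  have hsymm := hm.isSymmSndFDerivAt (by simp only [minSmoothness_of_isRCLikeNormedField]; exact h2)
  set D := fderiv ℝ (fderiv ℝ m) (z, z)
  have htar : ∀ᶠ w in 𝓝 z, φ.symm w ∈ (chartAt E (1 : G)).source := by
    filter_upwards [extChartAt_target_mem_nhds (I := 𝓘(ℝ, E)) (1 : G)] with w hw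
    simpa [φ] using φ.map_target hw
  have hleft : ∀ᶠ w in 𝓝 z, DifferentiableAt ℝ m (w, z) :=
    (Continuous.prodMk_left z).continuousAt (x := z) |>.eventually hm1
  have hright : ∀ᶠ w in 𝓝 z, DifferentiableAt ℝ m (z, w) :=
    (Continuous.prodMk_right z).continuousAt (x := z) |>.eventually hm1
  have hΛ : (fun w ↦ chartFrame E (1 : G) (φ.symm w)) =ᶠ[𝓝 z]
      fun w ↦ fderiv ℝ m (w, z) ∘L .inr ℝ E E := by
    filter_upwards [htar, hleft] with w h1 h2
    have h3 : HasFDerivAt (fun y ↦ m (w, y)) (fderiv ℝ m (w, z) ∘L .inr ℝ E E) z :=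
      HasFDerivAt.comp (f := fun y ↦ (w, y)) z h2.hasFDerivAt (hasFDerivAt_prodMk_right w z)
    have h4 := (contMDiffAt_extChartAt_of_mem (E := E) h1).hasModelDerivAt.comp_dleft.comp hs0 hz1
    rw [ContinuousLinearMap.comp_id] at h4
    have h5 := (hasModelDerivAt_iff_hasFDerivAt.1 h4).unique h3
    rw [← h5]
    exact (contMDiffAt_extChartAt_of_mem (E := E) h1).hasModelDerivAt.leftDeriv_eq
  -- A second expression of the same frame, from dl_a = dr_a Ad(a).
  have hR : (fun w ↦ chartFrame E (1 : G) (φ.symm w)) =ᶠ[𝓝 z]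
      fun w ↦ (fderiv ℝ m (z, w) ∘L .inl ℝ E E) ∘L Ad E (φ.symm w) := by
    filter_upwards [htar, hright] with w h1 h2
    have h3 : HasFDerivAt (fun y ↦ m (y, w)) (fderiv ℝ m (z, w) ∘L .inl ℝ E E) z :=
      HasFDerivAt.comp (f := fun y ↦ (y, w)) z h2.hasFDerivAt (hasFDerivAt_prodMk_left z w)
    have h0 := (contMDiffAt_extChartAt_of_mem (E := E) h1).hasModelDerivAt
    have h4 := (h0.comp (hasModelDerivAt_dright (φ.symm w)) (one_mul _)).comp hs0 hz1
    rw [ContinuousLinearMap.comp_id] at h4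
    have h5 := (hasModelDerivAt_iff_hasFDerivAt.1 h4).unique h3
    rw [← h5, ContinuousLinearMap.comp_assoc, dright_comp_Ad]
    exact h0.leftDeriv_eq
  let cl : (E × E →L[ℝ] E) →L[ℝ] E →L[ℝ] E :=
    (ContinuousLinearMap.compL ℝ E (E × E) E).flip (.inr ℝ E E)
  let cr : (E × E →L[ℝ] E) →L[ℝ] E →L[ℝ] E :=
    (ContinuousLinearMap.compL ℝ E (E × E) E).flip (.inl ℝ E E)
  have hdΛ : HasFDerivAt (fun w ↦ chartFrame E (1 : G) (φ.symm w))
      (cl ∘L (D ∘L .inl ℝ E E)) z :=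
    HasFDerivAt.congr_of_eventuallyEq (cl.hasFDerivAt.comp z
      (HasFDerivAt.comp (f := fun y ↦ (y, z)) z hm2 (hasFDerivAt_prodMk_left z z))) hΛ
  have hdR : HasFDerivAt (fun w ↦ fderiv ℝ m (z, w) ∘L .inl ℝ E E)
      (cr ∘L (D ∘L .inr ℝ E E)) z :=
    cr.hasFDerivAt.comp z
      (HasFDerivAt.comp (f := fun y ↦ (z, y)) z hm2 (hasFDerivAt_prodMk_right z z))
  have hAd : HasFDerivAt (fun w ↦ Ad E (φ.symm w)) (adDeriv E G) z := by
    have := (hasModelDerivAt_Ad_one (E := E) (G := G)).comp hs0 hz1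
    rw [ContinuousLinearMap.comp_id] at this
    exact hasModelDerivAt_iff_hasFDerivAt.1 this
  have hR1 : fderiv ℝ m (z, z) ∘L .inl ℝ E E = ContinuousLinearMap.id ℝ E := by
    have := hR.self_of_nhds
    simp only [hz1, Ad_one, chartFrame_one] at this
    exact this.symm
  have hdR' := ((hdR.clm_comp hAd).congr_of_eventuallyEq hR).unique hdΛ
  -- The two expressions of the frame have the same derivative at z; the extra term comes from
  -- differentiating Ad.
  have h6 : D (0, X) (Y, 0) + adDeriv E G X Y = D (X, 0) (0, Y) := by
    have h7 := congrArg (fun A : E →L[ℝ] E →L[ℝ] E ↦ A X Y) hdR'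
    have h8 : fderiv ℝ m (z, z) (adDeriv E G X Y, 0) = adDeriv E G X Y :=
      DFunLike.congr_fun hR1 (adDeriv E G X Y)
    simpa [cl, cr, hz1, Ad_one, h8, add_comm] using h7
  rw [bracket_eq_fderiv_chartFrame hdΛ, ← sub_eq_iff_eq_add'.2 h6.symm]
  -- Symmetry turns D(Y,0)(0,X) into D(0,X)(Y,0), and the mixed terms leave exactly ad(X) Y.
  exact congrArg (fun x ↦ D (X, 0) (0, Y) - x) (hsymm (Y, 0) (0, X))

end Bracket

/-! ### Local inverses and local sections on manifolds. -/

section InverseFunction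

variable {E₁ : Type*} [NormedAddCommGroup E₁] [NormedSpace ℝ E₁]
  {M₁ : Type*} [TopologicalSpace M₁] [ChartedSpace E₁ M₁]
  {E₂ : Type*} [NormedAddCommGroup E₂] [NormedSpace ℝ E₂]
  {M₂ : Type*} [TopologicalSpace M₂] [ChartedSpace E₂ M₂]

theorem eq_of_forall_hasModelDerivAt_zero [IsManifold 𝓘(ℝ, E₁) ∞ M₁] {c : ℝ → M₁}
    (hc : ∀ t, HasModelDerivAt c (0 : ℝ →L[ℝ] E₁) t) (s t : ℝ) : c s = c t := by
  have hcont : Continuous c := continuous_iff_continuousAt.2 fun t ↦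
    (hc t).mdifferentiableAt.continuousAt
  refine IsLocallyConstant.apply_eq_of_isPreconnected
    ((IsLocallyConstant.iff_eventually_eq c).2 fun t₀ ↦ ?_) isPreconnected_univ
    (mem_univ s) (mem_univ t)
  set φ := extChartAt 𝓘(ℝ, E₁) (c t₀)
  have hnhds : c ⁻¹' (chartAt E₁ (c t₀)).source ∈ 𝓝 t₀ :=
    hcont.continuousAt ((chartAt E₁ (c t₀)).open_source.mem_nhds (mem_chart_source _ _))
  obtain ⟨ε, hε, hball⟩ := Metric.mem_nhds_iff.1 hnhds
  have hd : ∀ t ∈ Metric.ball t₀ ε, HasFDerivAt (fun t ↦ φ (c t)) (0 : ℝ →L[ℝ] E₁) t := by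
    intro t ht
    have h1 : HasModelDerivAt φ (modelDeriv E₁ E₁ φ (c t)) (c t) :=
      (contMDiffAt_extChartAt' (hball ht) (n := ∞)).hasModelDerivAt
    have := hasModelDerivAt_iff_hasFDerivAt.1 (h1.comp (hc t) rfl)
    rwa [ContinuousLinearMap.comp_zero] at this
  have hconst : ∀ t ∈ Metric.ball t₀ ε, φ (c t) = φ (c t₀) := fun t ht ↦
    (convex_ball t₀ ε).is_const_of_fderivWithin_eq_zero (𝕜 := ℝ)
    (fun t ht ↦ (hd t ht).differentiableAt.differentiableWithinAt) (fun t ht ↦ by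
      rw [fderivWithin_of_isOpen Metric.isOpen_ball ht, (hd t ht).fderiv]) ht (Metric.mem_ball_self hε)
  filter_upwards [Metric.ball_mem_nhds t₀ hε] with t ht
  have e : φ (c t) = φ (c t₀) := hconst t ht
  rw [← φ.left_inv (by simpa [φ] using hball ht : c t ∈ φ.source), e,
    φ.left_inv (mem_extChartAt_source _)]

theorem hasModelDerivAt_extChartAt_symm [IsManifold 𝓘(ℝ, E₁) ∞ M₁] (x : M₁) :
    HasModelDerivAt (extChartAt 𝓘(ℝ, E₁) x).symm (ContinuousLinearMap.id ℝ E₁)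
      (extChartAt 𝓘(ℝ, E₁) x x) := by
  have h := ((contMDiffOn_extChartAt_symm (I := 𝓘(ℝ, E₁)) (n := ∞) x).contMDiffAt
    (extChartAt_target_mem_nhds x)).hasModelDerivAt
  have h' := (hasModelDerivAt_extChartAt_self (E₁ := E₁) x).comp h (extChartAt_to_inv x)
  have h'' := h'.unique ((hasModelDerivAt_id _).congr_of_eventuallyEq (by
    filter_upwards [extChartAt_target_mem_nhds (I := 𝓘(ℝ, E₁)) x] with w hw
    exact (extChartAt 𝓘(ℝ, E₁) x).right_inv hw))
  rw [ContinuousLinearMap.id_comp] at h''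
  rwa [h''] at h

theorem exists_local_inverse_of_hasFDerivAt [CompleteSpace E₁] {f : E₁ → E₂} {x : E₁}
    {f' : E₁ ≃L[ℝ] E₂} (hf : ∀ᶠ y in 𝓝 x, ContDiffAt ℝ ∞ f y)
    (hf' : HasFDerivAt f (f' : E₁ →L[ℝ] E₂) x) :
    ∃ s : E₂ → E₁, s (f x) = x ∧ (∀ᶠ y in 𝓝 (f x), ContDiffAt ℝ ∞ s y) ∧
      (∀ᶠ y in 𝓝 (f x), f (s y) = y) ∧ ∀ᶠ z in 𝓝 x, s (f z) = z := by
  have hs : HasStrictFDerivAt f (f' : E₁ →L[ℝ] E₂) x :=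
    hf.self_of_nhds.hasStrictFDerivAt' hf' (by simp)
  set P := hs.toOpenPartialHomeomorph f
  have hP : (P : E₁ → E₂) = f := hs.toOpenPartialHomeomorph_coe
  have hx : x ∈ P.source := hs.mem_toOpenPartialHomeomorph_source
  have hfx : f x ∈ P.target := hs.image_mem_toOpenPartialHomeomorph_target
  have hsx : P.symm (f x) = x := by rw [← hP]; exact P.left_inv hx
  refine ⟨P.symm, hsx, ?_, ?_, ?_⟩
  -- The derivative stays invertible near x, so the inverse is smooth on a whole neighbourhood and
  -- not merely at one point.
  · have hinv : ∀ᶠ y in 𝓝 x, fderiv ℝ f y ∈ range ((↑) : (E₁ ≃L[ℝ] E₂) → E₁ →L[ℝ] E₂) := by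
      have hc : ContinuousAt (fderiv ℝ f) x :=
        (hf.self_of_nhds.fderiv_right (m := 0) (by simp)).continuousAt
      refine hc.eventually ?_
      rw [hf'.fderiv]
      exact ContinuousLinearEquiv.nhds f'
    have hsc : Tendsto P.symm (𝓝 (f x)) (𝓝 x) := by
      have := P.symm.continuousAt (x := f x) hfx
      rwa [ContinuousAt, hsx] at this
    filter_upwards [P.open_target.mem_nhds hfx, hsc.eventually hinv, hsc.eventually hf]
      with y h₁ ⟨g', h₂⟩ h₃
    refine P.contDiffAt_symm h₁ (f₀' := g') ?_ (hP ▸ h₃)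
    rw [h₂, hP]
    exact (h₃.differentiableAt (by simp)).hasFDerivAt
  · filter_upwards [P.open_target.mem_nhds hfx] with y hy
    rw [← hP]; exact P.right_inv hy
  · filter_upwards [P.open_source.mem_nhds hx] with y hy
    rw [← hP]; exact P.left_inv hy

/-- The inverse function theorem on manifolds. -/
theorem exists_local_inverse [CompleteSpace E₁] [IsManifold 𝓘(ℝ, E₁) ∞ M₁]
    [IsManifold 𝓘(ℝ, E₂) ∞ M₂] {f : M₁ → M₂} {x : M₁}
    {f' : E₁ ≃L[ℝ] E₂} (hf : ∀ᶠ y in 𝓝 x, ContMDiffAt 𝓘(ℝ, E₁) 𝓘(ℝ, E₂) ∞ f y)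
    (hf' : HasModelDerivAt f (f' : E₁ →L[ℝ] E₂) x) :
    ∃ s : M₂ → M₁, s (f x) = x ∧ (∀ᶠ y in 𝓝 (f x), ContMDiffAt 𝓘(ℝ, E₂) 𝓘(ℝ, E₁) ∞ s y) ∧
      (∀ᶠ y in 𝓝 (f x), f (s y) = y) ∧ ∀ᶠ z in 𝓝 x, s (f z) = z := by
  set φ := extChartAt 𝓘(ℝ, E₁) x
  set ψ := extChartAt 𝓘(ℝ, E₂) (f x)
  have hφx : φ.symm (φ x) = x := extChartAt_to_inv x
  have hfc : ContinuousAt f x := hf'.mdifferentiableAt.continuousAt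
  have hφs : Tendsto φ.symm (𝓝 (φ x)) (𝓝 x) := by
    have := continuousAt_extChartAt_symm (I := 𝓘(ℝ, E₁)) x
    rwa [ContinuousAt, hφx] at this
  have hφc : Tendsto φ (𝓝 x) (𝓝 (φ x)) := continuousAt_extChartAt x
  have hψc : Tendsto ψ (𝓝 (f x)) (𝓝 (ψ (f x))) := continuousAt_extChartAt (f x)
  have hψsrc : ∀ᶠ y in 𝓝 (f x), y ∈ ψ.source := extChartAt_source_mem_nhds (f x)
  have hφsrc : ∀ᶠ y in 𝓝 x, y ∈ φ.source := extChartAt_source_mem_nhds x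
  have hφtar : ∀ᶠ y in 𝓝 (φ x), y ∈ φ.target := extChartAt_target_mem_nhds x
  have hg : ∀ᶠ z in 𝓝 (φ x), ContDiffAt ℝ ∞ (fun z ↦ ψ (f (φ.symm z))) z := by
    filter_upwards [hφs.eventually hf, hφs.eventually (hfc.eventually hψsrc), hφtar]
      with z h₁ h₂ h₃
    refine contMDiffAt_iff_contDiffAt.1 ((contMDiffAt_extChartAt'
      (by simpa [ψ] using h₂)).comp z (h₁.comp z ?_))
    exact (contMDiffOn_extChartAt_symm x).contMDiffAt
      ((isOpen_extChartAt_target (I := 𝓘(ℝ, E₁)) x).mem_nhds h₃)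
  have hg' : HasFDerivAt (fun z ↦ ψ (f (φ.symm z))) (f' : E₁ →L[ℝ] E₂) (φ x) := by
    have h := (hasModelDerivAt_extChartAt_self (E₁ := E₂) (f x)).comp
      (hf'.comp (hasModelDerivAt_extChartAt_symm x) hφx) (congrArg f hφx)
    rw [ContinuousLinearMap.comp_id, ContinuousLinearMap.id_comp] at h
    exact hasModelDerivAt_iff_hasFDerivAt.1 h
  obtain ⟨s, h₁, h₂, h₃, h₄⟩ := exists_local_inverse_of_hasFDerivAt hg hg'
  simp only [hφx] at h₁ h₂ h₃
  have hsc : Tendsto s (𝓝 (ψ (f x))) (𝓝 (φ x)) := by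
    have := h₂.self_of_nhds.continuousAt
    rwa [ContinuousAt, h₁] at this
  refine ⟨fun y ↦ φ.symm (s (ψ y)), by simp only [h₁, hφx], ?_, ?_, ?_⟩
  · filter_upwards [hψc.eventually h₂, hψsrc, (hsc.comp hψc).eventually hφtar] with y h₅ h₆ h₇
    refine ContMDiffAt.comp y (g := φ.symm) (I' := 𝓘(ℝ, E₁)) ((contMDiffOn_extChartAt_symm x).contMDiffAt
      ((isOpen_extChartAt_target (I := 𝓘(ℝ, E₁)) x).mem_nhds h₇)) ?_
    exact ContMDiffAt.comp y (g := s) (I' := 𝓘(ℝ, E₂)) h₅.contMDiffAt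
      (contMDiffAt_extChartAt' (by simpa [ψ] using h₆))
  · filter_upwards [hψc.eventually h₃, hψsrc,
      (hφs.comp (hsc.comp hψc)).eventually (hfc.eventually hψsrc)] with y h₅ h₆ h₇
    exact ψ.injOn h₇ h₆ h₅
  · filter_upwards [hφc.eventually h₄, hφsrc] with z h₅ h₆
    rw [φ.left_inv h₆] at h₅
    rw [h₅, φ.left_inv h₆]

/-- A submersion has smooth local sections. -/
theorem exists_local_section [FiniteDimensional ℝ E₂] [IsManifold 𝓘(ℝ, E₁) ∞ M₁]
    [IsManifold 𝓘(ℝ, E₂) ∞ M₂] {f : M₁ → M₂} {x : M₁}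
    (hf : ∀ᶠ y in 𝓝 x, ContMDiffAt 𝓘(ℝ, E₁) 𝓘(ℝ, E₂) ∞ f y)
    (hf' : Function.Surjective (modelDeriv E₁ E₂ f x)) :
    ∃ s : M₂ → M₁, s (f x) = x ∧ (∀ᶠ y in 𝓝 (f x), ContMDiffAt 𝓘(ℝ, E₂) 𝓘(ℝ, E₁) ∞ s y) ∧
      ∀ᶠ y in 𝓝 (f x), f (s y) = y := by
  have := FiniteDimensional.complete ℝ E₂
  obtain ⟨R, hR⟩ := (modelDeriv E₁ E₂ f x).toLinearMap.exists_rightInverse_of_surjective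
    (LinearMap.range_eq_top.2 hf')
  set φ := extChartAt 𝓘(ℝ, E₁) x
  have hφx : φ.symm (φ x) = x := extChartAt_to_inv x
  -- An affine slice through x in the chart, along a linear right inverse of df. Restricted to it, f
  -- has the identity as derivative and can be inverted.
  let j₀ : E₂ → E₁ := fun v ↦ φ x + R.toContinuousLinearMap v
  have hj₀ : ContDiff ℝ ∞ j₀ := contDiff_const.add R.toContinuousLinearMap.contDiff
  have hj0 : j₀ 0 = φ x := by simp [j₀]
  have hj₀c : Tendsto j₀ (𝓝 0) (𝓝 (φ x)) := by
    have := hj₀.continuous.tendsto 0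
    rwa [hj0] at this
  have hφs : Tendsto φ.symm (𝓝 (φ x)) (𝓝 x) := by
    have := continuousAt_extChartAt_symm (I := 𝓘(ℝ, E₁)) x
    rwa [ContinuousAt, hφx] at this
  have hj : ∀ᶠ v in 𝓝 (0 : E₂), ContMDiffAt 𝓘(ℝ, E₂) 𝓘(ℝ, E₁) ∞ (fun v ↦ φ.symm (j₀ v)) v := by
    filter_upwards [hj₀c.eventually (extChartAt_target_mem_nhds x)] with v hv
    exact ContMDiffAt.comp v (g := φ.symm) (I' := 𝓘(ℝ, E₁)) ((contMDiffOn_extChartAt_symm x).contMDiffAt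
      ((isOpen_extChartAt_target (I := 𝓘(ℝ, E₁)) x).mem_nhds hv)) hj₀.contMDiff.contMDiffAt
  have hjx : φ.symm (j₀ 0) = x := by rw [hj0, hφx]
  have hg : ∀ᶠ v in 𝓝 (0 : E₂), ContMDiffAt 𝓘(ℝ, E₂) 𝓘(ℝ, E₂) ∞ (fun v ↦ f (φ.symm (j₀ v))) v := by
    filter_upwards [hj, (hφs.comp hj₀c).eventually hf] with v h₁ h₂
    exact ContMDiffAt.comp v (g := f) (I' := 𝓘(ℝ, E₁)) h₂ h₁
  have hg' : HasModelDerivAt (fun v ↦ f (φ.symm (j₀ v)))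
      (ContinuousLinearEquiv.refl ℝ E₂ : E₂ →L[ℝ] E₂) 0 := by
    have h1 : HasModelDerivAt j₀ R.toContinuousLinearMap 0 :=
      hasModelDerivAt_iff_hasFDerivAt.2 (R.toContinuousLinearMap.hasFDerivAt.const_add (φ x))
    have h2 := hf.self_of_nhds.hasModelDerivAt.comp
      ((hasModelDerivAt_extChartAt_symm x).comp h1 hj0) hjx
    convert! h2 using 1
    ext v
    exact (DFunLike.congr_fun hR v).symm
  obtain ⟨s, h₁, h₂, h₃, -⟩ := exists_local_inverse hg hg'
  simp only [hjx] at h₁ h₂ h₃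
  have hsc : Tendsto s (𝓝 (f x)) (𝓝 0) := by
    have := h₂.self_of_nhds.continuousAt
    rwa [ContinuousAt, h₁] at this
  refine ⟨fun y ↦ φ.symm (j₀ (s y)), by simp only [h₁, hjx], ?_, h₃⟩
  filter_upwards [h₂, hsc.eventually hj] with y h₄ h₅
  exact ContMDiffAt.comp y (g := fun v ↦ φ.symm (j₀ v)) (I' := 𝓘(ℝ, E₂)) h₅ h₄

end InverseFunction

/-! ### One-parameter subgroups and the exponential map. -/

section OneParameterSubgroups

universe u v

variable {E : Type u} [NormedAddCommGroup E] [NormedSpace ℝ E]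
  {G : Type v} [TopologicalSpace G] [ChartedSpace E G] [Group G] [LieGroup 𝓘(ℝ, E) ∞ G]

theorem hasModelDerivAt_Ad_apply (a : G) (X : E) :
    HasModelDerivAt (fun b : G ↦ Ad E (a * b) X)
      (Ad E a ∘L (adDeriv E G).flip X) 1 := by
  have h1 : HasModelDerivAt (fun A : E →L[ℝ] E ↦ Ad E a (A X))
      (Ad E a ∘L ContinuousLinearMap.apply ℝ E X) (Ad E (1 : G)) :=
    hasModelDerivAt_iff_hasFDerivAt.2
      (Ad E a ∘L ContinuousLinearMap.apply ℝ E X).hasFDerivAt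
  have h2 := h1.comp (hasModelDerivAt_Ad_one (E := E) (G := G)) rfl
  simp only [← Ad_mul_apply] at h2
  exact h2

theorem leftDeriv_Ad_apply (a : G) (X Y : E) :
    leftDeriv E E (fun b : G ↦ Ad E b X) a Y = Ad E a (adDeriv E G Y X) :=
  DFunLike.congr_fun (hasModelDerivAt_Ad_apply a X).modelDeriv_eq Y

theorem adDeriv_self (X : E) : adDeriv E G X X = 0 := by
  rw [← bracket_eq_adDeriv]
  exact congrFun VectorField.mlieBracket_self (1 : G)

variable [FiniteDimensional ℝ E]

theorem ACPath.comp_eq_of_ae_leftDeriv_zero {E₂ : Type*} [NormedAddCommGroup E₂]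
    [NormedSpace ℝ E₂] {g : ℝ → G} (hg : ACPath E g) {w : ℝ → E}
    (hw : ∀ᵐ t ∂(volume.restrict (Icc (0 : ℝ) 1)), HasLeftVelocity g t (w t)) {f : G → E₂}
    (hf : ContMDiff 𝓘(ℝ, E) 𝓘(ℝ, E₂) ∞ f)
    (h : ∀ᵐ t ∂(volume.restrict (Icc (0 : ℝ) 1)), leftDeriv E E₂ f (g t) (w t) = 0) :
    ∀ t ∈ Icc (0 : ℝ) 1, f (g t) = f (g 0) := by
  refine eqOn_of_forall_eventually_eq fun t₀ ht ↦ ?_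
  obtain ⟨a, b, h₀, hab, h₁, hn, hac⟩ := ACNear.comp_contMDiffAt ht (hg.continuousOn t₀ ht)
    (mem_chart_source E (g t₀)) (hg.acNear t₀ ht) hf.contMDiffAt
  have hd : ∀ᵐ t, t ∈ uIcc a b → HasDerivAt (fun t ↦ f (g t)) 0 t := by
    rw [uIcc_of_le hab.le]
    filter_upwards [(ae_restrict_iff' measurableSet_Icc).1 h,
      (ae_restrict_iff' measurableSet_Icc).1 hw] with t h₂ h₃ ht
    have ht' : t ∈ Icc (0 : ℝ) 1 := ⟨h₀.trans ht.1, ht.2.trans h₁⟩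
    have := (h₃ ht').hasDerivAt_comp (f := f) (hf.mdifferentiable (by simp) _)
    rwa [h₂ ht'] at this
  obtain ⟨C, hC⟩ := hac.const_of_ae_hasDerivAt_zero hd
  rw [uIcc_of_le hab.le] at hC
  filter_upwards [hn] with t ht'
  exact (hC t ht').trans (hC t₀ (mem_of_mem_nhdsWithin ht hn)).symm

/-- Along the path the derivative of Ad(g) X is Ad(g) [sX, X] = 0. -/
theorem Ad_transport_constPath (X : E) (s : ℝ) {t : ℝ} (ht : t ∈ Icc (0 : ℝ) 1) :
    Ad E (transport G (constPath E (s • X)) t) X = X := by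
  have h := transports_transport (G := G) (constPath E (s • X))
  have := h.acPath.comp_eq_of_ae_leftDeriv_zero h.velocity (f := fun a : G ↦ Ad E a X)
    (contMDiff_Ad.clm_apply contMDiff_const) (by
      filter_upwards [coeFn_constPath (s • X)] with t ht
      have h1 : adDeriv E G (s • X) X = 0 := by
        rw [map_smul]
        exact (congrArg (s • ·) (adDeriv_self X)).trans (smul_zero s)
      rw [ht, leftDeriv_Ad_apply, h1, map_zero]) t ht
  rw [this, h.initial, Ad_one]
  rfl

/-- The cocycle identity, in which Ad(g_{tX}) fixes the constant control sX. -/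
theorem parallelTransport_constPath_add (X : E) (s t : ℝ) :
    (parallelTransport (constPath E ((s + t) • X)) : G) =
      parallelTransport (constPath E (s • X)) * parallelTransport (constPath E (t • X)) := by
  rw [add_smul, add_comm, map_add, parallelTransport_add]
  congr 2
  refine Lp.ext ?_
  filter_upwards [coeFn_mulPath (adTransport G (constPath E (t • X))) (constPath E (s • X)),
    coeFn_constPath (s • X), ae_restrict_mem measurableSet_Icc] with r h₁ h₂ h₃
  rw [h₁, h₂, pathExtend_of_mem _ h₃, adTransport_apply, map_smul, Ad_transport_constPath X t h₃]

theorem hasModelDerivAt_parallelTransport_constPath :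
    HasModelDerivAt (fun X : E ↦ (parallelTransport (constPath E X) : G))
      (ContinuousLinearMap.id ℝ E) 0 := by
  have := FiniteDimensional.complete ℝ E
  have h1 := contMDiffAt_parallelTransport_zero (E := E) (G := G).2.comp
    (hasModelDerivAt_iff_hasFDerivAt.2 ((constPath E).hasFDerivAt (x := 0))) (map_zero _)
  convert! h1 using 1
  ext X
  simpa using (primitive_constPath X ⟨1, by simp⟩).symm

theorem contMDiff_parallelTransport_constPath :
    ContMDiff 𝓘(ℝ, E) 𝓘(ℝ, E) ∞ (fun X : E ↦ (parallelTransport (constPath E X) : G)) :=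
  contMDiff_parallelTransport.comp (constPath E).contDiff.contMDiff

theorem isOneParameterSubgroup_parallelTransport (X : E) :
    IsOneParameterSubgroup (fun t : ℝ ↦ (parallelTransport (constPath E (t • X)) : G))
      (X : GroupLieAlgebra 𝓘(ℝ, E) G) where
  map_add := parallelTransport_constPath_add X
  contMDiff := contMDiff_parallelTransport_constPath.comp
    (contDiff_id.smul contDiff_const).contMDiff
  velocity := by
    have h1 : HasModelDerivAt (fun t : ℝ ↦ t • X) (ContinuousLinearMap.toSpanSingleton ℝ X) 0 :=
      hasModelDerivAt_iff_hasFDerivAt.2 (ContinuousLinearMap.toSpanSingleton ℝ X).hasFDerivAt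
    have h2 := ((hasModelDerivAt_parallelTransport_constPath (E := E) (G := G)).comp h1
      (zero_smul ℝ X)).modelDeriv_eq
    change modelDeriv ℝ E _ 0 1 = X
    rw [h2]
    simp

theorem IsOneParameterSubgroup.map_zero {γ : ℝ → G} {X : GroupLieAlgebra 𝓘(ℝ, E) G}
    (hγ : IsOneParameterSubgroup γ X) : γ 0 = 1 := by
  have := hγ.map_add 0 0
  rw [add_zero] at this
  exact left_eq_mul.1 this

theorem IsOneParameterSubgroup.hasLeftVelocity {γ : ℝ → G} {X : E}
    (hγ : IsOneParameterSubgroup γ (X : GroupLieAlgebra 𝓘(ℝ, E) G)) (t : ℝ) :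
    HasLeftVelocity γ t X := by
  have h0 : HasModelDerivAt γ (ContinuousLinearMap.toSpanSingleton ℝ X) 0 := by
    have h := hγ.contMDiff.contMDiffAt.hasModelDerivAt (x := (0 : ℝ))
    convert! h using 1
    ext
    exact (one_smul ℝ X).trans hγ.velocity.symm
  have h1 : HasModelDerivAt (fun s : ℝ ↦ s - t) (ContinuousLinearMap.id ℝ ℝ) t :=
    hasModelDerivAt_iff_hasFDerivAt.2 ((hasFDerivAt_id t).sub_const t)
  have h2 := (hasModelDerivAt_dleft (E := E) (γ t)).comp (h0.comp h1 (sub_self t))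
    (by rw [sub_self, hγ.map_zero])
  have h3 : (fun s ↦ γ t * γ (s - t)) = γ := by
    ext1 s
    rw [← hγ.map_add, add_sub_cancel]
  rw [h3] at h2
  unfold HasLeftVelocity
  convert! h2 using 1
  ext
  simp

/-- Both subgroups have constant left velocity X, so the quotient γ δ⁻¹ has velocity zero and is
constant. -/
theorem IsOneParameterSubgroup.eq_parallelTransport {γ : ℝ → G} {X : E}
    (hγ : IsOneParameterSubgroup γ (X : GroupLieAlgebra 𝓘(ℝ, E) G)) (t : ℝ) :
    γ t = parallelTransport (constPath E (t • X)) := by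
  have hδ := isOneParameterSubgroup_parallelTransport (G := G) X
  set δ : ℝ → G := fun t : ℝ ↦ (parallelTransport (constPath E (t • X)) : G)
  have h1 := eq_of_forall_hasModelDerivAt_zero (E₁ := E) (c := fun s ↦ γ s * (δ s)⁻¹) (fun s ↦ by
    have := (hγ.hasLeftVelocity s).mul (hδ.hasLeftVelocity s).inv
    rw [inv_inv, add_neg_cancel] at this
    unfold HasLeftVelocity at this
    rwa [_root_.map_zero, ContinuousLinearMap.toSpanSingleton_zero] at this) t 0
  have h2 : δ 0 = 1 := hδ.map_zero
  have h3 : γ 0 = 1 := hγ.map_zero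
  simp only [h3, h2, inv_one, mul_one] at h1
  exact mul_inv_eq_one.1 h1

/-- A one-parameter subgroup with velocity X exists, so the default value of `lieExp` is not taken,
and uniqueness makes the choice irrelevant. -/
theorem lieExp_eq (X : E) :
    lieExp (X : GroupLieAlgebra 𝓘(ℝ, E) G) = (parallelTransport (constPath E X) : G) := by
  have h : ∃ γ : ℝ → G, IsOneParameterSubgroup γ (X : GroupLieAlgebra 𝓘(ℝ, E) G) :=
    ⟨_, isOneParameterSubgroup_parallelTransport X⟩
  refine (dif_pos h).trans ?_
  have := h.choose_spec.eq_parallelTransport 1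
  rwa [one_smul] at this

end OneParameterSubgroups

/-! ### Smooth vector fields in charts. -/

section Fields

variable {E₁ : Type*} [NormedAddCommGroup E₁] [NormedSpace ℝ E₁]
  {M₁ : Type*} [TopologicalSpace M₁] [ChartedSpace E₁ M₁] [IsManifold 𝓘(ℝ, E₁) 1 M₁]

theorem trivializationAt_snd_eq_modelDeriv (Z : Π x : M₁, TangentSpace 𝓘(ℝ, E₁) x) {x₀ y : M₁}
    (hy : y ∈ (chartAt E₁ x₀).source) :
    (trivializationAt E₁ (TangentSpace 𝓘(ℝ, E₁)) x₀ ⟨y, Z y⟩).2 =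
      modelDeriv E₁ E₁ (extChartAt 𝓘(ℝ, E₁) x₀) y (Z y) := by
  have h := TangentBundle.continuousLinearMapAt_trivializationAt (I := 𝓘(ℝ, E₁)) hy
  refine Eq.trans ?_ (DFunLike.congr_fun h (Z y))
  rw [Trivialization.continuousLinearMapAt_apply, Trivialization.linearMapAt_apply, if_pos]
  simpa using hy

theorem contMDiffAt_field_iff {n : WithTop ℕ∞} [IsManifold 𝓘(ℝ, E₁) ∞ M₁]
    (Z : Π x : M₁, TangentSpace 𝓘(ℝ, E₁) x) (x₀ : M₁) :
    ContMDiffAt 𝓘(ℝ, E₁) 𝓘(ℝ, E₁).tangent n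
      (fun x ↦ (⟨x, Z x⟩ : TangentBundle 𝓘(ℝ, E₁) M₁)) x₀ ↔
    ContMDiffAt 𝓘(ℝ, E₁) 𝓘(ℝ, E₁) n
      (fun y ↦ modelDeriv E₁ E₁ (extChartAt 𝓘(ℝ, E₁) x₀) y (Z y)) x₀ := by
  refine (contMDiffAt_section x₀).trans ?_
  refine Filter.EventuallyEq.contMDiffAt_iff ?_
  filter_upwards [(chartAt E₁ x₀).open_source.mem_nhds (mem_chart_source _ _)] with y hy
  exact trivializationAt_snd_eq_modelDeriv Z hy

end Fields

/-! ### The projection onto the coset space. -/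

section CosetSpace

universe u v

variable {E : Type u} [NormedAddCommGroup E] [NormedSpace ℝ E]
  {G : Type v} [TopologicalSpace G] [ChartedSpace E G] [Group G] [LieGroup 𝓘(ℝ, E) ∞ G]
  {K : Subgroup G} {F : Type*} [NormedAddCommGroup F] [NormedSpace ℝ F]
  [ChartedSpace F (G ⧸ K)]

variable (E K F) in
/-- The derivative at `a` of the projection `G → G/K` in the left trivialization. -/
def projDeriv (a : G) : E →L[ℝ] F := leftDeriv E F (fun x : G ↦ (x : G ⧸ K)) a

theorem projDeriv_one : projDeriv E K F 1 = dproj E K 1 := by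
  unfold projDeriv leftDeriv
  simp only [one_mul]
  rfl

theorem projDeriv_eq (hπ : ContMDiff 𝓘(ℝ, E) 𝓘(ℝ, F) ∞ (fun a : G ↦ (a : G ⧸ K)))
    (a : G) :
    projDeriv E K F a = modelDeriv E F (fun x : G ↦ (x : G ⧸ K)) a ∘L dleft E a :=
  hπ.contMDiffAt.hasModelDerivAt.leftDeriv_eq

theorem dproj_mulInvariantVectorField (hπ : ContMDiff 𝓘(ℝ, E) 𝓘(ℝ, F) ∞ (fun a : G ↦ (a : G ⧸ K)))
    (a : G) (Y : E) :
    dproj (F := F) E K a (mulInvariantVectorField (Y : GroupLieAlgebra 𝓘(ℝ, E) G) a) =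
      projDeriv E K F a Y := by
  rw [projDeriv_eq hπ]
  rfl

theorem hasModelDerivAt_proj_mul (hπ : ContMDiff 𝓘(ℝ, E) 𝓘(ℝ, F) ∞ (fun a : G ↦ (a : G ⧸ K)))
    (a : G) :
    HasModelDerivAt (fun x : G ↦ ((a * x : G) : G ⧸ K)) (projDeriv E K F a) 1 := by
  rw [projDeriv_eq hπ]
  exact hπ.contMDiffAt.hasModelDerivAt.comp_dleft

variable [FiniteDimensional ℝ F] [IsManifold 𝓘(ℝ, F) ∞ (G ⧸ K)]

theorem projDeriv_surjective
    (hπ : IsSmoothSubmersion (E₁ := E) (E₂ := F) (fun a : G ↦ (a : G ⧸ K)))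
    (a : G) : Function.Surjective (projDeriv E K F a) := by
  rw [projDeriv_eq hπ.contMDiff]
  obtain ⟨e, he⟩ := isInvertible_dleft (E := E) a
  rw [← he]
  exact (hπ.surjective a).comp e.surjective

/-- The projection `G → G/K` has smooth local sections. -/
theorem exists_local_section_proj
    (hπ : IsSmoothSubmersion (E₁ := E) (E₂ := F) (fun a : G ↦ (a : G ⧸ K)))
    (b : G) :
    ∃ s : G ⧸ K → G, s (b : G ⧸ K) = b ∧
      (∀ᶠ y in 𝓝 (b : G ⧸ K), ContMDiffAt 𝓘(ℝ, F) 𝓘(ℝ, E) ∞ s y) ∧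
      ∀ᶠ y in 𝓝 (b : G ⧸ K), (s y : G ⧸ K) = y :=
  exists_local_section (f := fun a : G ↦ (a : G ⧸ K))
    (Eventually.of_forall fun _ ↦ hπ.contMDiff.contMDiffAt) (hπ.surjective b)

/-- Near the point, f = (f ∘ π) ∘ s for a smooth local section s. -/
theorem contMDiffAt_of_comp_proj
    (hπ : IsSmoothSubmersion (E₁ := E) (E₂ := F) (fun a : G ↦ (a : G ⧸ K)))
    {E' : Type*} [NormedAddCommGroup E'] [NormedSpace ℝ E']
    {M' : Type*} [TopologicalSpace M'] [ChartedSpace E' M'] {f : G ⧸ K → M'} {b : G}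
    (h : ContMDiffAt 𝓘(ℝ, E) 𝓘(ℝ, E') ∞ (fun a : G ↦ f a) b) :
    ContMDiffAt 𝓘(ℝ, F) 𝓘(ℝ, E') ∞ f (b : G ⧸ K) := by
  obtain ⟨s, h₁, h₂, h₃⟩ := exists_local_section_proj hπ b
  refine ContMDiffAt.congr_of_eventuallyEq (f := fun y ↦ f (s y : G ⧸ K)) ?_ ?_
  · exact ContMDiffAt.comp (I' := 𝓘(ℝ, E)) _ (g := fun a : G ↦ f a) (by rwa [h₁]) h₂.self_of_nhds
  · filter_upwards [h₃] with y hy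
    rw [hy]

theorem contMDiff_smul_coset
    (hπ : IsSmoothSubmersion (E₁ := E) (E₂ := F) (fun a : G ↦ (a : G ⧸ K)))
    (a : G) :
    ContMDiff 𝓘(ℝ, F) 𝓘(ℝ, F) ∞ (fun y : G ⧸ K ↦ a • y) := by
  intro y
  induction y using QuotientGroup.induction_on with
  | H b =>
    exact contMDiffAt_of_comp_proj hπ (hπ.contMDiff.comp
      (contMDiff_mul_left (a := a) (I := 𝓘(ℝ, E)) (n := ∞))).contMDiffAt

/-- Equivariance a · π(b x) = π(a b x), differentiated at x = 1. It reduces statements about dπ to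
the identity element. -/
theorem modelDeriv_smul_projDeriv
    (hπ : IsSmoothSubmersion (E₁ := E) (E₂ := F) (fun a : G ↦ (a : G ⧸ K)))
    (a b : G) (X : E) :
    modelDeriv F F (fun y : G ⧸ K ↦ a • y) (b : G ⧸ K) (projDeriv E K F b X) =
      projDeriv E K F (a * b) X := by
  have h1 := ((contMDiff_smul_coset hπ a).contMDiffAt.hasModelDerivAt (x := (b : G ⧸ K))).comp
    (hasModelDerivAt_proj_mul hπ.contMDiff b) (by rw [mul_one])
  have h2 : (fun x : G ↦ a • ((b * x : G) : G ⧸ K)) = fun x ↦ ((a * b * x : G) : G ⧸ K) := by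
    ext1 x
    rw [mul_assoc]
    rfl
  rw [h2] at h1
  exact (DFunLike.congr_fun (h1.unique (hasModelDerivAt_proj_mul hπ.contMDiff (a * b))) X)

theorem projDeriv_eq_zero_iff_one
    (hπ : IsSmoothSubmersion (E₁ := E) (E₂ := F) (fun a : G ↦ (a : G ⧸ K)))
    (a : G) (X : E) :
    projDeriv E K F a X = 0 ↔ projDeriv E K F 1 X = 0 := by
  constructor
  · intro h
    have := modelDeriv_smul_projDeriv hπ a⁻¹ a X
    rw [h, map_zero, inv_mul_cancel] at this
    exact this.symm
  · intro h
    have := modelDeriv_smul_projDeriv hπ a 1 X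
    rw [h, map_zero, mul_one] at this
    exact this.symm

variable [FiniteDimensional ℝ E]

theorem IsOneParameterSubgroup.hasModelDerivAt_proj
    (hπ : IsSmoothSubmersion (E₁ := E) (E₂ := F) (fun a : G ↦ (a : G ⧸ K)))
    {γ : ℝ → G} {X : E}
    (hγ : IsOneParameterSubgroup γ (X : GroupLieAlgebra 𝓘(ℝ, E) G)) (t : ℝ) :
    HasModelDerivAt (fun t ↦ (γ t : G ⧸ K))
      (ContinuousLinearMap.toSpanSingleton ℝ (projDeriv E K F (γ t) X)) t :=
  (hγ.hasLeftVelocity t).comp (hπ.contMDiff.mdifferentiable (by simp) _)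

/-- The kernel of the derivative of the projection `G → G/K` is the Lie algebra of `K`. -/
theorem projDeriv_eq_zero_iff
    (hπ : IsSmoothSubmersion (E₁ := E) (E₂ := F) (fun a : G ↦ (a : G ⧸ K)))
    (a : G) (X : E) :
    projDeriv E K F a X = 0 ↔ (X : GroupLieAlgebra 𝓘(ℝ, E) G) ∈ subgroupLieAlgebra E K := by
  rw [projDeriv_eq_zero_iff_one hπ]
  constructor
  · intro h
    -- If dπ_e X = 0, then by equivariance π ∘ γ has zero velocity at all times, so γ stays in the
    -- coset of 1, which is K.
    refine Submodule.subset_span ⟨_, isOneParameterSubgroup_parallelTransport X, fun t ↦ ?_⟩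
    have hγ := isOneParameterSubgroup_parallelTransport (G := G) X
    set γ : ℝ → G := fun t : ℝ ↦ (parallelTransport (constPath E (t • X)) : G)
    have h1 := eq_of_forall_hasModelDerivAt_zero (E₁ := F) (c := fun t ↦ (γ t : G ⧸ K))
      (fun s ↦ by
        have h2 := IsOneParameterSubgroup.hasModelDerivAt_proj hπ hγ s
        rw [(projDeriv_eq_zero_iff_one hπ (γ s) X).2 h,
          ContinuousLinearMap.toSpanSingleton_zero] at h2
        exact h2) 0 t
    have h3 : γ 0 = 1 := hγ.map_zero
    rw [h3] at h1
    have h4 := QuotientGroup.eq.1 h1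
    rwa [inv_one, one_mul] at h4
  · intro h
    let L : GroupLieAlgebra 𝓘(ℝ, E) G →ₗ[ℝ] F := (projDeriv E K F 1).toLinearMap
    suffices subgroupLieAlgebra E K ≤ LinearMap.ker L from this h
    refine Submodule.span_le.2 ?_
    rintro Y ⟨γ, hγ, hK⟩
    have h1 := IsOneParameterSubgroup.hasModelDerivAt_proj hπ hγ 0
    have h2 : (fun t ↦ (γ t : G ⧸ K)) = fun _ ↦ ((1 : G) : G ⧸ K) := by
      ext1 t
      exact QuotientGroup.eq.2 (by simpa using hK t)
    have h3 : γ 0 = 1 := hγ.map_zero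
    rw [h2, h3] at h1
    have h4 := DFunLike.congr_fun (h1.unique (hasModelDerivAt_const _ _)) 1
    rw [ContinuousLinearMap.toSpanSingleton_apply, one_smul] at h4
    exact h4

theorem projDeriv_bijective
    (hπ : IsSmoothSubmersion (E₁ := E) (E₂ := F) (fun a : G ↦ (a : G ⧸ K)))
    {p : Submodule ℝ E}
    (hp : IsCompl (subgroupLieAlgebra E K) (p : Submodule ℝ (GroupLieAlgebra 𝓘(ℝ, E) G)))
    (a : G) : Function.Bijective (projDeriv E K F a ∘L p.subtypeL) := by
  constructor
  · rw [injective_iff_map_eq_zero]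
    intro ξ h
    have h1 := (projDeriv_eq_zero_iff hπ a ξ).1 h
    have h2 := Submodule.disjoint_def.1 hp.disjoint _ h1 ξ.2
    exact Subtype.ext h2
  · intro v
    obtain ⟨X, rfl⟩ := projDeriv_surjective hπ a v
    obtain ⟨Y, hY, ξ, hξ, h⟩ := Submodule.mem_sup.1
      (hp.sup_eq_top ▸ Submodule.mem_top : (X : GroupLieAlgebra 𝓘(ℝ, E) G) ∈ _)
    refine ⟨⟨ξ, hξ⟩, ?_⟩
    have h1 := (projDeriv_eq_zero_iff hπ a Y).2 hY
    have h2 : projDeriv E K F a X = projDeriv E K F a Y + projDeriv E K F a ξ := by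
      rw [← map_add]
      exact congrArg _ h.symm
    rw [h2, h1, zero_add]
    rfl

end CosetSpace

/-! ### Extension of local fields, and the Leibniz rule for finite combinations. -/

section ManifoldFields

variable {E₁ : Type*} [NormedAddCommGroup E₁] [NormedSpace ℝ E₁]
  {M₁ : Type*} [TopologicalSpace M₁] [ChartedSpace E₁ M₁] [IsManifold 𝓘(ℝ, E₁) ∞ M₁]

/-- A local smooth vector field agrees near a given point with a global one. -/
theorem exists_isSmoothField_eventuallyEq [FiniteDimensional ℝ E₁] [T2Space M₁]
    (Z : Π x : M₁, TangentSpace 𝓘(ℝ, E₁) x) (x₀ : M₁)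
    (hZ : ∀ᶠ x in 𝓝 x₀, ContMDiffAt 𝓘(ℝ, E₁) 𝓘(ℝ, E₁).tangent ∞
      (fun x ↦ (⟨x, Z x⟩ : TangentBundle 𝓘(ℝ, E₁) M₁)) x) :
    ∃ W : Π x : M₁, TangentSpace 𝓘(ℝ, E₁) x, IsSmoothField W ∧ ∀ᶠ x in 𝓝 x₀, W x = Z x := by
  obtain ⟨U, hU, hUo, hxU⟩ := eventually_nhds_iff.1 hZ
  obtain ⟨ψ, -, hψ⟩ := (SmoothBumpFunction.nhds_basis_tsupport (I := 𝓘(ℝ, E₁)) x₀).mem_iff.1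
    (hUo.mem_nhds hxU)
  refine ⟨fun x ↦ ψ x • Z x, ?_, ?_⟩
  · exact ContMDiffOn.smul_section_of_tsupport (ψ := ψ) (s := Z)
      ψ.contMDiff.contMDiffOn hUo hψ (fun x hx ↦ (hU x hx).contMDiffWithinAt)
  · filter_upwards [ψ.eventuallyEq_one] with x hx
    rw [hx, Pi.one_apply, one_smul]

theorem CovariantDerivative.sum_smul
    (cov : CovariantDerivative 𝓘(ℝ, E₁) E₁ (TangentSpace 𝓘(ℝ, E₁) : M₁ → Type _))
    {ι : Type*} (s : Finset ι) {f : ι → M₁ → ℝ} {W : ι → Π x : M₁, TangentSpace 𝓘(ℝ, E₁) x} {x : M₁}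
    (hf : ∀ i, MDifferentiableAt 𝓘(ℝ, E₁) 𝓘(ℝ, ℝ) (f i) x)
    (hW : ∀ i, MDifferentiableAt 𝓘(ℝ, E₁) 𝓘(ℝ, E₁).tangent
      (fun y ↦ (⟨y, W i y⟩ : TangentBundle 𝓘(ℝ, E₁) M₁)) x) (v : TangentSpace 𝓘(ℝ, E₁) x) :
    cov (fun y ↦ ∑ i ∈ s, f i y • W i y) x v =
      ∑ i ∈ s, (f i x • cov (W i) x v + modelDeriv E₁ ℝ (f i) x v • W i x) := by
  classical
  induction s using Finset.induction_on with
  | empty =>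
    simp only [Finset.sum_empty]
    exact DFunLike.congr_fun (cov.isCovariantDerivativeOnUniv.zero (x := x)) v
  | insert i s hi ih =>
    simp only [Finset.sum_insert hi]
    have h1 : MDifferentiableAt 𝓘(ℝ, E₁) 𝓘(ℝ, E₁).tangent
      (fun y ↦ (⟨y, f i y • W i y⟩ : TangentBundle 𝓘(ℝ, E₁) M₁)) x :=
      (hf i).smul_section (hW i)
    have h2 : MDifferentiableAt 𝓘(ℝ, E₁) 𝓘(ℝ, E₁).tangent
      (fun y ↦ (⟨y, ∑ i ∈ s, f i y • W i y⟩ : TangentBundle 𝓘(ℝ, E₁) M₁)) x :=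
      MDifferentiableAt.sum_section fun j _ ↦ (hf j).smul_section (hW j)
    have h3 := cov.isCovariantDerivativeOnUniv.add h1 h2
    have h4 := cov.isCovariantDerivativeOnUniv.leibniz (hW i) (hf i)
    refine (DFunLike.congr_fun h3 v).trans ?_
    refine congrArg₂ (· + ·) ?_ ih
    exact DFunLike.congr_fun h4 v

end ManifoldFields

/-! ### Smoothness of fields on G/K and of their lifts to G. -/

section CosetSpace

universe u v

variable {E : Type u} [NormedAddCommGroup E] [NormedSpace ℝ E]
  {G : Type v} [TopologicalSpace G] [ChartedSpace E G] [Group G] [LieGroup 𝓘(ℝ, E) ∞ G]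
  {K : Subgroup G} {F : Type*} [NormedAddCommGroup F] [NormedSpace ℝ F]
  [ChartedSpace F (G ⧸ K)] [FiniteDimensional ℝ F] [IsManifold 𝓘(ℝ, F) ∞ (G ⧸ K)]

theorem contMDiffAt_extChartAt_proj
    (hπ : ContMDiff 𝓘(ℝ, E) 𝓘(ℝ, F) ∞ (fun a : G ↦ (a : G ⧸ K))) {y : G ⧸ K} {b : G}
    (hb : (b : G ⧸ K) ∈ (chartAt F y).source) :
    ContMDiffAt 𝓘(ℝ, E) 𝓘(ℝ, F) ∞ (fun a : G ↦ extChartAt 𝓘(ℝ, F) y (a : G ⧸ K)) b :=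
  (contMDiffAt_extChartAt' hb).comp b hπ.contMDiffAt

theorem leftDeriv_extChartAt_proj
    (hπ : ContMDiff 𝓘(ℝ, E) 𝓘(ℝ, F) ∞ (fun a : G ↦ (a : G ⧸ K))) {y : G ⧸ K} {b : G}
    (hb : (b : G ⧸ K) ∈ (chartAt F y).source) :
    leftDeriv E F (fun a : G ↦ extChartAt 𝓘(ℝ, F) y (a : G ⧸ K)) b =
      modelDeriv F F (extChartAt 𝓘(ℝ, F) y) (b : G ⧸ K) ∘L projDeriv E K F b := by
  have h : ContMDiffAt 𝓘(ℝ, F) 𝓘(ℝ, F) ∞ (extChartAt 𝓘(ℝ, F) y) (b : G ⧸ K) :=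
    contMDiffAt_extChartAt' hb
  exact (h.hasModelDerivAt.comp (hasModelDerivAt_proj_mul hπ b) (by rw [mul_one])).modelDeriv_eq

theorem eventually_mem_chart_source
    (hπ : ContMDiff 𝓘(ℝ, E) 𝓘(ℝ, F) ∞ (fun a : G ↦ (a : G ⧸ K))) (a : G) :
    ∀ᶠ b in 𝓝 a, ((b : G) : G ⧸ K) ∈ (chartAt F (a : G ⧸ K)).source :=
  hπ.continuous.continuousAt.preimage_mem_nhds
    ((chartAt F (a : G ⧸ K)).open_source.mem_nhds (mem_chart_source _ _))

/-- The vector field on `G/K` induced by a function on `G` with values in the Lie algebra, along a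
local section of the projection, is smooth. -/
theorem contMDiffAt_projDeriv_section
    (hπ : ContMDiff 𝓘(ℝ, E) 𝓘(ℝ, F) ∞ (fun a : G ↦ (a : G ⧸ K)))
    {e : G ⧸ K → G} {η : G ⧸ K → E} {Z : Π y : G ⧸ K, TangentSpace 𝓘(ℝ, F) y} {y₁ : G ⧸ K}
    (he : ContMDiffAt 𝓘(ℝ, F) 𝓘(ℝ, E) ∞ e y₁) (hη : ContMDiffAt 𝓘(ℝ, F) 𝓘(ℝ, E) ∞ η y₁)
    (hs : ∀ᶠ y in 𝓝 y₁, (e y : G ⧸ K) = y)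
    (hZ : ∀ᶠ y in 𝓝 y₁, Z y = projDeriv E K F (e y) (η y)) :
    ContMDiffAt 𝓘(ℝ, F) 𝓘(ℝ, F).tangent ∞
      (fun x ↦ (⟨x, Z x⟩ : TangentBundle 𝓘(ℝ, F) (G ⧸ K))) y₁ := by
  rw [contMDiffAt_field_iff]
  have h1 : ((e y₁ : G) : G ⧸ K) ∈ (chartAt F y₁).source := by
    rw [hs.self_of_nhds]
    exact mem_chart_source _ _
  have h2 : ContMDiffAt 𝓘(ℝ, F) 𝓘(ℝ, F) ∞
      (fun y ↦ leftDeriv E F (fun a : G ↦ extChartAt 𝓘(ℝ, F) y₁ (a : G ⧸ K)) (e y) (η y)) y₁ :=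
    ContMDiffAt.clm_apply (ContMDiffAt.comp (I' := 𝓘(ℝ, E)) _
      (g := leftDeriv E F (fun a : G ↦ extChartAt 𝓘(ℝ, F) y₁ (a : G ⧸ K)))
      (contMDiffAt_leftDeriv (contMDiffAt_extChartAt_proj hπ h1)) he) hη
  refine h2.congr_of_eventuallyEq ?_
  filter_upwards [hs, hZ, (chartAt F y₁).open_source.mem_nhds (mem_chart_source _ _)]
    with y h₁ h₂ h₃
  rw [leftDeriv_extChartAt_proj hπ (by rwa [h₁]), h₁, h₂]
  rfl

variable [FiniteDimensional ℝ E]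

/-- The horizontal lift to `G`, in the left trivialization, of a smooth vector field on `G/K` is
smooth. -/
theorem contMDiff_lift
    (hπ : IsSmoothSubmersion (E₁ := E) (E₂ := F) (fun a : G ↦ (a : G ⧸ K)))
    {p : Submodule ℝ E}
    (hp : IsCompl (subgroupLieAlgebra E K) (p : Submodule ℝ (GroupLieAlgebra 𝓘(ℝ, E) G)))
    {Z : Π y : G ⧸ K, TangentSpace 𝓘(ℝ, F) y} (hZ : IsSmoothField Z) {ζ : G → p}
    (hζ : ∀ b, projDeriv E K F b (ζ b) = Z (b : G ⧸ K)) :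
    ContMDiff 𝓘(ℝ, E) 𝓘(ℝ, p) ∞ ζ := by
  intro a
  have := FiniteDimensional.complete ℝ p
  set φ := extChartAt 𝓘(ℝ, F) (a : G ⧸ K)
  -- `Q b` is dπ_b dl_b on 𝔭, read in a fixed chart of G/K. It is invertible near a, and ζ is its
  -- inverse applied to the smooth chart expression of Z.
  set Q : G → p →L[ℝ] F := fun b ↦ leftDeriv E F (fun x : G ↦ φ (x : G ⧸ K)) b ∘L p.subtypeL
  have hQ : ContMDiffAt 𝓘(ℝ, E) 𝓘(ℝ, p →L[ℝ] F) ∞ Q a :=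
    (contMDiffAt_leftDeriv (contMDiffAt_extChartAt_proj hπ.contMDiff
      (mem_chart_source _ _))).clm_comp contMDiffAt_const
  have hQa : Q a = projDeriv E K F a ∘L p.subtypeL := by
    change leftDeriv E F (fun x : G ↦ φ (x : G ⧸ K)) a ∘L p.subtypeL = _
    rw [leftDeriv_extChartAt_proj hπ.contMDiff (mem_chart_source _ _),
      (hasModelDerivAt_extChartAt_self (a : G ⧸ K)).modelDeriv_eq]
    rfl
  let e : p ≃L[ℝ] F := (LinearEquiv.ofBijective
    (projDeriv E K F a ∘L p.subtypeL).toLinearMap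
    (projDeriv_bijective hπ hp a)).toContinuousLinearEquiv
  have he : (e : p →L[ℝ] F) = Q a := by
    rw [hQa]
    rfl
  have hinv : ContMDiffAt 𝓘(ℝ, E) 𝓘(ℝ, F →L[ℝ] p) ∞
      (fun b ↦ ContinuousLinearMap.inverse (Q b)) a := by
    refine ContMDiffAt.comp (I' := 𝓘(ℝ, p →L[ℝ] F)) a (g := ContinuousLinearMap.inverse) ?_ hQ
    rw [← he]
    exact (contDiffAt_map_inverse e).contMDiffAt
  have hz := ((contMDiffAt_field_iff Z (a : G ⧸ K)).1 hZ.contMDiffAt).comp a hπ.contMDiff.contMDiffAt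
  refine (hinv.clm_apply hz).congr_of_eventuallyEq ?_
  have hn : ∀ᶠ b in 𝓝 a, Q b ∈ range ((↑) : (p ≃L[ℝ] F) → p →L[ℝ] F) :=
    hQ.continuousAt.preimage_mem_nhds (he ▸ ContinuousLinearEquiv.nhds e)
  filter_upwards [hn, eventually_mem_chart_source hπ.contMDiff a] with b h₁ h₂
  obtain ⟨e', he'⟩ := h₁
  have h3 : Q b (ζ b) = modelDeriv F F φ (b : G ⧸ K) (Z (b : G ⧸ K)) := by
    refine (DFunLike.congr_fun (leftDeriv_extChartAt_proj hπ.contMDiff h₂) (ζ b : E)).trans ?_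
    exact congrArg (modelDeriv F F φ (b : G ⧸ K)) (hζ b)
  refine Eq.trans ?_ (congrArg (ContinuousLinearMap.inverse (Q b)) h3)
  rw [← he', ContinuousLinearMap.inverse_equiv]
  exact (e'.symm_apply_apply _).symm

end CosetSpace

/-! ### The natural torsion-free connection in terms of lifts to G. -/

section NaturalConnection

universe u v

variable {E : Type u} [NormedAddCommGroup E] [NormedSpace ℝ E] [FiniteDimensional ℝ E]
  {G : Type v} [TopologicalSpace G] [ChartedSpace E G] [Group G] [LieGroup 𝓘(ℝ, E) ∞ G] [T2Space G]
  {K : Subgroup G} {F : Type*} [NormedAddCommGroup F] [NormedSpace ℝ F]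
  [ChartedSpace F (G ⧸ K)] [FiniteDimensional ℝ F] [IsManifold 𝓘(ℝ, F) ∞ (G ⧸ K)]

/-- The section `π (exp P) ↦ exp P` of the projection `G → G/K`, for `P` near `0` in a complement
of the Lie algebra of `K`. -/
theorem exists_exp_section
    (hπ : IsSmoothSubmersion (E₁ := E) (E₂ := F) (fun a : G ↦ (a : G ⧸ K)))
    {p : Submodule ℝ E}
    (hp : IsCompl (subgroupLieAlgebra E K) (p : Submodule ℝ (GroupLieAlgebra 𝓘(ℝ, E) G))) :
    ∃ (e : G ⧸ K → G) (D : F →L[ℝ] E), e (1 : G) = 1 ∧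
      (∀ᶠ y in 𝓝 ((1 : G) : G ⧸ K), ContMDiffAt 𝓘(ℝ, F) 𝓘(ℝ, E) ∞ e y) ∧
      (∀ᶠ y in 𝓝 ((1 : G) : G ⧸ K), (e y : G ⧸ K) = y) ∧
      HasModelDerivAt e D ((1 : G) : G ⧸ K) ∧ (∀ ξ : p, D (projDeriv E K F 1 ξ) = ξ) ∧
      ∀ᶠ P : p in 𝓝 0, e (parallelTransport (constPath E (P : E)) : G) =
        parallelTransport (constPath E (P : E)) := by
  have := FiniteDimensional.complete ℝ p
  set Ψ : p → G := fun P ↦ parallelTransport (constPath E (P : E)) with hΨ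
  have hΨ0 : Ψ 0 = 1 := by
    rw [hΨ]
    simp only [Submodule.coe_zero, _root_.map_zero]
    exact parallelTransport_zero
  have hΨs : ContMDiff 𝓘(ℝ, p) 𝓘(ℝ, E) ∞ Ψ :=
    contMDiff_parallelTransport_constPath.comp p.subtypeL.contDiff.contMDiff
  have hΨd : HasModelDerivAt Ψ p.subtypeL 0 :=
    hasModelDerivAt_parallelTransport_constPath.comp
      (hasModelDerivAt_iff_hasFDerivAt.2 (p.subtypeL.hasFDerivAt (x := 0))) rfl
  let e' : p ≃L[ℝ] F := (LinearEquiv.ofBijective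
    (projDeriv E K F 1 ∘L p.subtypeL).toLinearMap
    (projDeriv_bijective hπ hp 1)).toContinuousLinearEquiv
  -- P ↦ π(exp P) has derivative dπ_e restricted to 𝔭, an isomorphism. The section is exp composed
  -- with the local inverse, so its derivative inverts dπ_e on 𝔭.
  have hfd : HasModelDerivAt (fun P ↦ (Ψ P : G ⧸ K)) (e' : p →L[ℝ] F) 0 := by
    have h1 := hasModelDerivAt_proj_mul (K := K) hπ.contMDiff 1
    simp only [one_mul] at h1
    exact h1.comp hΨd hΨ0
  obtain ⟨s, hs0, hs1, hs2, hs3⟩ := exists_local_inverse (f := fun P ↦ (Ψ P : G ⧸ K))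
    (Eventually.of_forall fun _ ↦ (hπ.contMDiff.comp hΨs).contMDiffAt) hfd
  rw [show ((Ψ 0 : G) : G ⧸ K) = (1 : G) by rw [hΨ0]] at hs0 hs1 hs2
  have hsd := hs1.self_of_nhds.hasModelDerivAt
  have hed := hΨd.comp hsd hs0
  refine ⟨fun y ↦ Ψ (s y), _, (congrArg Ψ hs0).trans hΨ0, ?_, hs2, hed, ?_, ?_⟩
  · filter_upwards [hs1] with y hy
    exact hΨs.contMDiffAt.comp y hy
  · intro ξ
    have h1 := hsd.comp hfd (by rw [hΨ0])
    have h2 := h1.unique ((hasModelDerivAt_id (0 : p)).congr_of_eventuallyEq hs3)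
    exact congrArg Subtype.val (DFunLike.congr_fun h2 ξ)
  · filter_upwards [hs3] with P hP
    exact congrArg Ψ hP

theorem projDeriv_one_pComponent
    (hπ : IsSmoothSubmersion (E₁ := E) (E₂ := F) (fun a : G ↦ (a : G ⧸ K)))
    {p : Submodule ℝ E}
    (hp : IsReductiveDecomposition K (p : Submodule ℝ (GroupLieAlgebra 𝓘(ℝ, E) G)))
    (V : GroupLieAlgebra 𝓘(ℝ, E) G) :
    projDeriv E K F 1 (pComponent hp V) = projDeriv E K F 1 V := by
  have h1 : V - pComponent hp V ∈ subgroupLieAlgebra E K := by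
    exact Submodule.sub_projection_mem hp.isCompl.symm V
  have h2 := (projDeriv_eq_zero_iff hπ 1 (V - pComponent hp V)).2 h1
  have h3 : projDeriv E K F 1 (V - pComponent hp V) =
      projDeriv E K F 1 V - projDeriv E K F 1 (pComponent hp V) := map_sub (projDeriv E K F 1) V _
  exact (sub_eq_zero.1 (h3.symm.trans h2)).symm

variable [T2Space (G ⧸ K)]

/-- The condition `cov_sharp` concerns global smooth fields that agree with Y^♯ near eK; a bump
function provides one. -/
theorem exists_isSmoothField_sharp
    (hπ : ContMDiff 𝓘(ℝ, E) 𝓘(ℝ, F) ∞ (fun a : G ↦ (a : G ⧸ K)))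
    {p : Submodule ℝ E} {e : G ⧸ K → G}
    (he : ∀ᶠ y in 𝓝 ((1 : G) : G ⧸ K), ContMDiffAt 𝓘(ℝ, F) 𝓘(ℝ, E) ∞ e y)
    (hs : ∀ᶠ y in 𝓝 ((1 : G) : G ⧸ K), (e y : G ⧸ K) = y)
    (hexp : ∀ᶠ P : p in 𝓝 0, e (parallelTransport (constPath E (P : E)) : G) =
        parallelTransport (constPath E (P : E))) (Y : E) :
    ∃ W : Π y : G ⧸ K, TangentSpace 𝓘(ℝ, F) y, IsSmoothField W ∧
      EqSharpNearBase (p : Submodule ℝ (GroupLieAlgebra 𝓘(ℝ, E) G))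
        (Y : GroupLieAlgebra 𝓘(ℝ, E) G) W ∧
      ∀ᶠ y in 𝓝 ((1 : G) : G ⧸ K), W y = projDeriv E K F (e y) Y := by
  obtain ⟨W, hW, hWe⟩ := exists_isSmoothField_eventuallyEq
    (fun y : G ⧸ K ↦ (projDeriv E K F (e y) Y : F)) ((1 : G) : G ⧸ K) (by
      filter_upwards [he, hs.eventually_nhds] with y h₁ h₂
      exact contMDiffAt_projDeriv_section hπ h₁ (contMDiffAt_const (c := Y)) h₂
        (Eventually.of_forall fun _ ↦ rfl))
  refine ⟨W, hW, ?_, hWe⟩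
  have hc : Tendsto (fun P : p ↦ ((parallelTransport (constPath E (P : E)) : G) : G ⧸ K)) (𝓝 0)
      (𝓝 ((1 : G) : G ⧸ K)) := by
    have h : Continuous (fun P : p ↦ ((parallelTransport (constPath E (P : E)) : G) : G ⧸ K)) :=
      hπ.continuous.comp
        ((contMDiff_parallelTransport_constPath (G := G)).continuous.comp p.subtypeL.continuous)
    have h0 := h.tendsto 0
    simp only [Submodule.coe_zero, _root_.map_zero] at h0
    rwa [parallelTransport_zero] at h0
  -- W consists of those P for which the section returns exp P and the global field agrees with the
  -- local one at π(exp P).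
  refine ⟨_, hexp.and (hc.eventually hWe), fun (P : p) hP ↦ ?_⟩
  have h1 := hP.2
  rw [hP.1, ← dproj_mulInvariantVectorField hπ] at h1
  have h2 := lieExp_eq (G := G) (P : E)
  have h3 : ∀ b : G, b = parallelTransport (constPath E (P : E)) →
      W (b : G ⧸ K) = dproj E K b (mulInvariantVectorField (Y : GroupLieAlgebra 𝓘(ℝ, E) G) b) := by
    rintro b rfl
    exact h1
  exact h3 _ h2

/-- With a basis Y_i of 𝔭, Z is near eK a combination of the fields Y_i^♯ with coefficients the
coordinates of ζ ∘ e. In the Leibniz rule the fields contribute ½[ξ, ζ(1)]_𝔭 and the coefficients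
dζ(ξ), since de ∘ dπ_e = id on 𝔭. Dropping the 𝔭-projection is harmless, as dπ_e kills 𝔨. -/
theorem IsNaturalTorsionFree.cov_lift_one
    (hπ : IsSmoothSubmersion (E₁ := E) (E₂ := F) (fun a : G ↦ (a : G ⧸ K)))
    {p : Submodule ℝ E}
    {hp : IsReductiveDecomposition K (p : Submodule ℝ (GroupLieAlgebra 𝓘(ℝ, E) G))}
    {cov : CovariantDerivative 𝓘(ℝ, F) F (TangentSpace 𝓘(ℝ, F) : G ⧸ K → Type _)}
    (hcov : IsNaturalTorsionFree hp cov)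
    {Z : Π y : G ⧸ K, TangentSpace 𝓘(ℝ, F) y} (hZ : IsSmoothField Z) {ζ : G → p}
    (hζ : ∀ b, projDeriv E K F b (ζ b) = Z (b : G ⧸ K)) (ξ : p) :
    cov Z ((1 : G) : G ⧸ K) (projDeriv E K F 1 ξ) =
      projDeriv E K F 1 ((1 / 2 : ℝ) • adDeriv E G ξ (ζ 1) + leftDeriv E p ζ 1 ξ) := by
  obtain ⟨e, D, he1, hes, hs, heD, hD, hexp⟩ := exists_exp_section hπ hp.isCompl
  have hζs := contMDiff_lift hπ hp.isCompl hZ hζ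
  let b := Module.finBasis ℝ p
  choose W hW hsharp hWe using fun i ↦
    exists_isSmoothField_sharp hπ.contMDiff hes hs hexp (b i : E)
  let c : Fin (Module.finrank ℝ p) → p →L[ℝ] ℝ := fun i ↦ (b.coord i).toContinuousLinearMap
  have h6 : ∀ z : p, ∑ i, c i z • (b i : E) = z := by
    intro z
    have h := congrArg p.subtypeL (b.sum_repr z)
    rw [map_sum] at h
    exact h
  have hf : ∀ i, HasModelDerivAt (fun y ↦ c i (ζ (e y))) (c i ∘L leftDeriv E p ζ 1 ∘L D)
      ((1 : G) : G ⧸ K) := by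
    intro i
    have h1 : HasModelDerivAt ζ (leftDeriv E p ζ 1) 1 := by
      unfold leftDeriv
      simp only [one_mul]
      exact hζs.contMDiffAt.hasModelDerivAt
    exact (hasModelDerivAt_iff_hasFDerivAt.2 (c i).hasFDerivAt).comp (h1.comp heD he1) rfl
  have hWd : ∀ i, MDifferentiableAt 𝓘(ℝ, F) 𝓘(ℝ, F).tangent
      (fun y ↦ (⟨y, W i y⟩ : TangentBundle 𝓘(ℝ, F) (G ⧸ K))) ((1 : G) : G ⧸ K) := fun i ↦
    (hW i).mdifferentiable (by simp) _
  have hsum : ∀ᶠ y in 𝓝 ((1 : G) : G ⧸ K),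
      Z y = ∑ i ∈ Finset.univ, (c i (ζ (e y)) • W i y : TangentSpace 𝓘(ℝ, F) y) := by
    filter_upwards [hs, eventually_all.2 hWe] with y h₁ h₂
    have h3 := hζ (e y)
    rw [h₁] at h3
    rw [← h3]
    refine Eq.trans ?_ (Finset.sum_congr rfl fun i _ ↦ congrArg (c i (ζ (e y)) • ·) (h₂ i).symm)
    conv_lhs => rw [← h6 (ζ (e y)), map_sum]
    exact Finset.sum_congr rfl fun i _ ↦ map_smul _ _ _
  have hd2 : MDifferentiableAt 𝓘(ℝ, F) 𝓘(ℝ, F).tangent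
      (fun y ↦ (⟨y, ∑ i ∈ Finset.univ, c i (ζ (e y)) • W i y⟩ : TangentBundle 𝓘(ℝ, F) (G ⧸ K)))
      ((1 : G) : G ⧸ K) :=
    MDifferentiableAt.sum_section fun i _ ↦ (hf i).mdifferentiableAt.smul_section (hWd i)
  have h1 := cov.isCovariantDerivativeOnUniv.congr_of_eventuallyEq
    (hZ.mdifferentiable (by simp) _) hd2 univ_mem hsum
  refine (DFunLike.congr_fun h1 _).trans ?_
  refine (cov.sum_smul Finset.univ (fun i ↦ (hf i).mdifferentiableAt) hWd _).trans ?_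
  have h2 : ∀ i, cov (W i) ((1 : G) : G ⧸ K) (projDeriv E K F 1 ξ) =
      projDeriv E K F 1 ((1 / 2 : ℝ) • adDeriv E G ξ (b i)) := by
    intro i
    have h3 := hcov.cov_sharp _ ξ.2 _ (b i).2 (W i) (hW i) (hsharp i)
    rw [← projDeriv_one] at h3
    refine h3.trans ?_
    rw [← bracket_eq_adDeriv]
    refine (map_smul (projDeriv E K F 1) _ _).trans ?_
    refine Eq.trans ?_ (map_smul (projDeriv E K F 1) _ _).symm
    exact congrArg _ (projDeriv_one_pComponent hπ hp _)
  have h4 : ∀ i, W i ((1 : G) : G ⧸ K) = projDeriv E K F 1 (b i) := fun i ↦ by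
    rw [(hWe i).self_of_nhds, he1]
  have h5 : ∀ i, modelDeriv F ℝ (fun y ↦ c i (ζ (e y))) ((1 : G) : G ⧸ K) (projDeriv E K F 1 ξ) =
      c i (leftDeriv E p ζ 1 ξ) := fun i ↦ by
    rw [(hf i).modelDeriv_eq]
    exact congrArg (fun z ↦ c i (leftDeriv E p ζ 1 z)) (hD ξ)
  have h7 : ∀ i, (c i (ζ (e ((1 : G) : G ⧸ K))) •
        cov (W i) ((1 : G) : G ⧸ K) (projDeriv E K F 1 ξ) +
      modelDeriv F ℝ (fun y ↦ c i (ζ (e y))) ((1 : G) : G ⧸ K) (projDeriv E K F 1 ξ) •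
        W i ((1 : G) : G ⧸ K) : F) =
      projDeriv E K F 1 (c i (ζ 1) • ((1 / 2 : ℝ) • adDeriv E G ξ (b i)) +
        c i (leftDeriv E p ζ 1 ξ) • (b i : E)) := by
    intro i
    rw [map_add, map_smul (projDeriv E K F 1) (c i (ζ 1)),
      map_smul (projDeriv E K F 1) (c i (leftDeriv E p ζ 1 ξ)), he1]
    exact congrArg₂ (· + ·) (congrArg _ (h2 i)) (congrArg₂ (· • ·) (h5 i) (h4 i))
  refine (Finset.sum_congr rfl fun i _ ↦ h7 i).trans ?_
  refine (map_sum (projDeriv E K F 1) _ _).symm.trans ?_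
  rw [Finset.sum_add_distrib, h6]
  congr 2
  conv_rhs => rw [← h6 (ζ 1), map_sum, Finset.smul_sum]
  refine Finset.sum_congr rfl fun i _ ↦ ?_
  rw [map_smul, smul_comm]

/-- The natural torsion-free connection in terms of horizontal lifts to `G`. -/
theorem IsNaturalTorsionFree.cov_lift
    (hπ : IsSmoothSubmersion (E₁ := E) (E₂ := F) (fun a : G ↦ (a : G ⧸ K)))
    {p : Submodule ℝ E}
    {hp : IsReductiveDecomposition K (p : Submodule ℝ (GroupLieAlgebra 𝓘(ℝ, E) G))}
    {cov : CovariantDerivative 𝓘(ℝ, F) F (TangentSpace 𝓘(ℝ, F) : G ⧸ K → Type _)}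
    (hcov : IsNaturalTorsionFree hp cov)
    {Z : Π y : G ⧸ K, TangentSpace 𝓘(ℝ, F) y} (hZ : IsSmoothField Z) {ζ : G → p}
    (hζ : ∀ b, projDeriv E K F b (ζ b) = Z (b : G ⧸ K)) (a : G) (ξ : p) :
    cov Z (a : G ⧸ K) (projDeriv E K F a ξ) =
      projDeriv E K F a ((1 / 2 : ℝ) • adDeriv E G ξ (ζ a) + leftDeriv E p ζ a ξ) := by
  have hζs := contMDiff_lift hπ hp.isCompl hZ hζ
  -- The translate of Z by a⁻¹. Its lift is b ↦ ζ(a b), so the formula at 1 for Z' becomes the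
  -- formula at a for Z.
  let Z' : Π y : G ⧸ K, TangentSpace 𝓘(ℝ, F) y := fun y ↦
    (modelDeriv F F (fun y : G ⧸ K ↦ a⁻¹ • y) (a • y) (Z (a • y)) : F)
  have hζ' : ∀ b, projDeriv E K F b (ζ (a * b)) = Z' (b : G ⧸ K) := by
    intro b
    have h1 := modelDeriv_smul_projDeriv hπ a⁻¹ (a * b) (ζ (a * b))
    rw [inv_mul_cancel_left] at h1
    rw [← h1]
    exact congrArg (modelDeriv F F (fun y : G ⧸ K ↦ a⁻¹ • y) ((a * b : G) : G ⧸ K)) (hζ (a * b))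
  have hZ' : IsSmoothField Z' := by
    intro y
    induction y using QuotientGroup.induction_on with
    | H b =>
      obtain ⟨s, h₁, h₂, h₃⟩ := exists_local_section_proj hπ b
      refine contMDiffAt_projDeriv_section hπ.contMDiff h₂.self_of_nhds
        (η := fun y ↦ (ζ (a * s y) : E)) ?_ h₃ ?_
      · have h4 : ContMDiff 𝓘(ℝ, E) 𝓘(ℝ, E) ∞ (fun b ↦ (ζ (a * b) : E)) :=
          p.subtypeL.contDiff.contMDiff.comp
            (hζs.comp (contMDiff_mul_left (a := a) (I := 𝓘(ℝ, E)) (n := ∞)))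
        exact h4.contMDiffAt.comp _ h₂.self_of_nhds
      · filter_upwards [h₃] with y hy
        rw [hζ', hy]
  have h1 := hcov.invariant a Z' Z hZ' hZ (by
    intro y
    induction y using QuotientGroup.induction_on with
    | H b =>
      refine (hζ (a * b)).symm.trans ?_
      rw [← modelDeriv_smul_projDeriv hπ a b, hζ' b]
      rfl) ((1 : G) : G ⧸ K) (projDeriv E K F 1 ξ)
  rw [hcov.cov_lift_one hπ hZ' hζ' ξ] at h1
  -- Invariance yields the identity at a * 1; the variable `c` allows the base point to be changed
  -- to a in all dependent types at once.
  have key : ∀ c, c = a * 1 → cov Z (c : G ⧸ K) (projDeriv E K F c ξ) =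
      projDeriv E K F c ((1 / 2 : ℝ) • adDeriv E G ξ (ζ c) + leftDeriv E p ζ c ξ) := by
    rintro c rfl
    have h2 := modelDeriv_smul_projDeriv hπ a 1 (ξ : E)
    have h3 : leftDeriv E p (fun b ↦ ζ (a * b)) 1 = leftDeriv E p ζ (a * 1) := by
      unfold leftDeriv
      simp only [mul_assoc]
    rw [h3] at h1
    refine Eq.trans ?_ (h1.trans (modelDeriv_smul_projDeriv hπ a 1 _))
    exact congrArg (cov Z ((a * 1 : G) : G ⧸ K)) h2.symm
  exact key a (mul_one a).symm

end NaturalConnection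

/-! ### Derivatives of horizontal fields on the path space. -/

section HorizontalFields

universe u v

variable {E : Type u} [NormedAddCommGroup E] [NormedSpace ℝ E]

variable (E) in
/-- The path `t ↦ (1 - t) ξ`. -/
def rampPath : E →L[ℝ] PathAlgebra E :=
  mulPath E ⟨fun t ↦ (1 - (t : ℝ)) • ContinuousLinearMap.id ℝ E, by fun_prop⟩ ∘L constPath E

theorem coeFn_rampPath (ξ : E) :
    ∀ᵐ t ∂(volume.restrict (Icc (0 : ℝ) 1)), rampPath E ξ t = (1 - t) • ξ := by
  filter_upwards [coeFn_mulPath (E := E)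
    ⟨fun t ↦ (1 - (t : ℝ)) • ContinuousLinearMap.id ℝ E, by fun_prop⟩ (constPath E ξ),
    coeFn_constPath ξ, ae_restrict_mem measurableSet_Icc] with t h₁ h₂ h₃
  refine h₁.trans ?_
  rw [h₂, pathExtend_of_mem _ h₃]
  rfl

variable [FiniteDimensional ℝ E]

/-- The mean value ½ of 1 - t is the factor ½ of the natural torsion-free connection. -/
theorem primitive_rampPath (ξ : E) :
    primitive E (rampPath E ξ) ⟨1, by simp⟩ = (1 / 2 : ℝ) • ξ := by
  have := FiniteDimensional.complete ℝ E
  rw [primitive_apply]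
  have : ∫ s in (0 : ℝ)..1, rampPath E ξ s = ∫ s in (0 : ℝ)..1, (1 - s) • ξ := by
    refine intervalIntegral.integral_congr_ae ?_
    have h := (ae_restrict_iff' measurableSet_Icc).1 (coeFn_rampPath ξ)
    filter_upwards [h] with s hs hs'
    refine hs ?_
    rw [uIoc_of_le zero_le_one] at hs'
    exact ⟨hs'.1.le, hs'.2⟩
  refine this.trans ?_
  rw [intervalIntegral.integral_smul_const]
  congr 1
  rw [intervalIntegral.integral_sub (by simp) (by simp)]
  norm_num [integral_id]

variable {G : Type v} [TopologicalSpace G] [ChartedSpace E G] [Group G] [LieGroup 𝓘(ℝ, E) ∞ G]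
  [T2Space G]

/-- The case c = ξ constant of `contDiff_adFrame`, where ∫_t^1 ξ ds = (1 - t) ξ. -/
theorem mulPath_fderiv_adFrame (u : PathAlgebra E) (ξ ζ : E) :
    mulPath E (fderiv ℝ (adFrame G) u (horizontalMap G u ξ)) (constPath E ζ) =
      mulPath E (adFrame G u) (rampPath E (adDeriv E G ξ ζ)) := by
  have := FiniteDimensional.complete ℝ E
  refine Lp.ext ?_
  filter_upwards [coeFn_mulPath (fderiv ℝ (adFrame G) u (horizontalMap G u ξ)) (constPath E ζ),
    coeFn_mulPath (adFrame G u) (rampPath E (adDeriv E G ξ ζ)), coeFn_constPath ζ,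
    coeFn_rampPath (adDeriv E G ξ ζ), ae_restrict_mem measurableSet_Icc] with t h₁ h₂ h₃ h₄ h₅
  rw [h₁, h₂, h₃, h₄, pathExtend_of_mem _ h₅, pathExtend_of_mem _ h₅]
  have h6 := (contDiff_adFrame (G := G)).2 u (constPath E ξ) ⟨t, h₅⟩
  refine (DFunLike.congr_fun h6 ζ).trans ?_
  rw [primitive_constPath, primitive_constPath, ← sub_smul]
  simp

/-- Product rule for F_v η(v): the ramp comes from the frame, the horizontal term from the
coefficient. -/
theorem hasFDerivAt_horizontalMap {η : PathAlgebra E → E} {η' : PathAlgebra E →L[ℝ] E}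
    {u : PathAlgebra E} (hη : HasFDerivAt η η' u) :
    ∃ L : PathAlgebra E →L[ℝ] PathAlgebra E,
      HasFDerivAt (fun v ↦ horizontalMap G v (η v)) L u ∧ ∀ ξ, L (horizontalMap G u ξ) =
        mulPath E (adFrame G u) (rampPath E (adDeriv E G ξ (η u))) +
          horizontalMap G u (η' (horizontalMap G u ξ)) := by
  have h1 : HasFDerivAt (adFrame (E := E) G) (fderiv ℝ (adFrame G) u) u :=
    (contDiff_adFrame.1.differentiable (by simp) u).hasFDerivAt
  have h2 := (constPath E).hasFDerivAt.comp u hη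
  refine ⟨_, (mulPath E).hasFDerivAt_of_bilinear h1 h2, fun ξ ↦ ?_⟩
  rw [← mulPath_fderiv_adFrame, add_comm]
  rfl

theorem contDiff_horizontalMap_apply (ξ : E) :
    ContDiff ℝ ∞ (fun u : PathAlgebra E ↦ horizontalMap G u ξ) :=
  ((mulPath E).flip (constPath E ξ)).contDiff.comp contDiff_adFrame.1

/-- A left inverse R of the horizontal map at u, kept fixed, gives operators A(v) = R ∘
`horizontalMap G v` with A(u) = id. They are invertible near u, and η(v) = A(v)⁻¹ R(F_v η(v)) there.
-/
theorem differentiableAt_of_horizontalMap {η : PathAlgebra E → E} {u : PathAlgebra E}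
    (h : DifferentiableAt ℝ (fun v ↦ horizontalMap G v (η v)) u) : DifferentiableAt ℝ η u := by
  have := FiniteDimensional.complete ℝ E
  let R : PathAlgebra E →L[ℝ] E := ContinuousMap.evalCLM ℝ (⟨1, by simp⟩ : Icc (0 : ℝ) 1) ∘L
    primitive E ∘L mulPath E (adFrameInv G u)
  let A : PathAlgebra E → E →L[ℝ] E := fun v ↦ R ∘L horizontalMap G v
  have hR : ∀ ξ, R (horizontalMap G u ξ) = ξ := by
    intro ξ
    change primitive E (mulPath E (adFrameInv G u) (mulPath E (adFrame G u) (constPath E ξ))) _ = ξ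
    rw [mulPath_adFrameInv_adFrame, primitive_constPath, one_smul]
  have hA : DifferentiableAt ℝ A u := by
    have h1 : DifferentiableAt ℝ (fun v : PathAlgebra E ↦ mulPath E (adFrame G v)) u :=
      (mulPath E).differentiableAt.comp u (contDiff_adFrame.1.differentiable (by simp) u)
    exact (differentiableAt_const R).clm_comp (h1.clm_comp (differentiableAt_const _))
  have hAu : A u = (ContinuousLinearEquiv.refl ℝ E : E →L[ℝ] E) := by
    ext ξ
    exact hR ξ
  have hi : DifferentiableAt ℝ (fun v ↦ ContinuousLinearMap.inverse (A v)) u := by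
    refine DifferentiableAt.comp u (g := ContinuousLinearMap.inverse) ?_ hA
    rw [hAu]
    exact (contDiffAt_map_inverse (n := 1) (ContinuousLinearEquiv.refl ℝ E)).differentiableAt
      one_ne_zero
  refine (hi.clm_apply (R.differentiableAt.comp u h)).congr_of_eventuallyEq ?_
  have hn : ∀ᶠ v in 𝓝 u, A v ∈ range ((↑) : (E ≃L[ℝ] E) → E →L[ℝ] E) :=
    hA.continuousAt.preimage_mem_nhds
      (hAu ▸ ContinuousLinearEquiv.nhds (ContinuousLinearEquiv.refl ℝ E))
  filter_upwards [hn] with v hv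
  obtain ⟨e, he⟩ := hv
  change η v = ContinuousLinearMap.inverse (A v) (A v (η v))
  rw [← he, ContinuousLinearMap.inverse_equiv]
  exact (e.symm_apply_apply _).symm

end HorizontalFields

/-! ### Φ_N as a submersion with a complementary horizontal distribution. -/

section QuotientSubmersion

universe u v

variable {E : Type u} [NormedAddCommGroup E] [NormedSpace ℝ E] [FiniteDimensional ℝ E]
  {G : Type v} [TopologicalSpace G] [ChartedSpace E G] [Group G] [LieGroup 𝓘(ℝ, E) ∞ G] [T2Space G]
  {K : Subgroup G} {F : Type*} [NormedAddCommGroup F] [NormedSpace ℝ F]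
  [ChartedSpace F (G ⧸ K)] [FiniteDimensional ℝ F] [IsManifold 𝓘(ℝ, F) ∞ (G ⧸ K)]

theorem modelDeriv_parallelTransportQuotient
    (hπ : ContMDiff 𝓘(ℝ, E) 𝓘(ℝ, F) ∞ (fun a : G ↦ (a : G ⧸ K))) (u c : PathAlgebra E) :
    modelDeriv (PathAlgebra E) F (parallelTransportQuotient K) u (mulPath E (adFrame G u) c) =
      projDeriv E K F (parallelTransport u) (primitive E c ⟨1, by simp⟩) :=
  modelDeriv_comp_parallelTransport (hπ.mdifferentiable (by simp) _) c

theorem modelDeriv_parallelTransportQuotient_horizontalMap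
    (hπ : ContMDiff 𝓘(ℝ, E) 𝓘(ℝ, F) ∞ (fun a : G ↦ (a : G ⧸ K))) (u : PathAlgebra E) (ξ : E) :
    modelDeriv (PathAlgebra E) F (parallelTransportQuotient K) u (horizontalMap G u ξ) =
      projDeriv E K F (parallelTransport u) ξ := by
  have := FiniteDimensional.complete ℝ E
  refine (modelDeriv_parallelTransportQuotient hπ u (constPath E ξ)).trans ?_
  rw [primitive_constPath, one_smul]

theorem isSmoothSubmersion_parallelTransportQuotient
    (hπ : IsSmoothSubmersion (E₁ := E) (E₂ := F) (fun a : G ↦ (a : G ⧸ K))) :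
    IsSmoothSubmersion (E₁ := PathAlgebra E) (E₂ := F)
      (parallelTransportQuotient K : PathAlgebra E → G ⧸ K) where
  contMDiff := hπ.contMDiff.comp (contMDiff_parallelTransport (E := E))
  surjective u v := by
    obtain ⟨ξ, hξ⟩ := projDeriv_surjective hπ (parallelTransport u) v
    exact ⟨horizontalMap G u ξ,
      (modelDeriv_parallelTransportQuotient_horizontalMap hπ.contMDiff u ξ).trans hξ⟩
  splits u := ContinuousLinearMap.ker_closedComplemented_of_finiteDimensional_range
    (modelDeriv (PathAlgebra E) F (parallelTransportQuotient K) u)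

variable {p : Submodule ℝ E}

theorem isSmoothDistribution_horizontalDistribution
    (hp : IsReductiveDecomposition K (p : Submodule ℝ (GroupLieAlgebra 𝓘(ℝ, E) G))) :
    IsSmoothDistribution (E₁ := PathAlgebra E) (M := PathAlgebra E)
      (horizontalDistribution K (p : Submodule ℝ (GroupLieAlgebra 𝓘(ℝ, E) G))) := by
  intro u₀
  let b := Module.finBasis ℝ p
  refine ⟨univ, univ_mem, Module.finrank ℝ p, fun i u ↦ horizontalMap G u (b i : E), fun i ↦ ?_,
    fun u _ ↦ ⟨?_, ?_⟩⟩
  · exact contMDiffOn_vectorSpace_iff_contDiffOn.2 (contDiff_horizontalMap_apply _).contDiffOn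
  · exact b.linearIndependent.map' ((horizontalMap G u).toLinearMap ∘ₗ p.subtype)
      (LinearMap.ker_eq_bot.2 ((horizontalMap_injective u).comp Subtype.val_injective))
  · have h1 : range (fun i ↦ horizontalMap G u (b i : E)) =
        ((horizontalMap G u).toLinearMap ∘ₗ p.subtype) '' range b :=
      range_comp ((horizontalMap G u).toLinearMap ∘ₗ p.subtype) b
    have h2 : Submodule.span ℝ (range fun i ↦ horizontalMap G u (b i : E)) =
        LinearMap.range ((horizontalMap G u).toLinearMap ∘ₗ p.subtype) := by
      rw [h1, Submodule.span_image, b.span_eq, Submodule.map_top]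
    refine h2.trans ?_
    refine Submodule.ext fun w ↦ Iff.trans ?_
      (mem_horizontalDistribution hp.adjointRep_mem u w).symm
    constructor
    · rintro ⟨ξ, rfl⟩
      exact ⟨ξ, ξ.2, rfl⟩
    · rintro ⟨ξ, hξ, rfl⟩
      exact ⟨⟨ξ, hξ⟩, rfl⟩

/-- On F_u 𝔭̂ the differential of Φ_N is dπ dl restricted to 𝔭, which is an isomorphism onto the
tangent space of G/K. -/
theorem isCompl_horizontalDistribution_verticalSpace
    (hπ : IsSmoothSubmersion (E₁ := E) (E₂ := F) (fun a : G ↦ (a : G ⧸ K)))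
    (hp : IsReductiveDecomposition K (p : Submodule ℝ (GroupLieAlgebra 𝓘(ℝ, E) G)))
    (u : PathAlgebra E) :
    IsCompl (horizontalDistribution K (p : Submodule ℝ (GroupLieAlgebra 𝓘(ℝ, E) G)) u)
      (verticalSpace (E₁ := PathAlgebra E) (E₂ := F) (parallelTransportQuotient K) u) := by
  constructor
  · rw [Submodule.disjoint_def]
    intro w hw hv
    obtain ⟨ξ, hξ, rfl⟩ := (mem_horizontalDistribution hp.adjointRep_mem u w).1 hw
    have h1 : projDeriv E K F (parallelTransport u) ξ = 0 :=
      (modelDeriv_parallelTransportQuotient_horizontalMap hπ.contMDiff u ξ).symm.trans hv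
    have h2 : (⟨ξ, hξ⟩ : p) = 0 :=
      (projDeriv_bijective hπ hp.isCompl (parallelTransport u)).1
        (h1.trans (_root_.map_zero (projDeriv E K F (parallelTransport u) ∘L p.subtypeL)).symm)
    have h3 : ξ = 0 := congrArg Subtype.val h2
    rw [h3]
    exact _root_.map_zero (horizontalMap G u)
  · rw [codisjoint_iff, Submodule.eq_top_iff']
    intro w
    obtain ⟨ξ, hξ⟩ := (projDeriv_bijective hπ hp.isCompl (parallelTransport u)).2
      (modelDeriv (PathAlgebra E) F (parallelTransportQuotient K) u w)
    refine Submodule.mem_sup.2 ⟨horizontalMap G u (ξ : E),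
      (mem_horizontalDistribution hp.adjointRep_mem u _).2 ⟨ξ, ξ.2, rfl⟩,
      (show PathAlgebra E from w) - horizontalMap G u (ξ : E), ?_,
      add_sub_cancel (horizontalMap G u (ξ : E)) (show PathAlgebra E from w)⟩
    change modelDeriv (PathAlgebra E) F (parallelTransportQuotient K) u
      ((show PathAlgebra E from w) - horizontalMap G u (ξ : E)) = 0
    rw [map_sub, modelDeriv_parallelTransportQuotient_horizontalMap hπ.contMDiff, sub_eq_zero]
    exact hξ.symm

end QuotientSubmersion

/-! ### The affine submersion property and the fundamental tensor. -/

section ParallelTransportSubmersion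

universe u v

variable {E : Type u} [NormedAddCommGroup E] [NormedSpace ℝ E] [FiniteDimensional ℝ E]
  {G : Type v} [TopologicalSpace G] [ChartedSpace E G] [Group G] [LieGroup 𝓘(ℝ, E) ∞ G] [T2Space G]
  {K : Subgroup G} {F : Type*} [NormedAddCommGroup F] [NormedSpace ℝ F]
  [ChartedSpace F (G ⧸ K)] [FiniteDimensional ℝ F] [IsManifold 𝓘(ℝ, F) ∞ (G ⧸ K)]
  {p : Submodule ℝ E}

theorem adDeriv_antisymm (X Y : E) : adDeriv E G X Y = -adDeriv E G Y X := by
  have h := adDeriv_self (G := G) (X + Y)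
  simp only [map_add, _root_.add_apply, adDeriv_self, zero_add, add_zero] at h
  exact eq_neg_of_add_eq_zero_right h

theorem horizontalPart_parallelTransportQuotient
    (hπ : IsSmoothSubmersion (E₁ := E) (E₂ := F) (fun a : G ↦ (a : G ⧸ K)))
    (hp : IsReductiveDecomposition K (p : Submodule ℝ (GroupLieAlgebra 𝓘(ℝ, E) G)))
    (u : PathAlgebra E) :
    horizontalPart (PathAlgebra E) F (parallelTransportQuotient K)
      (horizontalDistribution K (p : Submodule ℝ (GroupLieAlgebra 𝓘(ℝ, E) G))) u =
    (horizontalDistribution K (p : Submodule ℝ (GroupLieAlgebra 𝓘(ℝ, E) G)) u).projection _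
      (isCompl_horizontalDistribution_verticalSpace hπ hp u) :=
  dif_pos _

theorem horizontalPart_of_mem
    (hπ : IsSmoothSubmersion (E₁ := E) (E₂ := F) (fun a : G ↦ (a : G ⧸ K)))
    (hp : IsReductiveDecomposition K (p : Submodule ℝ (GroupLieAlgebra 𝓘(ℝ, E) G)))
    {u : PathAlgebra E} {w : TangentSpace 𝓘(ℝ, PathAlgebra E) u}
    (hw : w ∈ horizontalDistribution K (p : Submodule ℝ (GroupLieAlgebra 𝓘(ℝ, E) G)) u) :
    horizontalPart (PathAlgebra E) F (parallelTransportQuotient K)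
      (horizontalDistribution K (p : Submodule ℝ (GroupLieAlgebra 𝓘(ℝ, E) G))) u w = w := by
  rw [horizontalPart_parallelTransportQuotient hπ hp]
  exact Submodule.projection_apply_left _ ⟨w, hw⟩

theorem horizontalPart_mem
    (hπ : IsSmoothSubmersion (E₁ := E) (E₂ := F) (fun a : G ↦ (a : G ⧸ K)))
    (hp : IsReductiveDecomposition K (p : Submodule ℝ (GroupLieAlgebra 𝓘(ℝ, E) G)))
    {u : PathAlgebra E} (w : TangentSpace 𝓘(ℝ, PathAlgebra E) u) :
    horizontalPart (PathAlgebra E) F (parallelTransportQuotient K)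
      (horizontalDistribution K (p : Submodule ℝ (GroupLieAlgebra 𝓘(ℝ, E) G))) u w ∈
    horizontalDistribution K (p : Submodule ℝ (GroupLieAlgebra 𝓘(ℝ, E) G)) u := by
  rw [horizontalPart_parallelTransportQuotient hπ hp]
  exact Submodule.projection_apply_mem _ _

theorem verticalPart_of_mem
    (hπ : IsSmoothSubmersion (E₁ := E) (E₂ := F) (fun a : G ↦ (a : G ⧸ K)))
    (hp : IsReductiveDecomposition K (p : Submodule ℝ (GroupLieAlgebra 𝓘(ℝ, E) G)))
    {u : PathAlgebra E} {w : TangentSpace 𝓘(ℝ, PathAlgebra E) u}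
    (hw : w ∈ horizontalDistribution K (p : Submodule ℝ (GroupLieAlgebra 𝓘(ℝ, E) G)) u) :
    verticalPart (PathAlgebra E) F (parallelTransportQuotient K)
      (horizontalDistribution K (p : Submodule ℝ (GroupLieAlgebra 𝓘(ℝ, E) G))) u w = 0 :=
  sub_eq_zero.2 (horizontalPart_of_mem hπ hp hw).symm

theorem modelDeriv_horizontalPart
    (hπ : IsSmoothSubmersion (E₁ := E) (E₂ := F) (fun a : G ↦ (a : G ⧸ K)))
    (hp : IsReductiveDecomposition K (p : Submodule ℝ (GroupLieAlgebra 𝓘(ℝ, E) G)))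
    (u w : PathAlgebra E) :
    modelDeriv (PathAlgebra E) F (parallelTransportQuotient K) u
      (horizontalPart (PathAlgebra E) F (parallelTransportQuotient K)
        (horizontalDistribution K (p : Submodule ℝ (GroupLieAlgebra 𝓘(ℝ, E) G))) u w) =
    modelDeriv (PathAlgebra E) F (parallelTransportQuotient K) u w := by
  rw [horizontalPart_parallelTransportQuotient hπ hp]
  have h := Submodule.sub_projection_mem
    (isCompl_horizontalDistribution_verticalSpace hπ hp u) w
  exact (sub_eq_zero.1 ((map_sub (modelDeriv (PathAlgebra E) F (parallelTransportQuotient K) u)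
    w _).symm.trans h)).symm

/-- Horizontal lifts are F_u ζ(Φ(u)) with ζ the 𝔭-valued lift to G, so lifting to the path space
factors through G. -/
theorem eq_horizontalMap_of_isHorizontalLift
    (hπ : IsSmoothSubmersion (E₁ := E) (E₂ := F) (fun a : G ↦ (a : G ⧸ K)))
    (hp : IsReductiveDecomposition K (p : Submodule ℝ (GroupLieAlgebra 𝓘(ℝ, E) G)))
    {X : Π y : G ⧸ K, TangentSpace 𝓘(ℝ, F) y} {X' : PathAlgebra E → PathAlgebra E}
    (hX : IsHorizontalLift (E₁ := PathAlgebra E) (parallelTransportQuotient K)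
      (horizontalDistribution K (p : Submodule ℝ (GroupLieAlgebra 𝓘(ℝ, E) G))) X X')
    {ζ : G → p} (hζ : ∀ b, projDeriv E K F b (ζ b) = X (b : G ⧸ K)) (u : PathAlgebra E) :
    X' u = horizontalMap G u (ζ (parallelTransport u)) := by
  obtain ⟨h1, h2⟩ := hX u
  obtain ⟨ξ, hξ, h⟩ := (mem_horizontalDistribution hp.adjointRep_mem u (X' u)).1 h1
  have h3 : projDeriv E K F (parallelTransport u) ξ =
      projDeriv E K F (parallelTransport u) (ζ (parallelTransport u)) := by
    refine (modelDeriv_parallelTransportQuotient_horizontalMap hπ.contMDiff u ξ).symm.trans ?_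
    rw [h]
    exact h2.trans (hζ (parallelTransport u)).symm
  have h4 : (⟨ξ, hξ⟩ : p) = ζ (parallelTransport u) :=
    (projDeriv_bijective hπ hp.isCompl (parallelTransport u)).1 h3
  rw [← h, ← h4]

theorem exists_lift
    (hπ : IsSmoothSubmersion (E₁ := E) (E₂ := F) (fun a : G ↦ (a : G ⧸ K)))
    (hp : IsReductiveDecomposition K (p : Submodule ℝ (GroupLieAlgebra 𝓘(ℝ, E) G)))
    (X : Π y : G ⧸ K, TangentSpace 𝓘(ℝ, F) y) :
    ∃ ζ : G → p, ∀ b, projDeriv E K F b (ζ b) = X (b : G ⧸ K) :=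
  ⟨_, fun b ↦ ((projDeriv_bijective hπ hp.isCompl b).2 (X (b : G ⧸ K))).choose_spec⟩

theorem isAffineSubmersion_parallelTransportQuotient [T2Space (G ⧸ K)]
    (hπ : IsSmoothSubmersion (E₁ := E) (E₂ := F) (fun a : G ↦ (a : G ⧸ K)))
    {hp : IsReductiveDecomposition K (p : Submodule ℝ (GroupLieAlgebra 𝓘(ℝ, E) G))}
    {cov : CovariantDerivative 𝓘(ℝ, F) F (TangentSpace 𝓘(ℝ, F) : G ⧸ K → Type _)}
    (hcov : IsNaturalTorsionFree hp cov) :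
    IsAffineSubmersion (flatConnection (PathAlgebra E)) cov (parallelTransportQuotient K)
      (horizontalDistribution K (p : Submodule ℝ (GroupLieAlgebra 𝓘(ℝ, E) G))) where
  submersion := isSmoothSubmersion_parallelTransportQuotient hπ
  smooth := isSmoothDistribution_horizontalDistribution hp
  isCompl := isCompl_horizontalDistribution_verticalSpace hπ hp
  lift_cov X Z X' Z' _ hZ hX' hZ' u := by
    refine ⟨horizontalPart_mem hπ hp _, ?_⟩
    obtain ⟨ξ, hξ⟩ := exists_lift hπ hp X
    obtain ⟨ζ, hζ⟩ := exists_lift hπ hp Z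
    have hζs := contMDiff_lift hπ hp.isCompl hZ hζ
    have h1 := eq_horizontalMap_of_isHorizontalLift hπ hp hX' hξ u
    have h2 : Z' = fun u : PathAlgebra E ↦ horizontalMap G u (ζ (parallelTransport u) : E) :=
      funext fun u ↦ eq_horizontalMap_of_isHorizontalLift hπ hp hZ' hζ u
    have hη : ContMDiff 𝓘(ℝ, PathAlgebra E) 𝓘(ℝ, p) ∞
        (fun v : PathAlgebra E ↦ ζ (parallelTransport v)) := hζs.comp contMDiff_parallelTransport
    have hη1 : HasFDerivAt (fun v : PathAlgebra E ↦ ζ (parallelTransport v))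
        (modelDeriv (PathAlgebra E) p (fun v ↦ ζ (parallelTransport v)) u) u :=
      hasModelDerivAt_iff_hasFDerivAt.1 hη.contMDiffAt.hasModelDerivAt
    obtain ⟨L, hL, hL'⟩ := hasFDerivAt_horizontalMap (G := G) (p.subtypeL.hasFDerivAt.comp u hη1)
    -- The vertical part is killed by dΦ_N, so the projection can be dropped before computing the
    -- image.
    refine (modelDeriv_horizontalPart hπ hp u _).trans ?_
    have h3 : (flatConnection (PathAlgebra E) Z' u (X' u) : PathAlgebra E) =
        L (horizontalMap G u (ξ (parallelTransport u))) := by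
      subst h2
      exact congrArg₂ (fun (A : PathAlgebra E →L[ℝ] PathAlgebra E) x ↦ A x) hL.fderiv h1
    -- Since η = ζ ∘ Φ and dΦ_u(F_u ξ) = dl_{Φ(u)} ξ, the coefficient term becomes the derivative of
    -- ζ on G.
    have h4 : modelDeriv (PathAlgebra E) p (fun v ↦ ζ (parallelTransport v)) u
        (horizontalMap G u (ξ (parallelTransport u))) =
          leftDeriv E p ζ (parallelTransport u) (ξ (parallelTransport u)) := by
      have := FiniteDimensional.complete ℝ E
      refine (modelDeriv_comp_parallelTransport (hζs.mdifferentiable (by simp) _)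
        (constPath E (ξ (parallelTransport u) : E))).trans ?_
      rw [primitive_constPath, one_smul]
    refine (congrArg (modelDeriv (PathAlgebra E) F (parallelTransportQuotient K) u) h3).trans ?_
    rw [hL', map_add, modelDeriv_parallelTransportQuotient hπ.contMDiff,
      modelDeriv_parallelTransportQuotient_horizontalMap hπ.contMDiff, primitive_rampPath,
      ← map_add]
    have h5 := hcov.cov_lift hπ hZ hζ (parallelTransport u) (ξ (parallelTransport u))
    rw [hξ] at h5
    refine Eq.trans ?_ h5.symm
    rw [← h4]
    rfl

/-- For horizontal X = F ξ and Y = F ζ at u, D_X Y is F_u((1 - t)[ξ, ζ]) plus a horizontal vector.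
Only the first term survives the vertical projection, and it is skew in ξ and ζ. -/
theorem fundamentalTensorAlternating_parallelTransportQuotient
    (hπ : IsSmoothSubmersion (E₁ := E) (E₂ := F) (fun a : G ↦ (a : G ⧸ K)))
    (hp : IsReductiveDecomposition K (p : Submodule ℝ (GroupLieAlgebra 𝓘(ℝ, E) G))) :
    FundamentalTensorAlternating F (flatConnection (PathAlgebra E)) (parallelTransportQuotient K)
      (horizontalDistribution K (p : Submodule ℝ (GroupLieAlgebra 𝓘(ℝ, E) G))) := by
  set H := horizontalDistribution K (p : Submodule ℝ (GroupLieAlgebra 𝓘(ℝ, E) G))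
  have key : ∀ (X Y : PathAlgebra E → PathAlgebra E) (u : PathAlgebra E) (ξ ζ : E),
      IsSmoothField (E₁ := PathAlgebra E) (M := PathAlgebra E) Y →
      (∀ x, X x ∈ H x) → (∀ x, Y x ∈ H x) → horizontalMap G u ξ = X u →
      horizontalMap G u ζ = Y u →
      fundamentalTensor (E₁ := PathAlgebra E) F (flatConnection (PathAlgebra E))
        (parallelTransportQuotient K) H X Y u =
      verticalPart (PathAlgebra E) F (parallelTransportQuotient K) H u
        (mulPath E (adFrame G u) (rampPath E (adDeriv E G ξ ζ))) := by
    intro X Y u ξ ζ hY hXH hYH hξ hζ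
    choose η hηp hη using fun x ↦ (mem_horizontalDistribution hp.adjointRep_mem x (Y x)).1 (hYH x)
    have hY1 : Y = fun v ↦ horizontalMap G v (η v) := funext fun v ↦ (hη v).symm
    have hηζ : η u = ζ := horizontalMap_injective u ((hη u).trans hζ.symm)
    have hYd : DifferentiableAt ℝ Y u := differentiableAt_of_section (hY.mdifferentiable (by simp) u)
    have hηd : DifferentiableAt ℝ η u := differentiableAt_of_horizontalMap (G := G) (by
      rwa [← hY1])
    obtain ⟨L, hL, hL'⟩ := hasFDerivAt_horizontalMap (G := G) hηd.hasFDerivAt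
    -- A linear projection onto 𝔭 fixes η, hence also its derivative, which therefore takes values
    -- in 𝔭.
    have hp' : ∀ w, fderiv ℝ η u w ∈ p := by
      intro w
      obtain ⟨P, hP⟩ := p.subtype.exists_leftInverse_of_injective p.ker_subtype
      have h1 : (fun v ↦ (p.subtype ∘ₗ P).toContinuousLinearMap (η v)) = η := by
        ext1 v
        exact congrArg Subtype.val (DFunLike.congr_fun hP ⟨η v, hηp v⟩)
      have h2 := (p.subtype ∘ₗ P).toContinuousLinearMap.hasFDerivAt.comp u hηd.hasFDerivAt
      have h3 := (h2.congr_of_eventuallyEq (Eventually.of_forall (congrFun h1.symm))).unique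
        hηd.hasFDerivAt
      rw [← h3]
      exact (P _).2
    have hX1 : horizontalPart (PathAlgebra E) F (parallelTransportQuotient K) H u (X u) = X u :=
      horizontalPart_of_mem hπ hp (hXH u)
    have hYh : (fun y ↦ horizontalPart (PathAlgebra E) F (parallelTransportQuotient K) H y (Y y)) =
        Y := funext fun y ↦ horizontalPart_of_mem hπ hp (hYH y)
    have hYv : (fun y ↦ verticalPart (PathAlgebra E) F (parallelTransportQuotient K) H y (Y y)) =
        fun _ ↦ (0 : PathAlgebra E) :=
      funext fun y ↦ verticalPart_of_mem hπ hp (hYH y)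
    have h1 : (flatConnection (PathAlgebra E) Y u (X u) : PathAlgebra E) =
        mulPath E (adFrame G u) (rampPath E (adDeriv E G ξ ζ)) +
          horizontalMap G u (fderiv ℝ η u (horizontalMap G u ξ)) := by
      rw [← hηζ, ← hL', hξ]
      subst hY1
      exact congrArg (fun A : PathAlgebra E →L[ℝ] PathAlgebra E ↦ A (X u)) hL.fderiv
    have h2 : (flatConnection (PathAlgebra E) (fun _ ↦ (0 : PathAlgebra E)) u (X u) :
        PathAlgebra E) = 0 :=
      congrArg (fun A : PathAlgebra E →L[ℝ] PathAlgebra E ↦ A (X u))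
        (fderiv_const_apply (0 : PathAlgebra E))
    have h3 : fundamentalTensor (E₁ := PathAlgebra E) F (flatConnection (PathAlgebra E))
        (parallelTransportQuotient K) H X Y u =
        verticalPart (PathAlgebra E) F (parallelTransportQuotient K) H u
          (flatConnection (PathAlgebra E) Y u (X u)) +
        horizontalPart (PathAlgebra E) F (parallelTransportQuotient K) H u
          (flatConnection (PathAlgebra E) (fun _ ↦ (0 : PathAlgebra E)) u (X u)) := by
      unfold fundamentalTensor
      exact congrArg₂ (· + ·)
        (congrArg (verticalPart (PathAlgebra E) F (parallelTransportQuotient K) H u)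
          (congrArg₂ (fun A x ↦ (flatConnection (PathAlgebra E) A u x : PathAlgebra E)) hYh hX1))
        (congrArg (horizontalPart (PathAlgebra E) F (parallelTransportQuotient K) H u)
          (congrArg₂ (fun A x ↦ (flatConnection (PathAlgebra E) A u x : PathAlgebra E)) hYv hX1))
    refine h3.trans ?_
    refine (congrArg₂ (· + ·)
      ((congrArg (verticalPart (PathAlgebra E) F (parallelTransportQuotient K) H u) h1).trans
        (map_add (verticalPart (PathAlgebra E) F (parallelTransportQuotient K) H u) _ _))
      ((congrArg (horizontalPart (PathAlgebra E) F (parallelTransportQuotient K) H u) h2).trans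
        (_root_.map_zero (horizontalPart (PathAlgebra E) F (parallelTransportQuotient K) H u)))).trans
      ?_
    have h4 : verticalPart (PathAlgebra E) F (parallelTransportQuotient K) H u
        (horizontalMap G u (fderiv ℝ η u (horizontalMap G u ξ))) = 0 :=
      verticalPart_of_mem hπ hp
        ((mem_horizontalDistribution hp.adjointRep_mem u _).2 ⟨_, hp' _, rfl⟩)
    refine (add_zero _).trans ?_
    refine (congrArg (_ + ·) h4).trans (add_zero _)
  intro X Y hX hY hXH hYH u
  obtain ⟨ξ, -, hξ⟩ := (mem_horizontalDistribution hp.adjointRep_mem u (X u)).1 (hXH u)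
  obtain ⟨ζ, -, hζ⟩ := (mem_horizontalDistribution hp.adjointRep_mem u (Y u)).1 (hYH u)
  refine (key X Y u ξ ζ hY hXH hYH hξ hζ).trans ?_
  refine Eq.trans ?_ (congrArg Neg.neg (key Y X u ζ ξ hX hYH hXH hζ hξ)).symm
  refine Eq.trans ?_
    (map_neg (verticalPart (PathAlgebra E) F (parallelTransportQuotient K) H u) _)
  refine congrArg (verticalPart (PathAlgebra E) F (parallelTransportQuotient K) H u) ?_
  rw [adDeriv_antisymm, map_neg, map_neg]
  rfl

end ParallelTransportSubmersion

theorem theorem1p1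
    {E : Type*} [NormedAddCommGroup E] [NormedSpace ℝ E] [FiniteDimensional ℝ E]
    {G : Type*} [TopologicalSpace G] [ChartedSpace E G] [Group G] [LieGroup 𝓘(ℝ, E) ∞ G]
    [T2Space G] [ConnectedSpace G]
    (K : Subgroup G) (hK : IsClosed (K : Set G))
    {F : Type*} [NormedAddCommGroup F] [NormedSpace ℝ F] [FiniteDimensional ℝ F]
    [ChartedSpace F (G ⧸ K)] [IsManifold 𝓘(ℝ, F) ∞ (G ⧸ K)]
    (hπ : IsSmoothSubmersion (E₁ := E) (E₂ := F) (fun a : G ↦ (a : G ⧸ K)))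
    (𝔭 : Submodule ℝ (GroupLieAlgebra 𝓘(ℝ, E) G)) (h𝔭 : IsReductiveDecomposition K 𝔭)
    (covN : CovariantDerivative 𝓘(ℝ, F) F (TangentSpace 𝓘(ℝ, F) : G ⧸ K → Type _))
    (hcovN : IsNaturalTorsionFree h𝔭 covN) :
    (∀ g ∈ pathSpace E (univ ×ˢ (K : Set G)),
      horizontalDistribution K 𝔭 (gaugeAction g 0) = adConstPaths g 𝔭) ∧
    IsAffineSubmersion (flatConnection (PathAlgebra E)) covN
      (parallelTransportQuotient K) (horizontalDistribution K 𝔭) ∧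
    FundamentalTensorAlternating F (flatConnection (PathAlgebra E))
      (parallelTransportQuotient K) (horizontalDistribution K 𝔭) := by
  have := topologicalGroup_of_lieGroup 𝓘(ℝ, E) ∞ (G := G)
  have : IsClosed (K : Set G) := hK
  -- Closedness of K makes G/K Hausdorff, which the extension of local fields by bump functions
  -- requires.
  have : T2Space (G ⧸ K) := inferInstance
  exact ⟨fun g hg ↦ horizontalDistribution_gaugeAction h𝔭.adjointRep_mem hg,
    isAffineSubmersion_parallelTransportQuotient hπ hcovN,
    fundamentalTensorAlternating_parallelTransportQuotient hπ h𝔭⟩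

end
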